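/- Let $\mathfrak g=\bigoplus_{p\in\mathbb Z}\mathfrak g_p$ be a graded Lie algebra over $\mathbb R$: a graded real vector space (of arbitrary dimension) with a bilinear bracket such that $[\mathfrak g_p,\mathfrak g_q]\subset\mathfrak g_{p+q}$ and, for homogeneous $a,b,c$ of degrees $|a|,|b|,|c|$, $$[a,b]+(-1)^{|a||b|}[b,a]=0,\qquad (-1)^{|a||c|}[[a,b],c]+(-1)^{|b||a|}[[b,c],a]+(-1)^{|c||b|}[[c,a],b]=0.$$ Let $\mathcal U(\mathfrak g)$ be its enveloping algebra, the quotient of the tensor algebra of $\mathfrak g$ by the relations $a\otimes b-(-1)^{|a||b|}b\otimes a=[a,b]$ ($a,b$ homogeneous), and let $\partial_0:\mathcal U(\mathfrak g)\to\mathbb R$ be the augmentation, i.e. the morphism of unital algebras vanishing on $\mathfrak g$; $\mathbb R$ is the trivial $\mathcal U(\mathfrak g)$-module, on which $\mathcal U(\mathfrak g)$ acts through $\partial_0$. Let $\wedge^n\mathfrak g$ be the $n$-th graded exterior power, the quotient of $\otimes^n\mathfrak g$ by the relations $\dots\otimes a\otimes b\otimes\dots=-(-1)^{|a||b|}\dots\otimes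 b\otimes a\otimes\dots$. For $n\ge 1$ let $\partial_n:\mathcal U(\mathfrak g)\otimes\wedge^n\mathfrak g\to\mathcal U(\mathfrak g)\otimes\wedge^{n-1}\mathfrak g$ be the morphism of left $\mathcal U(\mathfrak g)$-modules given on homogeneous $a_1,\dots,a_n\in\mathfrak g$ by $$\partial_n(u\otimes a_1\wedge\dots\wedge a_n)=\sum_{i=1}^n(-1)^{i+1}\varepsilon_i\,ua_i\otimes a_1\wedge\dots\widehat{a_i}\dots\wedge a_n+\sum_{i<j}(-1)^{i+j}\varepsilon_{ij}\,u\otimes[a_i,a_j]\wedge a_1\wedge\dots\widehat{a_i}\dots\widehat{a_j}\dots\wedge a_n,$$ where $\varepsilon_i=\prod_{k<i}(-1)^{|a_k||a_i|}$ and $\varepsilon_{ij}=\prod_{k<i}(-1)^{|a_k||a_i|}\prod_{k<j,\,k\ne i}(-1)^{|a_k||a_j|}$ are the Koszul signs of the permutations $(i,1,\dots\hat\imath\dots,n)$ and $(i,j,1,\dots\hat\imath\dots\hat\jmath\dots,n)$. Then the Koszul complex $$0\longleftarrow\mathbb R\stackrel{\partial_0}{\longleftarrow}\mathcal U(\mathfrak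 g)\stackrel{\partial_1}{\longleftarrow}\mathcal U(\mathfrak g)\otimes\mathfrak g\stackrel{\partial_2}{\longleftarrow}\dots\stackrel{\partial_n}{\longleftarrow}\mathcal U(\mathfrak g)\otimes\wedge^n\mathfrak g\stackrel{\partial_{n+1}}{\longleftarrow}\dots$$ is exact, i.e. $\partial_0$ is surjective and $\ker\partial_n=\operatorname{im}\partial_{n+1}$ for every $n\ge0$; so it is a resolution of the trivial module $\mathbb R$. -/

import Mathlib

open scoped TensorProduct

/-- A `ℤ`-graded Lie algebra over `ℝ` on the vector space `𝔤`. -/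
structure RealGradedLieAlgebra (𝔤 : Type*) [AddCommGroup 𝔤] [Module ℝ 𝔤] where
  /-- The homogeneous component of degree `p`. -/
  piece : ℤ → Submodule ℝ 𝔤
  isInternal : DirectSum.IsInternal piece
  /-- The bracket. -/
  bracket : 𝔤 →ₗ[ℝ] 𝔤 →ₗ[ℝ] 𝔤
  bracket_mem : ∀ {p q : ℤ} {a b : 𝔤}, a ∈ piece p → b ∈ piece q → bracket a b ∈ piece (p + q)
  antisymm : ∀ {p q : ℤ} {a b : 𝔤}, a ∈ piece p → b ∈ piece q →
    bracket a b + (-1 : ℝ) ^ (p * q) • bracket b a = 0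
  jacobi : ∀ {p q r : ℤ} {a b c : 𝔤}, a ∈ piece p → b ∈ piece q → c ∈ piece r →
    (-1 : ℝ) ^ (p * r) • bracket (bracket a b) c + (-1 : ℝ) ^ (q * p) • bracket (bracket b c) a
      + (-1 : ℝ) ^ (r * q) • bracket (bracket c a) b = 0

namespace RealGradedLieAlgebra

noncomputable section

variable {𝔤 : Type*} [AddCommGroup 𝔤] [Module ℝ 𝔤] (L : RealGradedLieAlgebra 𝔤)

/-- The relations `a ⊗ b - (-1)^{|a||b|} b ⊗ a = [a, b]`, for homogeneous `a`, `b`. -/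
inductive EnvRel : TensorAlgebra ℝ 𝔤 → TensorAlgebra ℝ 𝔤 → Prop
  | comm {p q : ℤ} {a b : 𝔤} (ha : a ∈ L.piece p) (hb : b ∈ L.piece q) :
      EnvRel
        (TensorAlgebra.ι ℝ a * TensorAlgebra.ι ℝ b
          - (-1 : ℝ) ^ (p * q) • (TensorAlgebra.ι ℝ b * TensorAlgebra.ι ℝ a))
        (TensorAlgebra.ι ℝ (L.bracket a b))

/-- The enveloping algebra `U(𝔤)` of the graded Lie algebra. -/
abbrev Env : Type _ := RingQuot L.EnvRel

/-- The canonical map `𝔤 → U(𝔤)`. -/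
def envι : 𝔤 →ₗ[ℝ] L.Env :=
  (RingQuot.mkAlgHom ℝ L.EnvRel).toLinearMap ∘ₗ TensorAlgebra.ι ℝ

/-- The augmentation `U(𝔤) → ℝ`: the morphism of algebras that vanishes on `𝔤`. -/
def augmentation : L.Env →ₐ[ℝ] ℝ :=
  RingQuot.liftAlgHom ℝ ⟨TensorAlgebra.lift ℝ (0 : 𝔤 →ₗ[ℝ] ℝ), by
    rintro _ _ ⟨ha, hb⟩
    simp⟩

/-- The relations `… ⊗ a_i ⊗ a_{i+1} ⊗ … + (-1)^{|a_i||a_{i+1}|} … ⊗ a_{i+1} ⊗ a_i ⊗ … = 0` between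
tensors of homogeneous elements. -/
def wedgeRel (n : ℕ) : Submodule ℝ (⨂[ℝ] _ : Fin n, 𝔤) :=
  Submodule.span ℝ {x | ∃ (a : Fin n → 𝔤) (d : Fin n → ℤ) (i j : Fin n),
    (∀ k, a k ∈ L.piece (d k)) ∧ (i : ℕ) + 1 = j ∧
    x = PiTensorProduct.tprod ℝ a
      + (-1 : ℝ) ^ (d i * d j) • PiTensorProduct.tprod ℝ (a ∘ Equiv.swap i j)}

/-- The graded exterior power `⋀ⁿ 𝔤`. -/
abbrev ExtPow (n : ℕ) : Type _ := (⨂[ℝ] _ : Fin n, 𝔤) ⧸ L.wedgeRel n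

/-- `(a_1, …, a_n) ↦ a_1 ∧ … ∧ a_n`. -/
def wedge (n : ℕ) : MultilinearMap ℝ (fun _ : Fin n => 𝔤) (L.ExtPow n) :=
  (L.wedgeRel n).mkQ.compMultilinearMap (PiTensorProduct.tprod ℝ)

/-- The space `C_n = U(𝔤) ⊗ ⋀ⁿ 𝔤`, with its structure of left `U(𝔤)`-module. -/
abbrev Chain (n : ℕ) : Type _ := L.Env ⊗[ℝ] L.ExtPow n

/-- The Koszul sign `ε_d(i, 1, …, î, …, n)`. -/
def sign₁ {n : ℕ} (d : Fin n → ℤ) (i : Fin n) : ℝ :=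
  ∏ k with k < i, (-1 : ℝ) ^ (d k * d i)

/-- For `i < j`, the Koszul sign `ε_d(i, j, 1, …, î, …, ĵ, …, n)`. -/
def sign₂ {n : ℕ} (d : Fin n → ℤ) (i j : Fin n) : ℝ :=
  (∏ k with k < i, (-1 : ℝ) ^ (d k * d i)) * ∏ k with k < j ∧ k ≠ i, (-1 : ℝ) ^ (d k * d j)

/-- The first sum in the Koszul differential of `u ⊗ a_1 ∧ … ∧ a_n`, where `a_i` has degree `d_i`.
Indices start from `0` here. -/
def actionSum {n : ℕ} (d : Fin (n + 1) → ℤ) (u : L.Env) (a : Fin (n + 1) → 𝔤) : L.Chain n :=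
  ∑ i : Fin (n + 1), ((-1 : ℝ) ^ (i : ℕ) * sign₁ d i) •
    ((u * L.envι (a i)) ⊗ₜ[ℝ] L.wedge n (i.removeNth a))

/-- The second sum in the Koszul differential of `u ⊗ a_1 ∧ … ∧ a_n`, where `a_i` has degree `d_i`.
It is empty for `n = 1`. The pairs `i < j` are the pairs `i < j'.succ`; once `a_i` has been removed
from the family, `a_j` is the entry of index `j'`. -/
def bracketSum : {n : ℕ} → (Fin (n + 1) → ℤ) → L.Env → (Fin (n + 1) → 𝔤) → L.Chain n
  | 0, _, _, _ => 0
  | m + 1, d, u, a =>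
    ∑ i : Fin (m + 2), ∑ j' : Fin (m + 1) with i < j'.succ,
      ((-1 : ℝ) ^ ((i : ℕ) + (j'.succ : ℕ)) * sign₂ d i j'.succ) •
        (u ⊗ₜ[ℝ] L.wedge (m + 1)
          (Fin.cons (L.bracket (a i) (a j'.succ)) (j'.removeNth (i.removeNth a))))

/-- The formula that defines the Koszul differential `C_{n+1} → C_n`. -/
def IsKoszulDifferential {n : ℕ} (D : L.Chain (n + 1) →ₗ[L.Env] L.Chain n) : Prop :=
  ∀ (d : Fin (n + 1) → ℤ) (u : L.Env) (a : Fin (n + 1) → 𝔤), (∀ k, a k ∈ L.piece (d k)) →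
    D (u ⊗ₜ[ℝ] L.wedge (n + 1) a) = L.actionSum d u a + L.bracketSum d u a

/-- The augmentation `C_0 = U(𝔤) ⊗ ⋀⁰ 𝔤 = U(𝔤) → ℝ`. It is linear over `U(𝔤)` for the structure of
trivial module on `ℝ`, where `U(𝔤)` acts through its augmentation. -/
def koszulAug : L.Chain 0 →ₛₗ[(L.augmentation : L.Env →+* ℝ)] ℝ :=
  let θ : L.ExtPow 0 →ₗ[ℝ] ℝ := (L.wedgeRel 0).liftQ
    (PiTensorProduct.isEmptyEquiv (R := ℝ) (s := fun _ : Fin 0 => 𝔤) (Fin 0)).toLinearMap (by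
      rw [wedgeRel, Submodule.span_le]
      rintro _ ⟨_, _, i, _⟩
      exact i.elim0)
  let f : L.Chain 0 →ₗ[ℝ] ℝ := LinearMap.mul' ℝ ℝ ∘ₗ TensorProduct.map L.augmentation.toLinearMap θ
  { toFun := f
    map_add' := f.map_add
    map_smul' := fun u x => by
      induction x using TensorProduct.induction_on with
      | zero => simp
      | add x y hx hy => rw [smul_add, f.map_add, f.map_add, hx, hy, smul_add]
      | tmul v w => simp [f, TensorProduct.smul_tmul', mul_assoc] }

theorem koszulAug_tmul (u : L.Env) (a : Fin 0 → 𝔤) : L.koszulAug (u ⊗ₜ[ℝ] L.wedge 0 a) = L.augmentation u := by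
  simp [koszulAug, wedge]

variable {X : Type*} [AddCommGroup X] [Module ℝ X]

theorem exists_extension {n : ℕ} (F : (Fin n → ℤ) → MultilinearMap ℝ (fun _ : Fin n => 𝔤) X) :
    ∃ G : MultilinearMap ℝ (fun _ : Fin n => 𝔤) X,
      ∀ (d : Fin n → ℤ) (a : Fin n → 𝔤), (∀ k, a k ∈ L.piece (d k)) → G a = F d a := by
  classical
  let e := LinearEquiv.ofBijective (DirectSum.coeLinearMap L.piece) L.isInternal
  refine ⟨(MultilinearMap.fromDirectSumEquiv (R := ℝ) (κ := fun _ : Fin n => ℤ)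
    (M := fun _ k => L.piece k)
    (fun d => (F d).compLinearMap (fun i => (L.piece (d i)).subtype))).compLinearMap
      (fun _ => e.symm.toLinearMap), fun d a ha => ?_⟩
  have : ∀ k, e.symm (a k) = DirectSum.lof ℝ ℤ (fun k => L.piece k) (d k) ⟨a k, ha k⟩ := by
    intro k
    rw [LinearEquiv.symm_apply_eq]
    exact (DirectSum.coeLinearMap_lof L.piece (d k) ⟨a k, ha k⟩).symm
  simp only [MultilinearMap.compLinearMap_apply, LinearEquiv.coe_coe, this]
  rw [MultilinearMap.fromDirectSumEquiv_lof (R := ℝ) (κ := fun _ : Fin n => ℤ)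
    (M := fun _ k => L.piece k) _ d (fun k => ⟨a k, ha k⟩)]
  simp

theorem exists_lift {n : ℕ} (F : (Fin n → ℤ) → MultilinearMap ℝ (fun _ : Fin n => 𝔤) X)
    (hF : ∀ (d : Fin n → ℤ) (a : Fin n → 𝔤) (i j : Fin n), (∀ k, a k ∈ L.piece (d k)) →
      (i : ℕ) + 1 = j →
      F d a + (-1 : ℝ) ^ (d i * d j) • F (d ∘ Equiv.swap i j) (a ∘ Equiv.swap i j) = 0) :
    ∃ φ : L.ExtPow n →ₗ[ℝ] X,
      ∀ (d : Fin n → ℤ) (a : Fin n → 𝔤), (∀ k, a k ∈ L.piece (d k)) →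
        φ (L.wedge n a) = F d a := by
  obtain ⟨G, hG⟩ := L.exists_extension F
  refine ⟨(L.wedgeRel n).liftQ (PiTensorProduct.lift G) ?_, fun d a ha => ?_⟩
  · rw [wedgeRel, Submodule.span_le]
    rintro _ ⟨a, d, i, j, ha, hij, rfl⟩
    have := hF d a i j ha hij
    rw [← hG d a ha, ← hG (d ∘ Equiv.swap i j) (a ∘ Equiv.swap i j) (fun k => ha _)] at this
    simpa using this
  · simpa [wedge] using hG d a ha

theorem wedge_swap {n : ℕ} (d : Fin n → ℤ) (a : Fin n → 𝔤) (i j : Fin n)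
    (ha : ∀ k, a k ∈ L.piece (d k)) (hij : (i : ℕ) + 1 = j) :
    L.wedge n (a ∘ Equiv.swap i j) = -(-1 : ℝ) ^ (d i * d j) • L.wedge n a := by
  have h : L.wedge n a + (-1 : ℝ) ^ (d i * d j) • L.wedge n (a ∘ Equiv.swap i j) = 0 := by
    rw [wedge, LinearMap.compMultilinearMap_apply, LinearMap.compMultilinearMap_apply, ← map_smul,
      ← map_add, Submodule.mkQ_apply, Submodule.Quotient.mk_eq_zero]
    exact Submodule.subset_span ⟨a, d, i, j, ha, hij, rfl⟩
  have h1 : (-1 : ℝ) ^ (d i * d j) * (-1 : ℝ) ^ (d i * d j) = 1 := by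
    rw [← zpow_add₀ (by norm_num)]
    exact Even.neg_one_zpow ⟨_, rfl⟩
  rw [eq_neg_of_add_eq_zero_left h, smul_neg, neg_smul, neg_neg, smul_smul, h1, one_smul]

theorem exists_wedgeLeft (m : ℕ) : ∃ φ : 𝔤 →ₗ[ℝ] L.ExtPow m →ₗ[ℝ] L.ExtPow (m + 1),
    ∀ c a, φ c (L.wedge m a) = L.wedge (m + 1) (Fin.cons c a) := by
  let g : 𝔤 →ₗ[ℝ] (⨂[ℝ] _ : Fin m, 𝔤) →ₗ[ℝ] L.ExtPow (m + 1) :=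
    (PiTensorProduct.lift (R := ℝ) (s := fun _ : Fin m => 𝔤)).toLinearMap ∘ₗ
      (L.wedge (m + 1)).curryLeft
  have hg : ∀ c, L.wedgeRel m ≤ LinearMap.ker (g c) := by
    intro c
    have hc : c ∈ ⨆ p, L.piece p := by rw [L.isInternal.submodule_iSup_eq_top]; trivial
    induction hc using Submodule.iSup_induction' with
    | zero => simp
    | add x y _ _ hx hy =>
      intro t ht
      have h1 := hx ht
      have h2 := hy ht
      rw [LinearMap.mem_ker] at *
      rw [map_add, LinearMap.add_apply, h1, h2, add_zero]
    | mem p x hx =>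
      rw [wedgeRel, Submodule.span_le]
      rintro _ ⟨a, d, i, j, ha, hij, rfl⟩
      have := L.wedge_swap (Fin.cons p d) (Fin.cons x a) i.succ j.succ
        (fun k => by refine Fin.cases ?_ ?_ k <;> simp [hx, ha]) (by simpa using hij)
      have e : (Fin.cons x a : Fin (m+1) → 𝔤) ∘ Equiv.swap i.succ j.succ
          = Fin.cons x (a ∘ Equiv.swap i j) := by
        funext k
        refine Fin.cases ?_ (fun k => ?_) k
        · simp [Equiv.swap_apply_of_ne_of_ne (Fin.succ_ne_zero i).symm (Fin.succ_ne_zero j).symm]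
        · simp only [Function.comp, Fin.cons_succ]
          rw [← Function.Injective.map_swap (Fin.succ_injective m), Fin.cons_succ]
      rw [e] at this
      have h1 : (-1 : ℝ) ^ (d i * d j) * (-1 : ℝ) ^ (d i * d j) = 1 := by
        rw [← zpow_add₀ (by norm_num)]
        exact Even.neg_one_zpow ⟨_, rfl⟩
      simp [g, this, smul_smul, h1]
  exact ⟨{ toFun := fun c => (L.wedgeRel m).liftQ (g c) (hg c)
           map_add' := fun x y => by
             ext t
             simp
           map_smul' := fun r x => by
             ext t
             simp }, fun c a => by simp [g, wedge]⟩

theorem neg_one_sq_zpow (x : ℤ) : (-1 : ℝ) ^ x * (-1 : ℝ) ^ x = 1 := by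
  rw [← zpow_add₀ (by norm_num)]
  exact Even.neg_one_zpow ⟨_, rfl⟩

theorem coeff_eq {n : ℕ} (d : Fin n → ℤ) (i : Fin n) :
    (-1 : ℝ) ^ (i : ℕ) * sign₁ d i = ∏ k, if k < i then -(-1 : ℝ) ^ (d k * d i) else 1 := by
  have : (-1 : ℝ) ^ (i : ℕ) = ∏ k : Fin n with k < i, (-1 : ℝ) := by
    rw [Finset.prod_const]
    congr 1
    have : (Finset.univ.filter (fun k : Fin n => k < i)) = Finset.Iio i := by ext; simp
    rw [this, Fin.card_Iio]
  rw [this, sign₁, ← Finset.prod_mul_distrib, Finset.prod_filter]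
  refine Finset.prod_congr rfl fun k _ => ?_
  split_ifs <;> simp

theorem coeff_swap {n : ℕ} (d : Fin n → ℤ) (p q i : Fin n) (h : (p : ℕ) + 1 = q) :
    (-1 : ℝ) ^ (Equiv.swap p q i : ℕ) * sign₁ (d ∘ Equiv.swap p q) (Equiv.swap p q i)
      = ((-1 : ℝ) ^ (i : ℕ) * sign₁ d i) *
        (if i = p ∨ i = q then -(-1 : ℝ) ^ (d p * d q) else 1) := by
  have hpq : p < q := by rw [Fin.lt_def]; omega
  have hs := neg_one_sq_zpow (d p * d q)
  rw [coeff_eq, coeff_eq, ← Equiv.prod_comp (Equiv.swap p q)]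
  simp only [Function.comp, Equiv.swap_apply_self]
  by_cases hp : i = p
  · subst hp
    rw [if_pos (Or.inl rfl)]
    have : (-(-1 : ℝ) ^ (d i * d q)) = ∏ k, if k = q then (-(-1 : ℝ) ^ (d k * d i)) else 1 := by
      rw [Finset.prod_ite_eq' Finset.univ q (fun k => -(-1 : ℝ) ^ (d k * d i))]
      simp [mul_comm]
    rw [this, ← Finset.prod_mul_distrib]
    refine Finset.prod_congr rfl fun k _ => ?_
    rw [Equiv.swap_apply_left, Equiv.swap_apply_def]
    split_ifs <;> first | (exfalso; simp only [Fin.lt_def, Fin.ext_iff] at *; omega) | simp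
  by_cases hq : i = q
  · subst hq
    rw [if_pos (Or.inr rfl)]
    have : (-(-1 : ℝ) ^ (d p * d i)) = ∏ k, if k = p then (-(-1 : ℝ) ^ (d k * d i)) else 1 := by
      rw [Finset.prod_ite_eq' Finset.univ p (fun k => -(-1 : ℝ) ^ (d k * d i))]
      simp
    rw [this, ← Finset.prod_mul_distrib]
    refine Finset.prod_congr rfl fun k _ => ?_
    rw [Equiv.swap_apply_right, Equiv.swap_apply_def]
    split_ifs <;> first
      | (exfalso; simp only [Fin.lt_def, Fin.ext_iff] at *; omega)
      | (subst_vars; simp [neg_one_sq_zpow])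
  · rw [if_neg (by tauto), mul_one, Equiv.swap_apply_of_ne_of_ne hp hq]
    refine Finset.prod_congr rfl fun k _ => ?_
    rw [Equiv.swap_apply_def]
    split_ifs <;> first | (exfalso; simp only [Fin.lt_def, Fin.ext_iff] at *; omega) | rfl

theorem wedge_removeNth_swap {n : ℕ} (d : Fin (n + 1) → ℤ) (a : Fin (n + 1) → 𝔤)
    (ha : ∀ k, a k ∈ L.piece (d k)) (p q i : Fin (n + 1)) (h : (p : ℕ) + 1 = q) :
    L.wedge n ((Equiv.swap p q i).removeNth (a ∘ Equiv.swap p q))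
      = (if i = p ∨ i = q then 1 else -(-1 : ℝ) ^ (d p * d q)) • L.wedge n (i.removeNth a) := by
  by_cases hp : i = p
  · subst hp
    rw [if_pos (Or.inl rfl), one_smul, Equiv.swap_apply_left]
    congr 1
    funext k
    simp only [Fin.removeNth, Function.comp]
    congr 1
    rw [Equiv.swap_apply_def]
    simp only [Fin.succAbove, Fin.lt_def, Fin.ext_iff]
    split_ifs <;> simp at * <;> omega
  by_cases hq : i = q
  · subst hq
    rw [if_pos (Or.inr rfl), one_smul, Equiv.swap_apply_right]
    congr 1
    funext k
    simp only [Fin.removeNth, Function.comp]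
    congr 1
    rw [Equiv.swap_apply_def]
    simp only [Fin.succAbove, Fin.lt_def, Fin.ext_iff]
    split_ifs <;> simp at * <;> omega
  · rw [if_neg (by tauto), Equiv.swap_apply_of_ne_of_ne hp hq]
    obtain ⟨p', rfl⟩ := Fin.exists_succAbove_eq (Ne.symm hp)
    obtain ⟨q', rfl⟩ := Fin.exists_succAbove_eq (Ne.symm hq)
    have h' : (p' : ℕ) + 1 = q' := by
      simp only [Fin.succAbove, Fin.lt_def] at h
      split_ifs at h <;> simp at * <;> omega
    refine Eq.trans ?_ (L.wedge_swap (i.removeNth d) (i.removeNth a) p' q' (fun k => ha _) h')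
    congr 1
    funext k
    simp only [Fin.removeNth, Function.comp]
    rw [Function.Injective.map_swap Fin.succAbove_right_injective]

theorem exists_extract (n : ℕ) : ∃ φ : L.ExtPow (n + 1) →ₗ[ℝ] 𝔤 ⊗[ℝ] L.ExtPow n,
    ∀ (d : Fin (n + 1) → ℤ) (a : Fin (n + 1) → 𝔤), (∀ k, a k ∈ L.piece (d k)) →
      φ (L.wedge (n + 1) a) = ∑ i : Fin (n + 1), ((-1 : ℝ) ^ (i : ℕ) * sign₁ d i) •
        (a i ⊗ₜ[ℝ] L.wedge n (i.removeNth a)) := by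
  let g : 𝔤 →ₗ[ℝ] MultilinearMap ℝ (fun _ : Fin n => 𝔤) (𝔤 ⊗[ℝ] L.ExtPow n) :=
    { toFun := fun x => (TensorProduct.mk ℝ 𝔤 (L.ExtPow n) x).compMultilinearMap (L.wedge n)
      map_add' := fun x y => by ext; simp
      map_smul' := fun r x => by ext; simp [TensorProduct.smul_tmul'] }
  have hg : ∀ (i : Fin (n + 1)) (a : Fin (n + 1) → 𝔤),
      (LinearMap.uncurryMid (R := ℝ) (M := fun _ => 𝔤) i g) a = a i ⊗ₜ[ℝ] L.wedge n (i.removeNth a) :=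
    fun i a => by simp [LinearMap.uncurryMid, g]
  obtain ⟨φ, hφ⟩ := L.exists_lift (X := 𝔤 ⊗[ℝ] L.ExtPow n)
    (fun d => ∑ i : Fin (n + 1), ((-1 : ℝ) ^ (i : ℕ) * sign₁ d i) •
      LinearMap.uncurryMid (R := ℝ) (M := fun _ => 𝔤) i g) (by
    intro d a p q ha h
    simp only [sum_apply, smul_apply, hg]
    rw [← Equiv.sum_comp (Equiv.swap p q) (fun i => ((-1 : ℝ) ^ (i : ℕ) *
      sign₁ (d ∘ Equiv.swap p q) i) • ((a ∘ Equiv.swap p q) i ⊗ₜ[ℝ]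
        L.wedge n (i.removeNth (a ∘ Equiv.swap p q)))), Finset.smul_sum, ← Finset.sum_add_distrib]
    refine Finset.sum_eq_zero fun i _ => ?_
    rw [coeff_swap d p q i h, L.wedge_removeNth_swap d a ha p q i h, Function.comp_apply,
      Equiv.swap_apply_self, TensorProduct.tmul_smul, smul_smul, smul_smul, ← add_smul]
    have hs := neg_one_sq_zpow (d p * d q)
    convert zero_smul ℝ _ using 2
    split_ifs
    · linear_combination (-((-1 : ℝ) ^ (i : ℕ) * sign₁ d i)) * hs
    · linear_combination (-((-1 : ℝ) ^ (i : ℕ) * sign₁ d i)) * hs)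
  refine ⟨φ, fun d a ha => ?_⟩
  rw [hφ d a ha]
  simp only [sum_apply, smul_apply, hg]

theorem sign₁_removeNth {n : ℕ} (d : Fin (n + 1) → ℤ) (i : Fin (n + 1)) (j : Fin n) :
    sign₁ (i.removeNth d) j
      = ∏ k with k < i.succAbove j ∧ k ≠ i, (-1 : ℝ) ^ (d k * d (i.succAbove j)) := by
  rw [sign₁, Finset.prod_filter, Finset.prod_filter, Fin.prod_univ_succAbove _ i]
  simp [Fin.removeNth, Fin.succAbove_ne]

theorem double_symm {m : ℕ} (d : Fin (m + 2) → ℤ) (a : Fin (m + 2) → 𝔤)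
    (ha : ∀ k, a k ∈ L.piece (d k)) (i j : Fin (m + 1)) (hij : i ≤ j) :
    (((-1 : ℝ) ^ (j.succ : ℕ) * sign₁ d j.succ) * ((-1 : ℝ) ^ (i : ℕ) *
        sign₁ (j.succ.removeNth d) i)) •
      L.wedge (m + 1) (Fin.cons (L.bracket (a j.succ) (j.succ.removeNth a i))
        (i.removeNth (j.succ.removeNth a)))
    = (((-1 : ℝ) ^ (i.castSucc : ℕ) * sign₁ d i.castSucc) * ((-1 : ℝ) ^ (j : ℕ) *
        sign₁ (i.castSucc.removeNth d) j)) •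
      L.wedge (m + 1) (Fin.cons (L.bracket (a i.castSucc) (i.castSucc.removeNth a j))
        (j.removeNth (i.castSucc.removeNth a))) := by
  have e1 : j.succ.succAbove i = i.castSucc :=
    Fin.succAbove_of_castSucc_lt _ _ (by simp only [Fin.lt_def, Fin.le_def] at *; simp; omega)
  have e2 : i.castSucc.succAbove j = j.succ :=
    Fin.succAbove_of_le_castSucc _ _ (by simpa using hij)
  have e3 : i.removeNth (j.succ.removeNth a) = j.removeNth (i.castSucc.removeNth a) := by
    funext k
    simp only [Fin.removeNth]
    congr 1
    simp only [Fin.succAbove, Fin.lt_def, Fin.le_def, Fin.ext_iff] at *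
    split_ifs <;> simp at * <;> omega
  have hne : i.castSucc ≠ j.succ := by
    simp only [ne_eq, Fin.ext_iff, Fin.le_def] at *; simp; omega
  have hlt : i.castSucc < j.succ := by
    simp only [Fin.lt_def, Fin.le_def] at *; simp; omega
  have s1 : sign₁ (j.succ.removeNth d) i = sign₁ d i.castSucc := by
    rw [sign₁_removeNth, e1, sign₁]
    congr 1
    ext k
    simp only [Finset.mem_filter, Finset.mem_univ, true_and, and_iff_left_iff_imp]
    rintro h rfl
    exact absurd (h.trans hlt) (lt_irrefl _)
  have s2 : sign₁ d j.succ
      = (-1 : ℝ) ^ (d i.castSucc * d j.succ) * sign₁ (i.castSucc.removeNth d) j := by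
    rw [sign₁_removeNth, e2, sign₁, ← Finset.mul_prod_erase _ _ (a := i.castSucc) (by simpa using hlt)]
    congr 2
    ext k
    simp [and_comm]
  have hb : L.bracket (a j.succ) (a i.castSucc)
      = -(-1 : ℝ) ^ (d i.castSucc * d j.succ) • L.bracket (a i.castSucc) (a j.succ) := by
    rw [mul_comm, eq_neg_of_add_eq_zero_left (L.antisymm (ha j.succ) (ha i.castSucc)), neg_smul]
  have hc : ∀ (r : ℝ) (x : 𝔤) (y : Fin m → 𝔤),
      L.wedge (m + 1) (Fin.cons (r • x) y) = r • L.wedge (m + 1) (Fin.cons x y) := fun r x y =>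
    (L.wedge (m + 1)).cons_smul y r x
  have hs := neg_one_sq_zpow (d i.castSucc * d j.succ)
  rw [e3, s1, s2]
  simp only [Fin.removeNth, e1, e2]
  rw [hb, hc, smul_smul]
  congr 1
  simp only [Fin.val_succ, Fin.val_castSucc, pow_succ]
  linear_combination ((-1) ^ (i : ℕ) * sign₁ d i.castSucc *
    ((-1) ^ (j : ℕ) * sign₁ (i.castSucc.removeNth d) j)) * hs

theorem sum_halves {m : ℕ} (Y : Fin (m + 2) → Fin (m + 1) → X)
    (hY : ∀ i j, i ≤ j → Y j.succ i = Y i.castSucc j) :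
    ∑ i, ∑ j, Y i j = (2 : ℝ) • ∑ i, ∑ j : Fin (m + 1) with i < j.succ, Y i j := by
  have h : ∑ i, ∑ j : Fin (m + 1) with ¬ i < j.succ, Y i j
      = ∑ i, ∑ j : Fin (m + 1) with i < j.succ, Y i j := by
    have h1 : ∀ i : Fin (m + 2), ∑ j : Fin (m + 1) with i < j.succ, Y i j
        = ∑ j : Fin (m + 1), if i < j.succ then Y i j else 0 := fun i => Finset.sum_filter _ _
    have h2 : ∀ i : Fin (m + 2), ∑ j : Fin (m + 1) with ¬ i < j.succ, Y i j
        = ∑ j : Fin (m + 1), if ¬ i < j.succ then Y i j else 0 := fun i => Finset.sum_filter _ _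
    simp only [h1, h2]
    rw [Fin.sum_univ_succ, Fin.sum_univ_castSucc (n := m + 1)
      (f := fun i => ∑ j : Fin (m + 1), if i < j.succ then Y i j else 0)]
    have z1 : (∑ j : Fin (m + 1), if ¬ (0 : Fin (m + 2)) < j.succ then Y 0 j else 0) = 0 :=
      Finset.sum_eq_zero fun j _ => by simp
    have z2 : (∑ j : Fin (m + 1), if Fin.last (m + 1) < j.succ then Y (Fin.last (m + 1)) j else 0)
        = 0 := Finset.sum_eq_zero fun j _ => by
      rw [if_neg]; exact not_lt.2 (Fin.le_last _)
    rw [z1, z2, zero_add, add_zero, Finset.sum_comm]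
    refine Finset.sum_congr rfl fun i _ => Finset.sum_congr rfl fun j _ => ?_
    by_cases hij : i ≤ j
    · rw [if_pos (by simpa using hij), if_pos (by simpa [Fin.castSucc_lt_succ_iff] using hij),
        hY i j hij]
    · rw [if_neg (by simpa using hij), if_neg (by simpa [Fin.castSucc_lt_succ_iff] using hij)]
  rw [two_smul]
  nth_rewrite 1 [← h]
  rw [← Finset.sum_add_distrib]
  refine Finset.sum_congr rfl fun i _ => ?_
  exact ((add_comm _ _).trans (Finset.sum_filter_add_sum_filter_not _ _ _)).symm

theorem exists_envLift {n : ℕ} {Y : Type*} [AddCommGroup Y] [Module ℝ Y]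
    (g : Y →ₗ[ℝ] L.Chain n) :
    ∃ D : L.Env ⊗[ℝ] Y →ₗ[L.Env] L.Chain n, ∀ u w, D (u ⊗ₜ[ℝ] w) = u • g w :=
  ⟨TensorProduct.AlgebraTensorModule.lift
    (LinearMap.toSpanSingleton L.Env (Y →ₗ[ℝ] L.Chain n) g), fun u w => by simp⟩

theorem exists_bracketPart (n : ℕ) : ∃ g : L.ExtPow (n + 1) →ₗ[ℝ] L.Chain n,
    ∀ (d : Fin (n + 1) → ℤ) (u : L.Env) (a : Fin (n + 1) → 𝔤), (∀ k, a k ∈ L.piece (d k)) →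
      u • g (L.wedge (n + 1) a) = L.bracketSum d u a := by
  cases n with
  | zero => exact ⟨0, fun d u a _ => by simp [bracketSum]⟩
  | succ m =>
    obtain ⟨E, hE⟩ := L.exists_extract (m + 1)
    obtain ⟨E', hE'⟩ := L.exists_extract m
    obtain ⟨W, hW⟩ := L.exists_wedgeLeft m
    let B : 𝔤 ⊗[ℝ] (𝔤 ⊗[ℝ] L.ExtPow m) →ₗ[ℝ] L.ExtPow (m + 1) :=
      TensorProduct.lift (W ∘ₗ TensorProduct.lift L.bracket) ∘ₗ
        (TensorProduct.assoc ℝ 𝔤 𝔤 (L.ExtPow m)).symm.toLinearMap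
    refine ⟨(-(1 / 2) : ℝ) • (TensorProduct.mk ℝ L.Env (L.ExtPow (m + 1)) 1 ∘ₗ B ∘ₗ
      LinearMap.lTensor 𝔤 E' ∘ₗ E), fun d u a ha => ?_⟩
    have key : B (LinearMap.lTensor 𝔤 E' (E (L.wedge (m + 1 + 1) a)))
        = ∑ i : Fin (m + 2), ∑ j : Fin (m + 1), (((-1 : ℝ) ^ (i : ℕ) * sign₁ d i) *
            ((-1 : ℝ) ^ (j : ℕ) * sign₁ (i.removeNth d) j)) •
          L.wedge (m + 1) (Fin.cons (L.bracket (a i) (i.removeNth a j))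
            (j.removeNth (i.removeNth a))) := by
      rw [hE d a ha, map_sum, map_sum]
      refine Finset.sum_congr rfl fun i _ => ?_
      rw [map_smul, map_smul, LinearMap.lTensor_tmul,
        hE' (i.removeNth d) (i.removeNth a) (fun k => ha _), TensorProduct.tmul_sum, map_sum,
        Finset.smul_sum]
      refine Finset.sum_congr rfl fun j _ => ?_
      rw [TensorProduct.tmul_smul, map_smul, smul_smul]
      congr 1
      simp [B, hW]
    rw [sum_halves _ (fun i j hij => L.double_symm d a ha i j hij)] at key
    simp only [LinearMap.smul_apply, LinearMap.comp_apply, key, bracketSum, map_smul, smul_smul,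
      map_sum, TensorProduct.mk_apply]
    norm_num
    simp only [Finset.smul_sum]
    refine Finset.sum_congr rfl fun i _ => Finset.sum_congr rfl fun j hj => ?_
    have hij : i < j.succ := by simpa using hj
    have e2 : i.succAbove j = j.succ := Fin.succAbove_of_lt_succ _ _ hij
    have hu : ∀ w : L.ExtPow (m + 1), u • ((1 : L.Env) ⊗ₜ[ℝ] w) = u ⊗ₜ[ℝ] w := fun w => by
      rw [TensorProduct.smul_tmul', smul_eq_mul, mul_one]
    have ej : i.removeNth a j = a j.succ := by rw [Fin.removeNth, e2]
    rw [ej, smul_comm u, smul_comm u, hu, smul_smul, sign₁_removeNth, e2]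
    congr 1
    simp only [sign₂, sign₁]
    ring

theorem exists_koszulDifferential (n : ℕ) :
    ∃ D : L.Chain (n + 1) →ₗ[L.Env] L.Chain n, L.IsKoszulDifferential D := by
  obtain ⟨E, hE⟩ := L.exists_extract n
  obtain ⟨g, hg⟩ := L.exists_bracketPart n
  obtain ⟨D, hD⟩ := L.exists_envLift (TensorProduct.map L.envι LinearMap.id ∘ₗ E + g)
  refine ⟨D, fun d u a ha => ?_⟩
  rw [hD, LinearMap.add_apply, smul_add, hg d u a ha]
  congr 1
  rw [LinearMap.comp_apply, hE d a ha, map_sum, Finset.smul_sum, actionSum]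
  refine Finset.sum_congr rfl fun i _ => ?_
  rw [map_smul, TensorProduct.map_tmul, smul_comm u, TensorProduct.smul_tmul', smul_eq_mul]
  rfl

theorem eq_of_isKoszulDifferential {n : ℕ} {D D' : L.Chain (n + 1) →ₗ[L.Env] L.Chain n}
    (h : L.IsKoszulDifferential D) (h' : L.IsKoszulDifferential D') : D = D' := by
  classical
  have key : ∀ a, D (1 ⊗ₜ[ℝ] L.wedge (n + 1) a) = D' (1 ⊗ₜ[ℝ] L.wedge (n + 1) a) := by
    intro a
    let e := LinearEquiv.ofBijective (DirectSum.coeLinearMap L.piece) L.isInternal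
    let G (D : L.Chain (n + 1) →ₗ[L.Env] L.Chain n) :
        MultilinearMap ℝ (fun _ : Fin (n + 1) => DirectSum ℤ fun k => L.piece k) (L.Chain n) :=
      (((D.restrictScalars ℝ) ∘ₗ TensorProduct.mk ℝ L.Env (L.ExtPow (n + 1)) 1).compMultilinearMap
        (L.wedge (n + 1))).compLinearMap (fun _ => e.toLinearMap)
    have hG : G D = G D' := by
      refine MultilinearMap.dfinsupp_ext (M := fun _ k => L.piece k) fun p => ?_
      ext x
      have hx : ∀ k, e (DirectSum.lof ℝ ℤ (fun k => L.piece k) (p k) (x k)) ∈ L.piece (p k) := by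
        intro k
        have : e (DirectSum.lof ℝ ℤ (fun k => L.piece k) (p k) (x k)) = x k :=
          DirectSum.coeLinearMap_lof L.piece (p k) (x k)
        rw [this]
        exact (x k).2
      exact (h p 1 _ hx).trans (h' p 1 _ hx).symm
    have := congrArg (fun f => f (fun k => e.symm (a k))) hG
    simpa [G] using this
  have h1 : ((D.restrictScalars ℝ) ∘ₗ TensorProduct.mk ℝ L.Env (L.ExtPow (n + 1)) 1) ∘ₗ
        (L.wedgeRel (n + 1)).mkQ
      = ((D'.restrictScalars ℝ) ∘ₗ TensorProduct.mk ℝ L.Env (L.ExtPow (n + 1)) 1) ∘ₗ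
        (L.wedgeRel (n + 1)).mkQ :=
    PiTensorProduct.ext (MultilinearMap.ext key)
  refine LinearMap.ext fun x => ?_
  induction x using TensorProduct.induction_on with
  | zero => simp
  | add x y hx hy => rw [map_add, map_add, hx, hy]
  | tmul u w =>
    obtain ⟨t, rfl⟩ := (L.wedgeRel (n + 1)).mkQ_surjective w
    have hu : u ⊗ₜ[ℝ] (L.wedgeRel (n + 1)).mkQ t
        = u • ((1 : L.Env) ⊗ₜ[ℝ] (L.wedgeRel (n + 1)).mkQ t) := by
      rw [TensorProduct.smul_tmul', smul_eq_mul, mul_one]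
    rw [hu, map_smul, map_smul]
    exact congrArg (u • ·) (LinearMap.congr_fun h1 t)

/-- The Koszul differential `C_{n+1} → C_n`: the unique morphism of left `U(𝔤)`-modules given by
the formula of `IsKoszulDifferential`. -/
def koszulD (n : ℕ) : L.Chain (n + 1) →ₗ[L.Env] L.Chain n :=
  (L.exists_koszulDifferential n).choose

theorem isKoszulDifferential_koszulD (n : ℕ) : L.IsKoszulDifferential (L.koszulD n) :=
  (L.exists_koszulDifferential n).choose_spec

end

end RealGradedLieAlgebra

namespace RealGradedLieAlgebra

noncomputable section

variable {𝔤 : Type*} [AddCommGroup 𝔤] [Module ℝ 𝔤] (L : RealGradedLieAlgebra 𝔤)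

/-! ### Signs and the braiding -/

/-! Write S for the graded symmetric algebra `Sym`, realised as the enveloping algebra of the same
graded space with zero bracket, and ⋀ for `Ext`. A right action ρ of 𝔤 on M gives a differential `kD
ρ` on M ⊗ ⋀. For right multiplication on U(𝔤) it is the Koszul differential. For M = S and zero
bracket it is the classical d = `hat symMul`, and the map h = `symH`, which moves a factor from S to
⋀, satisfies dh + hd = k + n in bidegree (k, n) (`homotopy`). Over ℝ this scalar is invertible
unless k = n = 0, so the classical complex is exact up to the constants.

The general case is reduced to this one by a Poincaré–Birkhoff–Witt theorem, itself proved with h.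
One seeks a right action `symAct` = `symMul` + `lam` of 𝔤 on S in which `lam` does not raise the
degree. Being an action means that D = `kD symAct` squares to zero from ⋀² to ⋀⁰. Solving this
equation with h expresses `lam` in degree k through its values in lower degrees (`smul_hat_lam`),
which defines `lam` by recursion. The action identity follows by induction on the degree
(`hat_symAct_kD`): the obstruction in degree k is killed by D² = 0 in lower degrees. The Jacobi
identity enters through the vanishing of both double brackets on three extracted factors, which
makes the bracket part of D square to zero (`extBr_extBr`).

The orbit map u ↦ 1 · u is a bijection `symbol` from U(𝔤) to S. It is surjective because x acts as
multiplication by x up to lower terms. It is injective because U(𝔤) is spanned, one filtration step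
at a time, by symmetrized elements (`envFil_succ_le_sup`), and the symbol of the symmetrization of s
is s up to lower terms (`symbol_symm_sub_mem`). It carries the Koszul complex of U(𝔤) to (S ⊗ ⋀, D).
Since D is d plus terms that do not raise the degree in S, Dh + hD is k + n modulo the previous
filtration step (`kD_homotopy_mem`), and induction on the filtration gives exactness.

Signs are carried by the braiding: the identities are stated for operators that extract factors from
⋀, and the indexed sums return only to identify these operators with the given differential. -/

/-- The sign `(-1)^{pq}`. -/
def chi (p q : ℤ) : ℝ := (-1 : ℝ) ^ (p * q)

theorem chi_comm (p q : ℤ) : chi p q = chi q p := by rw [chi, chi, mul_comm]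

theorem chi_mul_self (p q : ℤ) : chi p q * chi p q = 1 := neg_one_sq_zpow _

theorem chi_add_left (p q r : ℤ) : chi (p + q) r = chi p r * chi q r := by
  rw [chi, add_mul, zpow_add₀ (by norm_num)]; rfl

variable {X N N' : Type*} [AddCommGroup X] [Module ℝ X]
  [AddCommGroup N] [Module ℝ N] [AddCommGroup N'] [Module ℝ N']

theorem hom_induction {P : 𝔤 → Prop} (x : 𝔤) (hom : ∀ p x, x ∈ L.piece p → P x)
    (add : ∀ x y, P x → P y → P (x + y)) : P x := by
  have hc : x ∈ ⨆ p, L.piece p := by rw [L.isInternal.submodule_iSup_eq_top]; trivial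
  induction hc using Submodule.iSup_induction' with
  | zero => exact hom 0 0 (zero_mem _)
  | add x y _ _ hx hy => exact add x y hx hy
  | mem p x hx => exact hom p x hx

theorem hom_ext {f g : 𝔤 →ₗ[ℝ] X} (h : ∀ p x, x ∈ L.piece p → f x = g x) : f = g := by
  refine LinearMap.ext fun x => L.hom_induction x h fun x y hx hy => ?_
  rw [map_add, map_add, hx, hy]

theorem tensor_hom_ext {f g : 𝔤 ⊗[ℝ] N →ₗ[ℝ] X}
    (h : ∀ p x n, x ∈ L.piece p → f (x ⊗ₜ n) = g (x ⊗ₜ n)) : f = g :=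
  TensorProduct.ext (L.hom_ext fun p x hx => LinearMap.ext fun n => h p x n hx)

theorem tensor_hom_ext₂ {f g : 𝔤 ⊗[ℝ] (𝔤 ⊗[ℝ] N) →ₗ[ℝ] X}
    (h : ∀ p q x y n, x ∈ L.piece p → y ∈ L.piece q → f (x ⊗ₜ (y ⊗ₜ n)) = g (x ⊗ₜ (y ⊗ₜ n))) :
    f = g :=
  TensorProduct.ext (L.hom_ext fun p x hx => L.tensor_hom_ext fun q y n hy => h p q x y n hx hy)

theorem tensor_hom_ext₃ {f g : 𝔤 ⊗[ℝ] (𝔤 ⊗[ℝ] (𝔤 ⊗[ℝ] N)) →ₗ[ℝ] X}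
    (h : ∀ p q r x y z n, x ∈ L.piece p → y ∈ L.piece q → z ∈ L.piece r →
      f (x ⊗ₜ (y ⊗ₜ (z ⊗ₜ n))) = g (x ⊗ₜ (y ⊗ₜ (z ⊗ₜ n)))) : f = g :=
  TensorProduct.ext (L.hom_ext fun p x hx =>
    L.tensor_hom_ext₂ fun q r y z n hy hz => h p q r x y z n hx hy hz)

/-- The linear map that is given by `F p` on the homogeneous component of degree `p`. -/
def piecewise {X : Type*} [AddCommMonoid X] [Module ℝ X] (F : ℤ → 𝔤 →ₗ[ℝ] X) : 𝔤 →ₗ[ℝ] X :=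
  DirectSum.toModule ℝ ℤ X (fun p => F p ∘ₗ (L.piece p).subtype) ∘ₗ
    (LinearEquiv.ofBijective (DirectSum.coeLinearMap L.piece) L.isInternal).symm.toLinearMap

theorem piecewise_apply {X : Type*} [AddCommMonoid X] [Module ℝ X] (F : ℤ → 𝔤 →ₗ[ℝ] X) {p : ℤ}
    {x : 𝔤} (hx : x ∈ L.piece p) :
    L.piecewise F x = F p x := by
  have : (LinearEquiv.ofBijective (DirectSum.coeLinearMap L.piece) L.isInternal).symm x
      = DirectSum.lof ℝ ℤ (fun k => L.piece k) p ⟨x, hx⟩ := by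
    rw [LinearEquiv.symm_apply_eq]
    exact (DirectSum.coeLinearMap_lof L.piece p ⟨x, hx⟩).symm
  simp [piecewise, this]

/-- The operator `y ↦ (-1)^{p|y|} y`. -/
def sgn (p : ℤ) : 𝔤 →ₗ[ℝ] 𝔤 := L.piecewise fun q => chi p q • LinearMap.id

theorem sgn_apply (p : ℤ) {q : ℤ} {y : 𝔤} (hy : y ∈ L.piece q) : L.sgn p y = chi p q • y := by
  simp [sgn, L.piecewise_apply _ hy]

/-- The braiding `x ⊗ (y ⊗ n) ↦ (-1)^{|x||y|} y ⊗ (x ⊗ n)`. -/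
def braid : 𝔤 ⊗[ℝ] (𝔤 ⊗[ℝ] N) →ₗ[ℝ] 𝔤 ⊗[ℝ] (𝔤 ⊗[ℝ] N) :=
  TensorProduct.lift <| L.piecewise fun p =>
    { toFun := fun x => TensorProduct.map (L.sgn p) (TensorProduct.mk ℝ 𝔤 N x)
      map_add' := fun x y => by rw [map_add, TensorProduct.map_add_right]
      map_smul' := fun r x => by rw [map_smul, TensorProduct.map_smul_right]; rfl }

theorem braid_tmul {p : ℤ} {x : 𝔤} (hx : x ∈ L.piece p) (z : 𝔤 ⊗[ℝ] N) :
    L.braid (x ⊗ₜ z) = TensorProduct.map (L.sgn p) (TensorProduct.mk ℝ 𝔤 N x) z := by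
  simp [braid, L.piecewise_apply _ hx]

theorem braid_tmul_tmul {p q : ℤ} {x y : 𝔤} (hx : x ∈ L.piece p) (hy : y ∈ L.piece q) (n : N) :
    L.braid (x ⊗ₜ (y ⊗ₜ n)) = chi p q • (y ⊗ₜ (x ⊗ₜ n)) := by
  rw [L.braid_tmul hx, TensorProduct.map_tmul, L.sgn_apply p hy, TensorProduct.smul_tmul']
  rfl

theorem braid_comp_braid : L.braid ∘ₗ L.braid = (LinearMap.id : 𝔤 ⊗[ℝ] (𝔤 ⊗[ℝ] N) →ₗ[ℝ] _) := by
  refine L.tensor_hom_ext₂ fun p q x y n hx hy => ?_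
  simp [L.braid_tmul_tmul hx hy, L.braid_tmul_tmul hy hx, smul_smul, chi_comm q p, chi_mul_self]

theorem braid_braid (z : 𝔤 ⊗[ℝ] (𝔤 ⊗[ℝ] N)) : L.braid (L.braid z) = z :=
  LinearMap.congr_fun L.braid_comp_braid z

theorem braid_lTensor_lTensor (f : N →ₗ[ℝ] N') (z : 𝔤 ⊗[ℝ] (𝔤 ⊗[ℝ] N)) :
    L.braid ((f.lTensor 𝔤).lTensor 𝔤 z) = (f.lTensor 𝔤).lTensor 𝔤 (L.braid z) := by
  refine LinearMap.congr_fun (f := L.braid ∘ₗ (f.lTensor 𝔤).lTensor 𝔤)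
    (g := (f.lTensor 𝔤).lTensor 𝔤 ∘ₗ L.braid) (L.tensor_hom_ext₂ fun p q x y n hx hy => ?_) z
  simp [L.braid_tmul_tmul hx hy]

/-- The sign attached to each factor depends only on that factor, so it travels with it through the
braiding. -/
theorem braid_map_sgn (p : ℤ) (f : N →ₗ[ℝ] N') (z : 𝔤 ⊗[ℝ] (𝔤 ⊗[ℝ] N)) :
    L.braid (TensorProduct.map (L.sgn p) (TensorProduct.map (L.sgn p) f) z)
      = TensorProduct.map (L.sgn p) (TensorProduct.map (L.sgn p) f) (L.braid z) := by
  refine LinearMap.congr_fun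
    (f := L.braid ∘ₗ TensorProduct.map (L.sgn p) (TensorProduct.map (L.sgn p) f))
    (g := TensorProduct.map (L.sgn p) (TensorProduct.map (L.sgn p) f) ∘ₗ L.braid)
    (L.tensor_hom_ext₂ fun q r x y n hx hy => ?_) z
  simp only [LinearMap.comp_apply, TensorProduct.map_tmul, L.sgn_apply p hx, L.sgn_apply p hy,
    L.braid_tmul_tmul hx hy, map_smul, ← TensorProduct.smul_tmul', TensorProduct.tmul_smul]
  module

/-! ### The bracket on tensors -/

/-- The map `x ⊗ (y ⊗ n) ↦ [x, y] ⊗ n`. -/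
def br : 𝔤 ⊗[ℝ] (𝔤 ⊗[ℝ] N) →ₗ[ℝ] 𝔤 ⊗[ℝ] N :=
  TensorProduct.lift ((LinearMap.rTensorHom N) ∘ₗ L.bracket)

@[simp] theorem br_tmul (x y : 𝔤) (n : N) : L.br (x ⊗ₜ (y ⊗ₜ n)) = L.bracket x y ⊗ₜ n := by
  simp [br]

theorem bracket_swap {p q : ℤ} {x y : 𝔤} (hx : x ∈ L.piece p) (hy : y ∈ L.piece q) :
    L.bracket x y = -(chi p q • L.bracket y x) :=
  eq_neg_of_add_eq_zero_left (L.antisymm hx hy)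

theorem br_lTensor_lTensor (f : N →ₗ[ℝ] N') (z : 𝔤 ⊗[ℝ] (𝔤 ⊗[ℝ] N)) :
    L.br ((f.lTensor 𝔤).lTensor 𝔤 z) = f.lTensor 𝔤 (L.br z) := by
  refine LinearMap.congr_fun (f := L.br ∘ₗ (f.lTensor 𝔤).lTensor 𝔤)
    (g := f.lTensor 𝔤 ∘ₗ L.br) (L.tensor_hom_ext₂ fun p q x y n hx hy => ?_) z
  simp

/-- Since |[x, y]| = |x| + |y|, passing [x, y] across a third factor costs the same sign as passing
y and then x. -/
theorem braid_br (z : 𝔤 ⊗[ℝ] (𝔤 ⊗[ℝ] (𝔤 ⊗[ℝ] N))) :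
    L.braid (L.br z) = L.br.lTensor 𝔤 (L.braid (L.braid.lTensor 𝔤 z)) := by
  refine LinearMap.congr_fun (f := L.braid ∘ₗ L.br)
    (g := L.br.lTensor 𝔤 ∘ₗ L.braid ∘ₗ L.braid.lTensor 𝔤)
    (L.tensor_hom_ext₃ fun p q r x y z n hx hy hz => ?_) z
  simp only [LinearMap.comp_apply, br_tmul, L.braid_tmul_tmul (L.bracket_mem hx hy) hz,
    LinearMap.lTensor_tmul, L.braid_tmul_tmul hy hz, TensorProduct.tmul_smul, map_smul,
    L.braid_tmul_tmul hx hz, smul_smul, chi_add_left]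
  rw [mul_comm]

/-- A cyclic permutation is a product of two adjacent braidings, and these produce the Jacobi signs
up to the common factor (-1)^{|x||z|}. In this form the identity can be applied to antisymmetric
tensors without signs. -/
theorem jacobi_tensor (z : 𝔤 ⊗[ℝ] (𝔤 ⊗[ℝ] (𝔤 ⊗[ℝ] N))) :
    L.br (L.br z) + L.br (L.br (L.braid.lTensor 𝔤 (L.braid z)))
      + L.br (L.br (L.braid.lTensor 𝔤 (L.braid (L.braid.lTensor 𝔤 (L.braid z))))) = 0 := by
  refine LinearMap.congr_fun (f := L.br ∘ₗ L.br + L.br ∘ₗ L.br ∘ₗ L.braid.lTensor 𝔤 ∘ₗ L.braid +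
      L.br ∘ₗ L.br ∘ₗ L.braid.lTensor 𝔤 ∘ₗ L.braid ∘ₗ L.braid.lTensor 𝔤 ∘ₗ L.braid)
    (g := 0) (L.tensor_hom_ext₃ fun p q r x y z n hx hy hz => ?_) z
  simp only [LinearMap.add_apply, LinearMap.comp_apply, br_tmul, LinearMap.lTensor_tmul,
    L.braid_tmul_tmul hx hy, L.braid_tmul_tmul hx hz, L.braid_tmul_tmul hy hz,
    L.braid_tmul_tmul hy hx, TensorProduct.tmul_smul, map_smul, smul_smul, LinearMap.zero_apply]
  have h := L.jacobi hx hy hz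
  simp only [TensorProduct.smul_tmul', ← TensorProduct.add_tmul]
  have e : L.bracket (L.bracket x y) z + (chi p q * chi p r) • L.bracket (L.bracket y z) x
      + (chi p q * chi p r * chi q r * chi q p) • L.bracket (L.bracket z x) y
      = chi p r • (chi p r • L.bracket (L.bracket x y) z + chi q p • L.bracket (L.bracket y z) x
      + chi r q • L.bracket (L.bracket z x) y) := by
    rw [smul_add, smul_add, smul_smul, smul_smul, smul_smul, chi_mul_self, one_smul,
      chi_comm q p, chi_comm r q, mul_comm (chi p q) (chi p r)]
    congr 2
    linear_combination (chi p r * chi q r) * chi_mul_self p q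
  rw [e]
  unfold chi
  rw [h, smul_zero, TensorProduct.zero_tmul]

/-- Graded antisymmetry turns [x, [y, z]] into a multiple of [[y, z], x], which reduces nested
brackets on the right to those on the left. -/
theorem br_lTensor_br (z : 𝔤 ⊗[ℝ] (𝔤 ⊗[ℝ] (𝔤 ⊗[ℝ] N))) :
    L.br (L.br.lTensor 𝔤 z) = -L.br (L.br (L.braid.lTensor 𝔤 (L.braid z))) := by
  refine LinearMap.congr_fun (f := L.br ∘ₗ L.br.lTensor 𝔤)
    (g := -(L.br ∘ₗ L.br ∘ₗ L.braid.lTensor 𝔤 ∘ₗ L.braid))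
    (L.tensor_hom_ext₃ fun p q r x y z n hx hy hz => ?_) z
  simp only [LinearMap.neg_apply, LinearMap.comp_apply, br_tmul, LinearMap.lTensor_tmul,
    L.braid_tmul_tmul hx hy, L.braid_tmul_tmul hx hz, TensorProduct.tmul_smul, map_smul, smul_smul,
    L.bracket_swap hx (L.bracket_mem hy hz), TensorProduct.neg_tmul]
  rw [chi_comm p (q + r), chi_add_left, chi_comm q p, chi_comm r p]
  simp only [TensorProduct.smul_tmul']

end

end RealGradedLieAlgebra

namespace RealGradedLieAlgebra

noncomputable section

variable {𝔤 : Type*} [AddCommGroup 𝔤] [Module ℝ 𝔤] (L : RealGradedLieAlgebra 𝔤)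

/-! ### The graded exterior algebra -/

/-- The graded exterior algebra `⋀ 𝔤 = ⨁ₙ ⋀ⁿ 𝔤`, as a vector space. -/
def Ext : Type _ := DirectSum ℕ fun n => L.ExtPow n

instance : AddCommGroup L.Ext := inferInstanceAs (AddCommGroup (DirectSum ℕ fun n => L.ExtPow n))

instance : Module ℝ L.Ext := inferInstanceAs (Module ℝ (DirectSum ℕ fun n => L.ExtPow n))

/-- The inclusion of `⋀ⁿ 𝔤` in `⋀ 𝔤`. -/
def extOf (n : ℕ) : L.ExtPow n →ₗ[ℝ] L.Ext := DirectSum.lof ℝ ℕ (fun n => L.ExtPow n) n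

/-- The projection of `⋀ 𝔤` onto `⋀ⁿ 𝔤`. -/
def extProj (n : ℕ) : L.Ext →ₗ[ℝ] L.ExtPow n := DirectSum.component ℝ ℕ (fun n => L.ExtPow n) n

theorem extProj_extOf (n : ℕ) (w : L.ExtPow n) : L.extProj n (L.extOf n w) = w :=
  DirectSum.component.lof_self ℝ n w

theorem extProj_extOf_of_ne {m n : ℕ} (h : m ≠ n) (w : L.ExtPow m) :
    L.extProj n (L.extOf m w) = 0 :=
  (DirectSum.component.of ℝ n m w).trans (dif_neg h)

/-- The linear map out of `⋀ 𝔤` with given restrictions to the `⋀ⁿ 𝔤`. -/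
def extLift {X : Type*} [AddCommGroup X] [Module ℝ X] (f : ∀ n, L.ExtPow n →ₗ[ℝ] X) :
    L.Ext →ₗ[ℝ] X := DirectSum.toModule ℝ ℕ X f

@[simp] theorem extLift_extOf {X : Type*} [AddCommGroup X] [Module ℝ X]
    (f : ∀ n, L.ExtPow n →ₗ[ℝ] X) (n : ℕ) (w : L.ExtPow n) : L.extLift f (L.extOf n w) = f n w :=
  DirectSum.toModule_lof ℝ n w

/-- Left multiplication `⋀ⁿ 𝔤 → ⋀ⁿ⁺¹ 𝔤`. -/
def powWedge (n : ℕ) : 𝔤 →ₗ[ℝ] L.ExtPow n →ₗ[ℝ] L.ExtPow (n + 1) := (L.exists_wedgeLeft n).choose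

theorem powWedge_wedge (n : ℕ) (x : 𝔤) (a : Fin n → 𝔤) :
    L.powWedge n x (L.wedge n a) = L.wedge (n + 1) (Fin.cons x a) :=
  (L.exists_wedgeLeft n).choose_spec x a

/-- The map `⋀ⁿ⁺¹ 𝔤 → 𝔤 ⊗ ⋀ⁿ 𝔤` that extracts a factor. -/
def powExtract (n : ℕ) : L.ExtPow (n + 1) →ₗ[ℝ] 𝔤 ⊗[ℝ] L.ExtPow n := (L.exists_extract n).choose

theorem powExtract_wedge {n : ℕ} {d : Fin (n + 1) → ℤ} {a : Fin (n + 1) → 𝔤}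
    (ha : ∀ k, a k ∈ L.piece (d k)) :
    L.powExtract n (L.wedge (n + 1) a) = ∑ i : Fin (n + 1), ((-1 : ℝ) ^ (i : ℕ) * sign₁ d i) •
        (a i ⊗ₜ[ℝ] L.wedge n (i.removeNth a)) :=
  (L.exists_extract n).choose_spec d a ha

/-- Left multiplication in `⋀ 𝔤`. -/
def extWedge : 𝔤 →ₗ[ℝ] L.Ext →ₗ[ℝ] L.Ext :=
  (L.extLift fun n => ((L.powWedge n).compr₂ (L.extOf (n + 1))).flip).flip

@[simp] theorem extWedge_extOf (x : 𝔤) (n : ℕ) (w : L.ExtPow n) :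
    L.extWedge x (L.extOf n w) = L.extOf (n + 1) (L.powWedge n x w) := by
  simp [extWedge]

/-- The unit of `⋀ 𝔤`. -/
def vac : L.Ext := L.extOf 0 (L.wedge 0 Fin.elim0)

/-- The map `⋀ 𝔤 → 𝔤 ⊗ ⋀ 𝔤` that extracts a factor. -/
def extract : L.Ext →ₗ[ℝ] 𝔤 ⊗[ℝ] L.Ext :=
  L.extLift fun
    | 0 => 0
    | n + 1 => (L.extOf n).lTensor 𝔤 ∘ₗ L.powExtract n

@[simp] theorem extract_extOf_zero (w : L.ExtPow 0) : L.extract (L.extOf 0 w) = 0 := by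
  simp [extract]

@[simp] theorem extract_extOf_succ (n : ℕ) (w : L.ExtPow (n + 1)) :
    L.extract (L.extOf (n + 1) w) = (L.extOf n).lTensor 𝔤 (L.powExtract n w) := by
  simp [extract]

theorem extPow_le_of_wedge_mem {n : ℕ} {P : Submodule ℝ (L.ExtPow n)}
    (h : ∀ a, L.wedge n a ∈ P) (w : L.ExtPow n) : w ∈ P := by
  have h1 : P.mkQ ∘ₗ (L.wedgeRel n).mkQ = 0 := by
    refine PiTensorProduct.ext (MultilinearMap.ext fun a => ?_)
    exact (Submodule.Quotient.mk_eq_zero P).2 (h a)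
  obtain ⟨t, rfl⟩ := (L.wedgeRel n).mkQ_surjective w
  exact (Submodule.Quotient.mk_eq_zero P).1 (LinearMap.congr_fun h1 t)

theorem extOf_wedge_mem {P : Submodule ℝ L.Ext} (h0 : L.vac ∈ P)
    (h1 : ∀ p x, x ∈ L.piece p → ∀ w ∈ P, L.extWedge x w ∈ P) (n : ℕ) (a : Fin n → 𝔤) :
    L.extOf n (L.wedge n a) ∈ P := by
  induction n with
  | zero => rwa [Subsingleton.elim a Fin.elim0]
  | succ n ih =>
    rw [← Fin.cons_self_tail a, ← L.powWedge_wedge, ← L.extWedge_extOf]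
    refine L.hom_induction (P := fun x => L.extWedge x (L.extOf n (L.wedge n (Fin.tail a))) ∈ P)
      _ (fun p x hx => h1 p x hx _ (ih _)) (fun x y hx hy => ?_)
    rw [map_add]
    exact add_mem hx hy

theorem ext_mem {P : Submodule ℝ L.Ext} (h : ∀ n w, L.extOf n w ∈ P) (w : L.Ext) : w ∈ P := by
  refine DirectSum.induction_on (motive := fun w => w ∈ P) w (zero_mem _) (fun n w => h n w)
    fun x y hx hy => add_mem hx hy

theorem ext_le_of_extWedge_mem {P : Submodule ℝ L.Ext} (h0 : L.vac ∈ P)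
    (h1 : ∀ p x, x ∈ L.piece p → ∀ w ∈ P, L.extWedge x w ∈ P) (w : L.Ext) : w ∈ P :=
  L.ext_mem (fun n => L.extPow_le_of_wedge_mem (P := P.comap (L.extOf n))
    (L.extOf_wedge_mem h0 h1 n)) w

variable {X : Type*} [AddCommGroup X] [Module ℝ X]

theorem ext_hom_ext {f g : L.Ext →ₗ[ℝ] X} (h0 : f L.vac = g L.vac)
    (h1 : ∀ p x w, x ∈ L.piece p → f w = g w → f (L.extWedge x w) = g (L.extWedge x w)) :
    f = g :=
  LinearMap.ext fun w => L.ext_le_of_extWedge_mem (P := LinearMap.eqLocus f g) h0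
    (fun p x hx w hw => h1 p x w hx hw) w

theorem extract_vac : L.extract L.vac = 0 := by simp [vac]

/-- Splitting one factor at a time into homogeneous parts reduces to homogeneous families, the only
ones for which the index formulas are available. -/
theorem hom_wedge_mem {n : ℕ} {P : Submodule ℝ (L.ExtPow n)}
    (h : ∀ (d : Fin n → ℤ) (a : Fin n → 𝔤), (∀ k, a k ∈ L.piece (d k)) → L.wedge n a ∈ P)
    (w : L.ExtPow n) : w ∈ P := by
  induction n with
  | zero => exact L.extPow_le_of_wedge_mem (fun a => h Fin.elim0 a fun k => k.elim0) w
  | succ n ih =>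
    have key : ∀ x, ∀ w, L.powWedge n x w ∈ P := by
      refine fun x => L.hom_induction (P := fun x => ∀ w, L.powWedge n x w ∈ P) x
        (fun p x hx w => ?_) fun x y hx hy w => ?_
      · refine ih (P := P.comap (L.powWedge n x)) (fun d a ha => ?_) w
        rw [Submodule.mem_comap, L.powWedge_wedge]
        refine h (Fin.cons p d) (Fin.cons x a) fun k => ?_
        refine Fin.cases ?_ ?_ k <;> simp [hx, ha]
      · rw [map_add]; exact add_mem (hx w) (hy w)
    refine L.extPow_le_of_wedge_mem (fun a => ?_) w
    rw [← Fin.cons_self_tail a, ← L.powWedge_wedge]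
    exact key _ _

theorem powExtract_powWedge_zero (x : 𝔤) (w : L.ExtPow 0) :
    L.powExtract 0 (L.powWedge 0 x w) = x ⊗ₜ w := by
  refine L.hom_induction (P := fun x => L.powExtract 0 (L.powWedge 0 x w) = x ⊗ₜ w) x
    (fun p x hx => ?_) fun x y hx hy => ?_
  · refine L.hom_wedge_mem (P := LinearMap.eqLocus (L.powExtract 0 ∘ₗ L.powWedge 0 x)
      (TensorProduct.mk ℝ 𝔤 _ x)) (fun d a _ => ?_) w
    rw [LinearMap.mem_eqLocus, LinearMap.comp_apply, L.powWedge_wedge,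
      L.powExtract_wedge (d := Fin.cons p d) (fun k => by
        refine Fin.cases ?_ (fun k => k.elim0) k; simp [hx])]
    simp [sign₁, Fin.removeNth_zero]
  · rw [map_add, LinearMap.add_apply, map_add, hx, hy, TensorProduct.add_tmul]

theorem sign₁_cons_succ {n : ℕ} (p : ℤ) (d : Fin n → ℤ) (i : Fin n) :
    sign₁ (Fin.cons p d : Fin (n + 1) → ℤ) i.succ = chi p (d i) * sign₁ d i := by
  rw [sign₁, sign₁, Finset.prod_filter, Finset.prod_filter, Fin.prod_univ_succ]
  simp [chi]

/-- In the sum for x ∧ w, the index 0 gives x ⊗ w; every later index is shifted by one and its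
factor has to cross x, hence the sign -(-1)^{|x||a_i|}. This recursion replaces the indexed sum in
the arguments on ⋀. -/
theorem powExtract_powWedge_succ {p : ℤ} {x : 𝔤} (hx : x ∈ L.piece p) {n : ℕ}
    (w : L.ExtPow (n + 1)) :
    L.powExtract (n + 1) (L.powWedge (n + 1) x w)
      = x ⊗ₜ w - TensorProduct.map (L.sgn p) (L.powWedge n x) (L.powExtract n w) := by
  refine L.hom_wedge_mem (P := LinearMap.eqLocus (L.powExtract (n + 1) ∘ₗ L.powWedge (n + 1) x)
    (TensorProduct.mk ℝ 𝔤 _ x - TensorProduct.map (L.sgn p) (L.powWedge n x) ∘ₗ L.powExtract n))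
    (fun d a ha => ?_) w
  rw [LinearMap.mem_eqLocus, LinearMap.comp_apply, L.powWedge_wedge,
    L.powExtract_wedge (d := Fin.cons p d) (fun k => by
      refine Fin.cases ?_ ?_ k <;> simp [hx, ha]), Fin.sum_univ_succ]
  rw [LinearMap.sub_apply, LinearMap.comp_apply, L.powExtract_wedge ha]
  simp only [map_sum, map_smul,
    TensorProduct.map_tmul, L.sgn_apply p (ha _), L.powWedge_wedge, sign₁_cons_succ,
    TensorProduct.mk_apply]
  rw [sub_eq_add_neg, ← Finset.sum_neg_distrib]
  congr 1
  · simp [sign₁, Fin.removeNth_zero]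
  · refine Finset.sum_congr rfl fun i _ => ?_
    have e : i.succ.removeNth (Fin.cons x a : Fin (n + 2) → 𝔤) = Fin.cons x (i.removeNth a) := by
      funext k
      refine Fin.cases ?_ (fun k => ?_) k <;> simp [Fin.removeNth]
    rw [e, Fin.cons_succ, ← TensorProduct.smul_tmul', smul_smul, ← neg_smul, Fin.val_succ]
    congr 1
    ring

theorem extract_extWedge {p : ℤ} {x : 𝔤} (hx : x ∈ L.piece p) (w : L.Ext) :
    L.extract (L.extWedge x w)
      = x ⊗ₜ w - TensorProduct.map (L.sgn p) (L.extWedge x) (L.extract w) := by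
  refine L.ext_mem (P := LinearMap.eqLocus (L.extract ∘ₗ L.extWedge x)
    (TensorProduct.mk ℝ 𝔤 _ x - TensorProduct.map (L.sgn p) (L.extWedge x) ∘ₗ L.extract))
    (fun n w => ?_) w
  cases n with
  | zero => simp [L.powExtract_powWedge_zero]
  | succ n =>
    simp only [LinearMap.mem_eqLocus, LinearMap.comp_apply, LinearMap.sub_apply, extWedge_extOf,
      extract_extOf_succ, L.powExtract_powWedge_succ hx, map_sub, LinearMap.lTensor_tmul,
      TensorProduct.mk_apply]
    congr 1
    induction L.powExtract n w using TensorProduct.induction_on with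
    | zero => simp
    | add z z' hz hz' => simp only [map_add, hz, hz']
    | tmul y v => simp

theorem powWedge_powWedge {p q : ℤ} {x y : 𝔤} (hx : x ∈ L.piece p) (hy : y ∈ L.piece q) {n : ℕ}
    (w : L.ExtPow n) : L.powWedge (n + 1) x (L.powWedge n y w)
      = -(chi p q • L.powWedge (n + 1) y (L.powWedge n x w)) := by
  refine L.hom_wedge_mem (P := LinearMap.eqLocus (L.powWedge (n + 1) x ∘ₗ L.powWedge n y)
    (-(chi p q • L.powWedge (n + 1) y ∘ₗ L.powWedge n x))) (fun d a ha => ?_) w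
  simp only [LinearMap.mem_eqLocus, LinearMap.comp_apply, LinearMap.neg_apply,
    LinearMap.smul_apply, L.powWedge_wedge]
  have := L.wedge_swap (n := n + 2) (Fin.cons q (Fin.cons p d)) (Fin.cons y (Fin.cons x a)) 0 1
    (fun k => by
      refine Fin.cases ?_ (fun k => Fin.cases ?_ (fun k => ?_) k) k <;> simp [hx, hy, ha]) rfl
  have e : (Fin.cons y (Fin.cons x a) : Fin (n + 2) → 𝔤) ∘ Equiv.swap 0 1
      = Fin.cons x (Fin.cons y a) := by
    funext k
    refine Fin.cases ?_ (fun k => Fin.cases ?_ (fun k => ?_) k) k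
    · simp
    · simp
    · simp [Equiv.swap_apply_of_ne_of_ne, Fin.ext_iff]
  rw [e] at this
  rw [this, chi_comm]
  simp [chi]

theorem extWedge_extWedge {p q : ℤ} {x y : 𝔤} (hx : x ∈ L.piece p) (hy : y ∈ L.piece q)
    (w : L.Ext) : L.extWedge x (L.extWedge y w) = -(chi p q • L.extWedge y (L.extWedge x w)) := by
  refine L.ext_mem (P := LinearMap.eqLocus (L.extWedge x ∘ₗ L.extWedge y)
    (-(chi p q • L.extWedge y ∘ₗ L.extWedge x))) (fun n w => ?_) w
  simp [L.powWedge_powWedge hx hy w]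

end

end RealGradedLieAlgebra

namespace RealGradedLieAlgebra

noncomputable section

variable {𝔤 : Type*} [AddCommGroup 𝔤] [Module ℝ 𝔤] (L : RealGradedLieAlgebra 𝔤)

/-! ### The bracket part of the differential on the exterior algebra -/

/-- Left multiplication `𝔤 ⊗ ⋀ 𝔤 → ⋀ 𝔤`. -/
def wedgeT : 𝔤 ⊗[ℝ] L.Ext →ₗ[ℝ] L.Ext := TensorProduct.lift L.extWedge

@[simp] theorem wedgeT_tmul (x : 𝔤) (w : L.Ext) : L.wedgeT (x ⊗ₜ w) = L.extWedge x w := by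
  simp [wedgeT]

theorem lTensor_wedgeT_braid_tmul {p : ℤ} {x : 𝔤} (hx : x ∈ L.piece p) (z : 𝔤 ⊗[ℝ] L.Ext) :
    L.wedgeT.lTensor 𝔤 (L.braid (x ⊗ₜ z)) = TensorProduct.map (L.sgn p) (L.extWedge x) z := by
  rw [L.braid_tmul hx]
  induction z using TensorProduct.induction_on with
  | zero => simp
  | add z z' hz hz' => simp only [map_add, hz, hz']
  | tmul y v => simp

/-- The recursion `extract_extWedge` freed from the choice of a homogeneous x: the braiding supplies
the sign. -/
theorem extract_wedgeT (z : 𝔤 ⊗[ℝ] L.Ext) :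
    L.extract (L.wedgeT z) = z - L.wedgeT.lTensor 𝔤 (L.braid (L.extract.lTensor 𝔤 z)) := by
  refine LinearMap.congr_fun (f := L.extract ∘ₗ L.wedgeT)
    (g := LinearMap.id - L.wedgeT.lTensor 𝔤 ∘ₗ L.braid ∘ₗ L.extract.lTensor 𝔤)
    (L.tensor_hom_ext fun p x w hx => ?_) z
  simp only [LinearMap.comp_apply, LinearMap.sub_apply, LinearMap.id_apply, wedgeT_tmul,
    LinearMap.lTensor_tmul, L.lTensor_wedgeT_braid_tmul hx, L.extract_extWedge hx]

theorem wedgeT_lTensor_wedgeT_braid (z : 𝔤 ⊗[ℝ] (𝔤 ⊗[ℝ] L.Ext)) :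
    L.wedgeT (L.wedgeT.lTensor 𝔤 (L.braid z)) = -L.wedgeT (L.wedgeT.lTensor 𝔤 z) := by
  refine LinearMap.congr_fun (f := L.wedgeT ∘ₗ L.wedgeT.lTensor 𝔤 ∘ₗ L.braid)
    (g := -(L.wedgeT ∘ₗ L.wedgeT.lTensor 𝔤)) (L.tensor_hom_ext₂ fun p q x y w hx hy => ?_) z
  simp [L.braid_tmul_tmul hx hy, L.extWedge_extWedge hx hy]

theorem wedgeT_extract_extWedge (x : 𝔤) (w : L.Ext) :
    L.wedgeT (L.extract (L.extWedge x w))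
      = L.extWedge x w + L.extWedge x (L.wedgeT (L.extract w)) := by
  rw [← wedgeT_tmul, extract_wedgeT, map_sub, wedgeT_lTensor_wedgeT_braid]
  simp

/-- Euler's identity. In positive degree it makes `extract` injective, which is how vanishing in ⋀
is tested. -/
theorem wedgeT_extract_extOf (n : ℕ) (w : L.ExtPow n) :
    L.wedgeT (L.extract (L.extOf n w)) = (n : ℝ) • L.extOf n w := by
  induction n with
  | zero => simp
  | succ n ih =>
    refine L.extPow_le_of_wedge_mem (P := LinearMap.eqLocus
      (L.wedgeT ∘ₗ L.extract ∘ₗ L.extOf (n + 1)) (((n + 1 : ℕ) : ℝ) • L.extOf (n + 1)))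
      (fun a => ?_) w
    rw [← Fin.cons_self_tail a, ← L.powWedge_wedge, LinearMap.mem_eqLocus, LinearMap.comp_apply,
      LinearMap.comp_apply, LinearMap.smul_apply, ← L.extWedge_extOf, wedgeT_extract_extWedge, ih,
      map_smul]
    push_cast
    module

/-- The map `⋀ 𝔤 → 𝔤 ⊗ 𝔤 ⊗ ⋀ 𝔤` that extracts two factors. -/
def extract₂ : L.Ext →ₗ[ℝ] 𝔤 ⊗[ℝ] (𝔤 ⊗[ℝ] L.Ext) := L.extract.lTensor 𝔤 ∘ₗ L.extract

theorem lTensor_extract_map (p : ℤ) {x : 𝔤} (hx : x ∈ L.piece p) (z : 𝔤 ⊗[ℝ] L.Ext) :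
    L.extract.lTensor 𝔤 (TensorProduct.map (L.sgn p) (L.extWedge x) z)
      = L.braid (x ⊗ₜ z) - TensorProduct.map (L.sgn p)
          (TensorProduct.map (L.sgn p) (L.extWedge x)) (L.extract.lTensor 𝔤 z) := by
  rw [L.braid_tmul hx]
  induction z using TensorProduct.induction_on with
  | zero => simp
  | add z z' hz hz' => simp only [map_add, hz, hz']; abel
  | tmul y v => simp [L.extract_extWedge hx, TensorProduct.tmul_sub]

/-- By induction on w: in the expansion of `extract₂` at x ∧ w, the terms where x is one of the two
extracted factors form a tensor minus its braiding, which is antisymmetric because the braiding is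
an involution. The remaining term inherits antisymmetry from w. -/
theorem braid_extract₂ (w : L.Ext) : L.braid (L.extract₂ w) = -L.extract₂ w := by
  refine LinearMap.congr_fun (f := L.braid ∘ₗ L.extract₂) (g := -L.extract₂)
    (L.ext_hom_ext ?_ fun p x w hx hw => ?_) w
  · simp [extract₂, L.extract_vac]
  · have e : L.extract₂ (L.extWedge x w) = x ⊗ₜ L.extract w - L.braid (x ⊗ₜ L.extract w)
        + TensorProduct.map (L.sgn p) (TensorProduct.map (L.sgn p) (L.extWedge x))
          (L.extract₂ w) := by
      rw [extract₂, LinearMap.comp_apply, L.extract_extWedge hx, map_sub,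
        L.lTensor_extract_map p hx, LinearMap.lTensor_tmul, LinearMap.comp_apply]
      abel
    simp only [LinearMap.comp_apply, LinearMap.neg_apply] at hw ⊢
    rw [e, map_add, map_sub, braid_braid, braid_map_sgn, hw, map_neg]
    abel

/-- The map `⋀ 𝔤 → 𝔤 ⊗ 𝔤 ⊗ 𝔤 ⊗ ⋀ 𝔤` that extracts three factors. -/
def extract₃ : L.Ext →ₗ[ℝ] 𝔤 ⊗[ℝ] (𝔤 ⊗[ℝ] (𝔤 ⊗[ℝ] L.Ext)) := L.extract₂.lTensor 𝔤 ∘ₗ L.extract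

theorem extract₃_apply (w : L.Ext) :
    L.extract₃ w = (L.extract.lTensor 𝔤).lTensor 𝔤 (L.extract₂ w) := by
  simp only [extract₃, extract₂, LinearMap.comp_apply, LinearMap.lTensor_comp]

theorem braid_extract₃ (w : L.Ext) : L.braid (L.extract₃ w) = -L.extract₃ w := by
  rw [extract₃_apply, braid_lTensor_lTensor, braid_extract₂, map_neg]

theorem lTensor_braid_extract₃ (w : L.Ext) :
    L.braid.lTensor 𝔤 (L.extract₃ w) = -L.extract₃ w := by
  have h : L.braid ∘ₗ L.extract₂ = -L.extract₂ := LinearMap.ext L.braid_extract₂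
  rw [extract₃, LinearMap.comp_apply, ← LinearMap.comp_apply (L.braid.lTensor 𝔤),
    ← LinearMap.lTensor_comp, h, LinearMap.lTensor_neg, LinearMap.neg_apply]

/-- The three extracted factors are antisymmetric under both adjacent braidings, hence invariant
under cyclic permutations. The three Jacobi terms therefore coincide, and 3 is invertible. -/
theorem br_br_extract₃ (w : L.Ext) : L.br (L.br (L.extract₃ w)) = 0 := by
  have h := L.jacobi_tensor (L.extract₃ w)
  simp only [braid_extract₃, lTensor_braid_extract₃, map_neg, neg_neg] at h
  have h3 : (3 : ℝ) • L.br (L.br (L.extract₃ w)) = 0 := by rw [← h]; module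
  exact (smul_eq_zero.1 h3).resolve_left (by norm_num)

theorem br_lTensor_br_extract₃ (w : L.Ext) : L.br (L.br.lTensor 𝔤 (L.extract₃ w)) = 0 := by
  rw [br_lTensor_br, braid_extract₃, map_neg, lTensor_braid_extract₃, neg_neg, br_br_extract₃,
    neg_zero]

/-- The part of the differential that comes from the bracket. -/
def extBr : L.Ext →ₗ[ℝ] L.Ext := (-(1 / 2) : ℝ) • (L.wedgeT ∘ₗ L.br ∘ₗ L.extract₂)

theorem extBr_apply (w : L.Ext) :
    L.extBr w = (-(1 / 2) : ℝ) • L.wedgeT (L.br (L.extract₂ w)) := rfl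

/-- An extracted factor either is untouched by the bracket, or is the bracket itself, standing at
the head of the wedge; the latter gives the term in `br`. -/
theorem extract_extBr (w : L.Ext) : L.extract (L.extBr w)
    = -L.extBr.lTensor 𝔤 (L.extract w) - (1 / 2 : ℝ) • L.br (L.extract₂ w) := by
  rw [extBr_apply, map_smul, extract_wedgeT, ← br_lTensor_lTensor, ← extract₃_apply, braid_br,
    lTensor_braid_extract₃, map_neg, braid_extract₃, neg_neg]
  have e : L.extBr.lTensor 𝔤 (L.extract w)
      = (-(1 / 2) : ℝ) • L.wedgeT.lTensor 𝔤 (L.br.lTensor 𝔤 (L.extract₃ w)) := by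
    simp only [extBr, extract₃, LinearMap.lTensor_smul, LinearMap.lTensor_comp,
      LinearMap.smul_apply, LinearMap.comp_apply]
  rw [e]
  module

theorem extract₂_extBr (w : L.Ext) : L.extract₂ (L.extBr w)
    = (L.extBr.lTensor 𝔤).lTensor 𝔤 (L.extract₂ w)
      + (1 / 2 : ℝ) • L.br.lTensor 𝔤 (L.extract₃ w)
      - (1 / 2 : ℝ) • L.br (L.extract₃ w) := by
  have h : L.extract ∘ₗ L.extBr
      = -(L.extBr.lTensor 𝔤 ∘ₗ L.extract) - (1 / 2 : ℝ) • (L.br ∘ₗ L.extract₂) :=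
    LinearMap.ext L.extract_extBr
  rw [extract₂, LinearMap.comp_apply, extract_extBr, map_sub, map_neg, map_smul,
    ← br_lTensor_lTensor, ← extract₃_apply, ← LinearMap.comp_apply (L.extract.lTensor 𝔤),
    ← LinearMap.lTensor_comp, h, LinearMap.lTensor_sub, LinearMap.lTensor_neg,
    LinearMap.lTensor_smul, LinearMap.lTensor_comp, LinearMap.lTensor_comp]
  simp only [LinearMap.sub_apply, LinearMap.neg_apply, LinearMap.smul_apply, LinearMap.comp_apply,
    extract₃]
  module

theorem br_extract₂_extBr (w : L.Ext) :
    L.br (L.extract₂ (L.extBr w)) = L.extBr.lTensor 𝔤 (L.br (L.extract₂ w)) := by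
  rw [extract₂_extBr, map_sub, map_add, map_smul, map_smul, br_br_extract₃,
    br_lTensor_br_extract₃, br_lTensor_lTensor]
  simp

/-! ### Degrees in the exterior algebra -/

/-- The component `⋀ⁿ 𝔤` of `⋀ 𝔤`. -/
def extDeg (n : ℕ) : Submodule ℝ L.Ext := LinearMap.range (L.extOf n)

theorem vac_mem : L.vac ∈ L.extDeg 0 := ⟨_, rfl⟩

theorem extWedge_mem {n : ℕ} (x : 𝔤) {w : L.Ext} (hw : w ∈ L.extDeg n) :
    L.extWedge x w ∈ L.extDeg (n + 1) := by
  obtain ⟨w, rfl⟩ := hw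
  rw [extWedge_extOf]
  exact ⟨_, rfl⟩

theorem extract_eq_zero {w : L.Ext} (hw : w ∈ L.extDeg 0) : L.extract w = 0 := by
  obtain ⟨w, rfl⟩ := hw
  simp

theorem extract_mem {n : ℕ} {w : L.Ext} (hw : w ∈ L.extDeg (n + 1)) :
    ∃ z, L.extract w = (L.extDeg n).subtype.lTensor 𝔤 z := by
  obtain ⟨w, rfl⟩ := hw
  let r : L.ExtPow n →ₗ[ℝ] L.extDeg n := (L.extOf n).rangeRestrict
  refine ⟨r.lTensor 𝔤 (L.powExtract n w), ?_⟩
  rw [extract_extOf_succ, ← LinearMap.comp_apply (LinearMap.lTensor 𝔤 (L.extDeg n).subtype),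
    ← LinearMap.lTensor_comp]
  rfl

theorem wedgeT_extract_of_mem {n : ℕ} {w : L.Ext} (hw : w ∈ L.extDeg n) :
    L.wedgeT (L.extract w) = (n : ℝ) • w := by
  obtain ⟨w, rfl⟩ := hw
  exact L.wedgeT_extract_extOf n w

theorem extract₂_eq_zero {w : L.Ext} (hw : w ∈ L.extDeg 1) : L.extract₂ w = 0 := by
  obtain ⟨z, hz⟩ := L.extract_mem hw
  rw [extract₂, LinearMap.comp_apply, hz, ← LinearMap.comp_apply, ← LinearMap.lTensor_comp]
  have : L.extract ∘ₗ (L.extDeg 0).subtype = 0 :=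
    LinearMap.ext fun w => L.extract_eq_zero w.2
  rw [this, LinearMap.lTensor_zero, LinearMap.zero_apply]

theorem extBr_eq_zero {w : L.Ext} (hw : w ∈ L.extDeg 1) : L.extBr w = 0 := by
  simp [extBr_apply, L.extract₂_eq_zero hw]

theorem extBr_eq_zero_of_mem_zero {w : L.Ext} (hw : w ∈ L.extDeg 0) : L.extBr w = 0 := by
  simp [extBr_apply, extract₂, L.extract_eq_zero hw]

theorem wedgeT_mem {n : ℕ} (z : 𝔤 ⊗[ℝ] L.extDeg n) :
    L.wedgeT ((L.extDeg n).subtype.lTensor 𝔤 z) ∈ L.extDeg (n + 1) := by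
  induction z using TensorProduct.induction_on with
  | zero => simp
  | add z z' hz hz' => rw [map_add, map_add]; exact add_mem hz hz'
  | tmul x w => simpa using L.extWedge_mem x w.2

theorem extBr_mem {n : ℕ} {w : L.Ext} (hw : w ∈ L.extDeg (n + 1)) : L.extBr w ∈ L.extDeg n := by
  cases n with
  | zero => rw [L.extBr_eq_zero hw]; exact zero_mem _
  | succ n =>
    obtain ⟨z, hz⟩ := L.extract_mem hw
    have key : ∃ y, L.br (L.extract₂ w) = (L.extDeg n).subtype.lTensor 𝔤 y := by
      rw [extract₂, LinearMap.comp_apply, hz]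
      clear hz
      induction z using TensorProduct.induction_on with
      | zero => exact ⟨0, by simp⟩
      | add z z' hz hz' =>
        obtain ⟨y, hy⟩ := hz
        obtain ⟨y', hy'⟩ := hz'
        exact ⟨y + y', by simp only [map_add, hy, hy']⟩
      | tmul x v =>
        obtain ⟨y, hy⟩ := L.extract_mem v.2
        refine ⟨L.br (x ⊗ₜ y), ?_⟩
        rw [← br_lTensor_lTensor]
        simp [hy]
    obtain ⟨y, hy⟩ := key
    rw [extBr_apply, hy]
    exact Submodule.smul_mem _ _ (L.wedgeT_mem y)

/-- Extracting a factor from the square gives the square on the remaining factors, which is zero by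
induction, plus bracket terms that cancel by `br_extract₂_extBr`. Euler's identity then concludes
wherever the target degree is positive. -/
theorem extBr_extBr (w : L.Ext) : L.extBr (L.extBr w) = 0 := by
  refine L.ext_mem (P := LinearMap.ker (L.extBr ∘ₗ L.extBr)) (fun n w => ?_) w
  suffices h : ∀ n, ∀ w ∈ L.extDeg n, L.extBr (L.extBr w) = 0 from h n _ ⟨w, rfl⟩
  clear w n
  intro n
  induction n with
  | zero => intro w hw; simp [L.extBr_eq_zero_of_mem_zero hw]
  | succ n ih =>
    intro w hw
    -- Degrees 1 and 2 are separate: the square would land in degree at most 0, where Euler's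
    -- identity says nothing, but `extBr` already vanishes on degree 1.
    match n, ih, hw with
    | 0, _, hw => simp [L.extBr_eq_zero hw]
    | 1, _, hw => exact L.extBr_eq_zero (L.extBr_mem hw)
    | n + 2, ih, hw =>
      obtain ⟨z, hz⟩ := L.extract_mem hw
      have h0 : (L.extBr ∘ₗ L.extBr) ∘ₗ (L.extDeg (n + 2)).subtype = 0 :=
        LinearMap.ext fun w => ih w w.2
      have h1 : L.extBr.lTensor 𝔤 (L.extBr.lTensor 𝔤 (L.extract w)) = 0 := by
        rw [hz, ← LinearMap.comp_apply, ← LinearMap.comp_apply, ← LinearMap.lTensor_comp,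
          ← LinearMap.lTensor_comp, h0, LinearMap.lTensor_zero,
          LinearMap.zero_apply]
      have h2 : L.extract (L.extBr (L.extBr w)) = 0 := by
        rw [extract_extBr, extract_extBr, br_extract₂_extBr, map_sub, map_neg, h1, map_smul]
        module
      have h3 := L.wedgeT_extract_of_mem (L.extBr_mem (L.extBr_mem hw))
      rw [h2, map_zero] at h3
      exact (smul_eq_zero.1 h3.symm).resolve_left (by positivity)

end

end RealGradedLieAlgebra

namespace RealGradedLieAlgebra

noncomputable section

variable {𝔤 : Type*} [AddCommGroup 𝔤] [Module ℝ 𝔤] (L : RealGradedLieAlgebra 𝔤)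

/-! ### The Koszul differential with coefficients in a right module -/

variable {M M' : Type*} [AddCommGroup M] [Module ℝ M] [AddCommGroup M'] [Module ℝ M']

/-- The map `s ⊗ w ↦ ∑ ρ(s, y) ⊗ w'`, where `∑ y ⊗ w'` extracts a factor from `w`. -/
def hat (ρ : M →ₗ[ℝ] 𝔤 →ₗ[ℝ] M') : M ⊗[ℝ] L.Ext →ₗ[ℝ] M' ⊗[ℝ] L.Ext :=
  TensorProduct.lift (LinearMap.lcomp ℝ _ L.extract ∘ₗ LinearMap.rTensorHom L.Ext ∘ₗ ρ)

@[simp] theorem hat_tmul (ρ : M →ₗ[ℝ] 𝔤 →ₗ[ℝ] M') (s : M) (w : L.Ext) :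
    L.hat ρ (s ⊗ₜ w) = (ρ s).rTensor L.Ext (L.extract w) := by
  simp [hat]

theorem hat_add (ρ ρ' : M →ₗ[ℝ] 𝔤 →ₗ[ℝ] M') : L.hat (ρ + ρ') = L.hat ρ + L.hat ρ' := by
  refine TensorProduct.ext' fun s w => ?_
  simp [LinearMap.rTensor_add]

/-- The Koszul differential on `M ⊗ ⋀ 𝔤` for a right action `ρ` of `𝔤` on `M`. -/
def kD (ρ : M →ₗ[ℝ] 𝔤 →ₗ[ℝ] M) : M ⊗[ℝ] L.Ext →ₗ[ℝ] M ⊗[ℝ] L.Ext :=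
  L.hat ρ + L.extBr.lTensor M

theorem kD_tmul (ρ : M →ₗ[ℝ] 𝔤 →ₗ[ℝ] M) (s : M) (w : L.Ext) :
    L.kD ρ (s ⊗ₜ w) = (ρ s).rTensor L.Ext (L.extract w) + s ⊗ₜ L.extBr w := by
  simp [kD]

/-- The bilinear map `ρ` satisfies at `s` the identity of a right action of `𝔤`. -/
def IsRepAt (ρ : M →ₗ[ℝ] 𝔤 →ₗ[ℝ] M) (s : M) : Prop :=
  ∀ ⦃p q : ℤ⦄ ⦃x y : 𝔤⦄, x ∈ L.piece p → y ∈ L.piece q →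
    ρ (ρ s x) y - chi p q • ρ (ρ s y) x = ρ s (L.bracket x y)

/-- The map `x ⊗ (y ⊗ w) ↦ ρ(ρ(s, x), y) ⊗ w`. -/
def actTwice (ρ : M →ₗ[ℝ] 𝔤 →ₗ[ℝ] M) (s : M) : 𝔤 ⊗[ℝ] (𝔤 ⊗[ℝ] L.Ext) →ₗ[ℝ] M ⊗[ℝ] L.Ext :=
  TensorProduct.lift (LinearMap.rTensorHom L.Ext ∘ₗ ρ ∘ₗ ρ s)

@[simp] theorem actTwice_tmul (ρ : M →ₗ[ℝ] 𝔤 →ₗ[ℝ] M) (s : M) (x : 𝔤) (z : 𝔤 ⊗[ℝ] L.Ext) :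
    L.actTwice ρ s (x ⊗ₜ z) = (ρ (ρ s x)).rTensor L.Ext z := by
  simp [actTwice]

theorem actTwice_braid {ρ : M →ₗ[ℝ] 𝔤 →ₗ[ℝ] M} {s : M} (h : L.IsRepAt ρ s)
    (z : 𝔤 ⊗[ℝ] (𝔤 ⊗[ℝ] L.Ext)) :
    L.actTwice ρ s z - L.actTwice ρ s (L.braid z) = (ρ s).rTensor L.Ext (L.br z) := by
  refine LinearMap.congr_fun (f := L.actTwice ρ s - L.actTwice ρ s ∘ₗ L.braid)
    (g := (ρ s).rTensor L.Ext ∘ₗ L.br) (L.tensor_hom_ext₂ fun p q x y w hx hy => ?_) z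
  simp [L.braid_tmul_tmul hx hy, ← h hx hy, TensorProduct.sub_tmul, TensorProduct.smul_tmul']

theorem kD_rTensor (ρ : M →ₗ[ℝ] 𝔤 →ₗ[ℝ] M) (s : M) (z : 𝔤 ⊗[ℝ] L.Ext) :
    L.kD ρ ((ρ s).rTensor L.Ext z) = L.actTwice ρ s (L.extract.lTensor 𝔤 z)
      + (ρ s).rTensor L.Ext (L.extBr.lTensor 𝔤 z) := by
  induction z using TensorProduct.induction_on with
  | zero => simp
  | add z z' hz hz' => simp only [map_add, hz, hz']; abel
  | tmul x w => simp [kD_tmul]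

/-- On the antisymmetric tensor `extract₂ w`, acting twice equals half of acting by the bracket,
which cancels the half in `extract_extBr`. The action identity is needed at s only; this locality
lets the construction of `symAct` proceed by induction on the degree. -/
theorem kD_kD_tmul {ρ : M →ₗ[ℝ] 𝔤 →ₗ[ℝ] M} {s : M} (h : L.IsRepAt ρ s) (w : L.Ext) :
    L.kD ρ (L.kD ρ (s ⊗ₜ w)) = 0 := by
  have h1 := L.actTwice_braid h (L.extract₂ w)
  rw [braid_extract₂, map_neg, sub_neg_eq_add] at h1
  rw [kD_tmul, map_add, kD_rTensor, kD_tmul, extBr_extBr, extract_extBr, map_sub, map_neg,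
    map_smul, ← h1, extract₂, LinearMap.comp_apply, TensorProduct.tmul_zero]
  module

theorem kD_kD {ρ : M →ₗ[ℝ] 𝔤 →ₗ[ℝ] M} (h : ∀ s, L.IsRepAt ρ s) (z : M ⊗[ℝ] L.Ext) :
    L.kD ρ (L.kD ρ z) = 0 :=
  LinearMap.congr_fun (f := L.kD ρ ∘ₗ L.kD ρ) (g := 0)
    (TensorProduct.ext' fun s w => L.kD_kD_tmul (h s) w) z

theorem hat_hat_tmul {ρ : M →ₗ[ℝ] 𝔤 →ₗ[ℝ] M} {s : M}
    (h : ∀ ⦃p q : ℤ⦄ ⦃x y : 𝔤⦄, x ∈ L.piece p → y ∈ L.piece q →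
      ρ (ρ s x) y = chi p q • ρ (ρ s y) x) (w : L.Ext) :
    L.hat ρ (L.hat ρ (s ⊗ₜ w)) = 0 := by
  have e : ∀ z : 𝔤 ⊗[ℝ] L.Ext,
      L.hat ρ ((ρ s).rTensor L.Ext z) = L.actTwice ρ s (L.extract.lTensor 𝔤 z) := by
    intro z
    induction z using TensorProduct.induction_on with
    | zero => simp
    | add z z' hz hz' => simp only [map_add, hz, hz']
    | tmul x w => simp
  have h1 : ∀ z, L.actTwice ρ s (L.braid z) = L.actTwice ρ s z := fun z => by
    refine LinearMap.congr_fun (f := L.actTwice ρ s ∘ₗ L.braid)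
      (g := L.actTwice ρ s) (L.tensor_hom_ext₂ fun p q x y w hx hy => ?_) z
    simp [L.braid_tmul_tmul hx hy, h hx hy, TensorProduct.smul_tmul']
  have h2 := h1 (L.extract₂ w)
  rw [braid_extract₂, map_neg] at h2
  have h3 : (2 : ℝ) • L.actTwice ρ s (L.extract₂ w) = 0 := by
    rw [two_smul]
    nth_rewrite 1 [← h2]
    exact neg_add_cancel _
  rw [hat_tmul, e]
  exact (smul_eq_zero.1 h3).resolve_left two_ne_zero

end

end RealGradedLieAlgebra

namespace RealGradedLieAlgebra

noncomputable section

variable {𝔤 : Type*} [AddCommGroup 𝔤] [Module ℝ 𝔤] (L : RealGradedLieAlgebra 𝔤)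

/-! ### The enveloping algebra and right actions -/

variable {M A : Type*} [AddCommGroup M] [Module ℝ M] [Ring A] [Algebra ℝ A]

theorem envι_mul_envι {p q : ℤ} {x y : 𝔤} (hx : x ∈ L.piece p) (hy : y ∈ L.piece q) :
    L.envι x * L.envι y - chi p q • (L.envι y * L.envι x) = L.envι (L.bracket x y) := by
  have := RingQuot.mkAlgHom_rel ℝ (EnvRel.comm (L := L) hx hy)
  simpa [envι, chi] using this

/-- The algebra morphism out of `U(𝔤)` that extends a linear map satisfying its relations. -/
def envLift (f : 𝔤 →ₗ[ℝ] A) (h : ∀ ⦃p q : ℤ⦄ ⦃x y : 𝔤⦄, x ∈ L.piece p → y ∈ L.piece q →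
    f x * f y - chi p q • (f y * f x) = f (L.bracket x y)) : L.Env →ₐ[ℝ] A :=
  RingQuot.liftAlgHom ℝ ⟨TensorAlgebra.lift ℝ f, by
    rintro _ _ ⟨ha, hb⟩
    simpa [chi] using h ha hb⟩

@[simp] theorem envLift_envι (f : 𝔤 →ₗ[ℝ] A) (h) (x : 𝔤) : L.envLift f h (L.envι x) = f x := by
  simp [envLift, envι]

theorem env_mem_of_mul_mem {P : Submodule ℝ L.Env} (h1 : 1 ∈ P)
    (hm : ∀ u ∈ P, ∀ x, u * L.envι x ∈ P) (u : L.Env) : u ∈ P := by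
  -- The left factor v is arbitrary so that a product in the tensor algebra can be absorbed one
  -- factor after the other.
  have key : ∀ t : TensorAlgebra ℝ 𝔤, ∀ v ∈ P, v * RingQuot.mkAlgHom ℝ L.EnvRel t ∈ P := by
    intro t
    induction t using TensorAlgebra.induction with
    | algebraMap r =>
      intro v hv
      rw [AlgHom.commutes, ← Algebra.commutes, ← Algebra.smul_def]
      exact P.smul_mem r hv
    | ι x => exact fun v hv => hm v hv x
    | mul s t hs ht =>
      intro v hv
      rw [map_mul, ← mul_assoc]
      exact ht _ (hs v hv)
    | add s t hs ht =>
      intro v hv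
      rw [map_add, mul_add]
      exact add_mem (hs v hv) (ht v hv)
  obtain ⟨t, rfl⟩ := RingQuot.mkAlgHom_surjective ℝ L.EnvRel u
  simpa using key t 1 h1

/-- The right action of `U(𝔤)` that extends a right action of `𝔤`. -/
def actHom (ρ : M →ₗ[ℝ] 𝔤 →ₗ[ℝ] M) (h : ∀ s, L.IsRepAt ρ s) :
    L.Env →ₐ[ℝ] (Module.End ℝ M)ᵐᵒᵖ :=
  L.envLift ((MulOpposite.opLinearEquiv ℝ).toLinearMap ∘ₗ ρ.flip) fun p q x y hx hy => by
    refine MulOpposite.unop_injective (LinearMap.ext fun s => ?_)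
    simpa using h s hx hy

/-- The orbit map `u ↦ s · u` of a right action. -/
def orbit (ρ : M →ₗ[ℝ] 𝔤 →ₗ[ℝ] M) (h : ∀ s, L.IsRepAt ρ s) (s : M) : L.Env →ₗ[ℝ] M :=
  LinearMap.applyₗ s ∘ₗ (MulOpposite.opLinearEquiv ℝ).symm.toLinearMap ∘ₗ
    (L.actHom ρ h).toLinearMap

theorem orbit_one (ρ : M →ₗ[ℝ] 𝔤 →ₗ[ℝ] M) (h : ∀ s, L.IsRepAt ρ s) (s : M) :
    L.orbit ρ h s 1 = s := by
  simp [orbit]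

theorem orbit_mul (ρ : M →ₗ[ℝ] 𝔤 →ₗ[ℝ] M) (h : ∀ s, L.IsRepAt ρ s) (s : M) (u : L.Env) (x : 𝔤) :
    L.orbit ρ h s (u * L.envι x) = ρ (L.orbit ρ h s u) x := by
  simp [orbit, actHom]

/-- Right multiplication `U(𝔤) × 𝔤 → U(𝔤)`. -/
def envMul : L.Env →ₗ[ℝ] 𝔤 →ₗ[ℝ] L.Env := (LinearMap.mul ℝ L.Env).compl₂ L.envι

@[simp] theorem envMul_apply (u : L.Env) (x : 𝔤) : L.envMul u x = u * L.envι x := rfl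

theorem isRepAt_envMul (u : L.Env) : L.IsRepAt L.envMul u := by
  intro p q x y hx hy
  simp only [envMul_apply, ← L.envι_mul_envι hx hy, mul_sub, mul_assoc, mul_smul_comm]

/-! ### The graded symmetric algebra -/

/-- The underlying graded vector space, with the zero bracket. -/
def abelian : RealGradedLieAlgebra 𝔤 where
  piece := L.piece
  isInternal := L.isInternal
  bracket := 0
  bracket_mem _ _ := zero_mem _
  antisymm _ _ := by simp
  jacobi _ _ _ := by simp

/-- The graded symmetric algebra of `𝔤`. -/
def Sym : Type _ := L.abelian.Env

instance : Ring L.Sym := inferInstanceAs (Ring L.abelian.Env)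

instance : Algebra ℝ L.Sym := inferInstanceAs (Algebra ℝ L.abelian.Env)

/-- The canonical map `𝔤 → S(𝔤)`. -/
def symι : 𝔤 →ₗ[ℝ] L.Sym := L.abelian.envι

/-- Right multiplication `S(𝔤) × 𝔤 → S(𝔤)`. -/
def symMul : L.Sym →ₗ[ℝ] 𝔤 →ₗ[ℝ] L.Sym := (LinearMap.mul ℝ L.Sym).compl₂ L.symι

theorem symMul_apply (s : L.Sym) (x : 𝔤) : L.symMul s x = s * L.symι x := rfl

theorem symMul_symMul (s : L.Sym) {p q : ℤ} {x y : 𝔤} (hx : x ∈ L.piece p) (hy : y ∈ L.piece q) :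
    L.symMul (L.symMul s x) y = chi p q • L.symMul (L.symMul s y) x := by
  have := L.abelian.isRepAt_envMul s hx hy
  exact sub_eq_zero.1 (this.trans (map_zero _))

theorem sym_mem {P : Submodule ℝ L.Sym} (h1 : 1 ∈ P)
    (hm : ∀ s ∈ P, ∀ p x, x ∈ L.piece p → L.symMul s x ∈ P) (s : L.Sym) : s ∈ P := by
  refine L.abelian.env_mem_of_mul_mem (P := P) h1 (fun s hs x => ?_) s
  refine L.hom_induction (P := fun x => L.symMul s x ∈ P) x (fun p x hx => hm s hs p x hx)
    fun x y hx hy => ?_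
  rw [map_add]
  exact add_mem hx hy

theorem sym_induction {P : L.Sym → Prop} (s : L.Sym) (one : P 1)
    (mul : ∀ s p x, x ∈ L.piece p → P s → P (L.symMul s x))
    (add : ∀ s t, P s → P t → P (s + t)) (smul : ∀ (r : ℝ) s, P s → P (r • s)) : P s :=
  L.sym_mem (P := { carrier := {s | P s}
                    zero_mem' := by simpa using smul 0 1 one
                    add_mem' := fun {s t} => add s t
                    smul_mem' := smul }) one (fun s hs p x hx => mul s p x hx hs) s

variable {X : Type*} [AddCommGroup X] [Module ℝ X]

theorem sym_hom_ext {f g : L.Sym →ₗ[ℝ] X} (h1 : f 1 = g 1)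
    (hm : ∀ p x s, x ∈ L.piece p → f s = g s → f (L.symMul s x) = g (L.symMul s x)) : f = g :=
  LinearMap.ext fun s => L.sym_mem (P := LinearMap.eqLocus f g) h1
    (fun s hs p x hx => hm p x s hx hs) s

/-- The right action of `𝔤` on `S(𝔤) ⊗ 𝔤`. -/
def symTwist : 𝔤 →ₗ[ℝ] L.Sym ⊗[ℝ] 𝔤 →ₗ[ℝ] L.Sym ⊗[ℝ] 𝔤 :=
  L.piecewise fun q =>
    { toFun := fun y => TensorProduct.map (L.symMul.flip y) (L.sgn q)
      map_add' := fun x y => by rw [map_add, TensorProduct.map_add_left]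
      map_smul' := fun r x => by rw [map_smul, TensorProduct.map_smul_left]; rfl }

theorem symTwist_apply {q : ℤ} {y : 𝔤} (hy : y ∈ L.piece q) (z : L.Sym ⊗[ℝ] 𝔤) :
    L.symTwist y z = TensorProduct.map (L.symMul.flip y) (L.sgn q) z := by
  simp [symTwist, L.piecewise_apply _ hy]

theorem symTwist_tmul {p q : ℤ} {x y : 𝔤} (hx : x ∈ L.piece p) (hy : y ∈ L.piece q) (s : L.Sym) :
    L.symTwist y (s ⊗ₜ x) = chi p q • (L.symMul s y ⊗ₜ x) := by
  simp [L.symTwist_apply hy, L.sgn_apply q hx, chi_comm q p]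

theorem sym_tensor_hom_ext {f g : L.Sym ⊗[ℝ] 𝔤 →ₗ[ℝ] X}
    (h : ∀ p x s, x ∈ L.piece p → f (s ⊗ₜ x) = g (s ⊗ₜ x)) : f = g :=
  TensorProduct.ext (LinearMap.ext fun s => L.hom_ext fun p x hx => h p x s hx)

theorem symTwist_symTwist {p q : ℤ} {x y : 𝔤} (hx : x ∈ L.piece p) (hy : y ∈ L.piece q)
    (z : L.Sym ⊗[ℝ] 𝔤) :
    L.symTwist y (L.symTwist x z) = chi p q • L.symTwist x (L.symTwist y z) := by
  refine LinearMap.congr_fun (f := L.symTwist y ∘ₗ L.symTwist x)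
    (g := chi p q • (L.symTwist x ∘ₗ L.symTwist y)) (L.sym_tensor_hom_ext fun r c s hc => ?_) z
  simp only [LinearMap.comp_apply, LinearMap.smul_apply, L.symTwist_tmul hc hx,
    L.symTwist_tmul hc hy, map_smul, L.symMul_symMul s hx hy, ← TensorProduct.smul_tmul', smul_smul]
  congr 1
  ring

/-- The right action of `𝔤` on `S(𝔤) × S(𝔤) ⊗ 𝔤` that encodes the rule of derivation. -/
def symDerAct : L.Sym × (L.Sym ⊗[ℝ] 𝔤) →ₗ[ℝ] 𝔤 →ₗ[ℝ] L.Sym × (L.Sym ⊗[ℝ] 𝔤) :=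
  LinearMap.mk₂ ℝ (fun a y => (L.symMul a.1 y, a.1 ⊗ₜ y + L.symTwist y a.2))
    (fun a b y => by
      ext <;> simp only [Prod.fst_add, Prod.snd_add, map_add, LinearMap.add_apply,
        TensorProduct.add_tmul]
      abel)
    (fun r a y => by
      ext <;> simp [TensorProduct.smul_tmul', smul_add])
    (fun a x y => by
      ext <;> simp only [Prod.fst_add, Prod.snd_add, map_add, LinearMap.add_apply,
        TensorProduct.tmul_add]
      abel)
    (fun r a y => by
      ext <;> simp [smul_add])

theorem symDerAct_apply (a : L.Sym × (L.Sym ⊗[ℝ] 𝔤)) (y : 𝔤) :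
    L.symDerAct a y = (L.symMul a.1 y, a.1 ⊗ₜ y + L.symTwist y a.2) := rfl

/-- The orbit of (1, 0) will be the graph of `symExtract`, so this commutation replaces the check
that the derivation respects the relations of S(𝔤). The cross terms s y ⊗ x and s x ⊗ y are
exchanged with exactly the braiding sign. -/
theorem isRepAt_symDerAct (a : L.Sym × (L.Sym ⊗[ℝ] 𝔤)) : L.abelian.IsRepAt L.symDerAct a := by
  intro p q x y hx hy
  replace hx : x ∈ L.piece p := hx
  replace hy : y ∈ L.piece q := hy
  refine Eq.trans ?_ (map_zero (L.symDerAct a)).symm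
  rw [sub_eq_zero]
  ext
  · exact L.symMul_symMul a.1 hx hy
  · simp only [symDerAct_apply, Prod.smul_snd, map_add, L.symTwist_tmul hx hy,
      L.symTwist_tmul hy hx, L.symTwist_symTwist hx hy a.2, smul_add, smul_smul, chi_comm q p,
      chi_mul_self, one_smul]
    abel

/-- The derivation `S(𝔤) → S(𝔤) ⊗ 𝔤` that extracts a factor. -/
def symExtract : L.Sym →ₗ[ℝ] L.Sym ⊗[ℝ] 𝔤 :=
  LinearMap.snd ℝ L.Sym (L.Sym ⊗[ℝ] 𝔤) ∘ₗ
    L.abelian.orbit L.symDerAct L.isRepAt_symDerAct (1, 0)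

theorem symExtract_one : L.symExtract 1 = 0 := by
  have := L.abelian.orbit_one L.symDerAct L.isRepAt_symDerAct (1, 0)
  exact congrArg Prod.snd this

theorem symExtract_symMul (s : L.Sym) (y : 𝔤) :
    L.symExtract (L.symMul s y) = s ⊗ₜ y + L.symTwist y (L.symExtract s) := by
  have h := L.abelian.orbit_mul L.symDerAct L.isRepAt_symDerAct (1, 0)
  -- The first component of the orbit map is the identity of S(𝔤), so the second component sees s
  -- itself in the Leibniz rule.
  have h1 : LinearMap.fst ℝ L.Sym (L.Sym ⊗[ℝ] 𝔤) ∘ₗ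
      L.abelian.orbit L.symDerAct L.isRepAt_symDerAct (1, 0) = LinearMap.id := by
    refine L.sym_hom_ext ?_ fun p x s hx hs => ?_
    · exact congrArg Prod.fst (L.abelian.orbit_one L.symDerAct L.isRepAt_symDerAct (1, 0))
    · exact (congrArg Prod.fst (h s x)).trans (congrArg (fun t => L.symMul t x) hs)
  have h2 := congrArg Prod.snd (h s y)
  rw [symDerAct_apply] at h2
  have h3 := LinearMap.congr_fun h1 s
  exact h2.trans (congrArg (fun t => t ⊗ₜ y + L.symTwist y (L.symExtract s)) h3)

/-- Right multiplication `S(𝔤) ⊗ 𝔤 → S(𝔤)`. -/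
def symMulT : L.Sym ⊗[ℝ] 𝔤 →ₗ[ℝ] L.Sym := TensorProduct.lift L.symMul

@[simp] theorem symMulT_tmul (s : L.Sym) (x : 𝔤) : L.symMulT (s ⊗ₜ x) = L.symMul s x := by
  simp [symMulT]

theorem symMulT_symTwist {q : ℤ} {y : 𝔤} (hy : y ∈ L.piece q) (z : L.Sym ⊗[ℝ] 𝔤) :
    L.symMulT (L.symTwist y z) = L.symMul (L.symMulT z) y := by
  refine LinearMap.congr_fun (f := L.symMulT ∘ₗ L.symTwist y)
    (g := L.symMul.flip y ∘ₗ L.symMulT) (L.sym_tensor_hom_ext fun p x s hx => ?_) z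
  simp [L.symTwist_tmul hx hy, L.symMul_symMul s hx hy]

theorem symMulT_symExtract_symMul (s : L.Sym) {q : ℤ} {y : 𝔤} (hy : y ∈ L.piece q) :
    L.symMulT (L.symExtract (L.symMul s y))
      = L.symMul s y + L.symMul (L.symMulT (L.symExtract s)) y := by
  rw [symExtract_symMul, map_add, L.symMulT_symTwist hy, symMulT_tmul]

/-! ### The grading of the symmetric algebra -/

/-- The algebra morphism `S(𝔤) → S(𝔤)[X]` with `x ↦ x X` for `x ∈ 𝔤`. -/
def symGrading : L.Sym →ₐ[ℝ] Polynomial L.Sym :=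
  L.abelian.envLift ((Polynomial.monomial 1 : L.Sym →ₗ[L.Sym] _).restrictScalars ℝ ∘ₗ L.symι)
    fun p q x y hx hy => by
      have h := L.symMul_symMul 1 (show x ∈ L.piece p from hx) (show y ∈ L.piece q from hy)
      simp only [symMul_apply, one_mul] at h
      refine Eq.trans ?_ (map_zero _).symm
      simp [Polynomial.monomial_mul_monomial, h]

theorem symGrading_symMul (s : L.Sym) (x : 𝔤) :
    L.symGrading (L.symMul s x) = L.symGrading s * Polynomial.monomial 1 (L.symι x) :=
  (map_mul _ _ _).trans (congrArg _ (L.abelian.envLift_envι _ _ x))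

/-- The projection of `S(𝔤)` onto its component of degree `k`. -/
def symProj (k : ℕ) : L.Sym →ₗ[ℝ] L.Sym :=
  (Polynomial.lcoeff L.Sym k).restrictScalars ℝ ∘ₗ L.symGrading.toLinearMap

theorem symProj_one (k : ℕ) : L.symProj k 1 = if k = 0 then 1 else 0 := by
  simp [symProj, Polynomial.coeff_one]

theorem symProj_zero_symMul (s : L.Sym) (x : 𝔤) : L.symProj 0 (L.symMul s x) = 0 := by
  simp [symProj, symGrading_symMul, Polynomial.mul_coeff_zero, Polynomial.coeff_monomial]

theorem symProj_succ_symMul (k : ℕ) (s : L.Sym) (x : 𝔤) :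
    L.symProj (k + 1) (L.symMul s x) = L.symMul (L.symProj k s) x := by
  simp only [symProj, LinearMap.comp_apply, AlgHom.toLinearMap_apply, symGrading_symMul,
    LinearMap.restrictScalars_apply, Polynomial.lcoeff_apply, Polynomial.coeff_mul_monomial]
  rfl

theorem symProj_symProj (j k : ℕ) (s : L.Sym) :
    L.symProj j (L.symProj k s) = if j = k then L.symProj k s else 0 := by
  induction s using L.sym_induction generalizing j k with
  | one =>
    rw [symProj_one]
    split_ifs <;> simp_all [symProj_one]
  | mul s p x hx hs =>
    cases k with
    | zero => simp [symProj_zero_symMul]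
    | succ k =>
      cases j with
      | zero => simp [symProj_succ_symMul, symProj_zero_symMul]
      | succ j =>
        rw [symProj_succ_symMul, symProj_succ_symMul, hs j k]
        by_cases h : j = k <;> simp [h]
  | add s t hs ht =>
    rw [map_add, map_add, hs, ht]
    split_ifs <;> simp
  | smul r s hs =>
    rw [map_smul, map_smul, hs]
    split_ifs <;> simp

theorem exists_sum_symProj (s : L.Sym) :
    ∃ K, ∀ n, K ≤ n → ∑ j ∈ Finset.range n, L.symProj j s = s := by
  induction s using L.sym_induction with
  | one =>
    refine ⟨1, fun n hn => ?_⟩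
    obtain ⟨n, rfl⟩ := Nat.exists_eq_add_of_le' hn
    simp [symProj_one]
  | mul s p x hx hs =>
    obtain ⟨K, hK⟩ := hs
    refine ⟨K + 1, fun n hn => ?_⟩
    obtain ⟨n, rfl⟩ := Nat.exists_eq_add_of_le' (le_trans (Nat.le_add_left 1 K) hn)
    rw [Finset.sum_range_succ', symProj_zero_symMul, add_zero]
    simp only [symProj_succ_symMul]
    conv_rhs => rw [← hK n (by omega), map_sum, LinearMap.sum_apply]
  | add s t hs ht =>
    obtain ⟨K, hK⟩ := hs
    obtain ⟨K', hK'⟩ := ht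
    refine ⟨max K K', fun n hn => ?_⟩
    simp only [map_add, Finset.sum_add_distrib]
    rw [hK n (le_trans (le_max_left _ _) hn), hK' n (le_trans (le_max_right _ _) hn)]
  | smul r s hs =>
    obtain ⟨K, hK⟩ := hs
    refine ⟨K, fun n hn => ?_⟩
    simp only [map_smul, ← Finset.smul_sum]
    rw [hK n hn]

/-- The linear map that is given by `f k` on the component of degree `k` of `S(𝔤)`. -/
def symPiecewise (f : ℕ → L.Sym →ₗ[ℝ] X) : L.Sym →ₗ[ℝ] X :=
  Polynomial.lsum f ∘ₗ L.symGrading.toLinearMap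

theorem symPiecewise_symProj (f : ℕ → L.Sym →ₗ[ℝ] X) (k : ℕ) (s : L.Sym) :
    L.symPiecewise f (L.symProj k s) = f k (L.symProj k s) := by
  have : L.symGrading (L.symProj k s) = Polynomial.monomial k (L.symProj k s) := by
    ext j
    rw [Polynomial.coeff_monomial]
    exact (L.symProj_symProj j k s).trans (by simp [eq_comm])
  simp [symPiecewise, this, Polynomial.lsum_apply, Polynomial.sum_monomial_index]

/-- Euler's identity for S(𝔤), the counterpart of `wedgeT_extract_extOf`. -/
theorem symMulT_symExtract_symProj (k : ℕ) (s : L.Sym) :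
    L.symMulT (L.symExtract (L.symProj k s)) = (k : ℝ) • L.symProj k s := by
  induction s using L.sym_induction generalizing k with
  | one =>
    rw [symProj_one]
    split_ifs <;> simp_all [symExtract_one]
  | mul s p x hx hs =>
    cases k with
    | zero => simp [symProj_zero_symMul]
    | succ k =>
      rw [symProj_succ_symMul, L.symMulT_symExtract_symMul _ hx, hs k, map_smul,
        LinearMap.smul_apply]
      push_cast
      module
  | add s t hs ht => simp only [map_add, hs, ht, smul_add]
  | smul r s hs => simp only [map_smul, hs, smul_comm r]

/-- The augmentation `S(𝔤) → ℝ`. -/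
def symAug : L.Sym →ₗ[ℝ] ℝ := L.abelian.augmentation.toLinearMap

theorem symAug_one : L.symAug 1 = 1 := map_one L.abelian.augmentation

theorem augmentation_mul_envι (u : L.Env) (x : 𝔤) : L.augmentation (u * L.envι x) = 0 := by
  simp [augmentation, envι]

theorem symProj_zero_apply (s : L.Sym) : L.symProj 0 s = L.symAug s • 1 := by
  refine LinearMap.congr_fun (g := LinearMap.toSpanSingleton ℝ L.Sym 1 ∘ₗ L.symAug)
    (L.sym_hom_ext ?_ fun p x s _ _ => ?_) s
  · simp [symProj_one, symAug_one]
  · have : L.symAug (L.symMul s x) = 0 := L.abelian.augmentation_mul_envι s x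
    simp [symProj_zero_symMul, this]

theorem symExtract_symProj_zero (s : L.Sym) : L.symExtract (L.symProj 0 s) = 0 := by
  rw [symProj_zero_apply, map_smul, symExtract_one, smul_zero]

theorem symExtract_symProj_succ (k : ℕ) (s : L.Sym) :
    L.symExtract (L.symProj (k + 1) s) = (L.symProj k).rTensor 𝔤 (L.symExtract s) := by
  induction s using L.sym_induction generalizing k with
  | one => simp [symProj_one, symExtract_one]
  | mul s p x hx hs =>
    rw [symProj_succ_symMul, symExtract_symMul, symExtract_symMul, map_add,
      LinearMap.rTensor_tmul]
    congr 1
    rw [L.symTwist_apply hx, L.symTwist_apply hx]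
    cases k with
    | zero =>
      rw [symExtract_symProj_zero, map_zero]
      induction L.symExtract s using TensorProduct.induction_on with
      | zero => simp
      | add z z' hz hz' => rw [map_add, map_add, ← hz, ← hz', add_zero]
      | tmul t y => simp [symProj_zero_symMul]
    | succ k =>
      rw [hs k]
      induction L.symExtract s using TensorProduct.induction_on with
      | zero => simp
      | add z z' hz hz' => simp only [map_add, hz, hz']
      | tmul t y => simp [symProj_succ_symMul]
  | add s t hs ht => simp only [map_add, hs, ht]
  | smul r s hs => simp only [map_smul, hs]

end

end RealGradedLieAlgebra

namespace RealGradedLieAlgebra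

noncomputable section

variable {𝔤 : Type*} [AddCommGroup 𝔤] [Module ℝ 𝔤] (L : RealGradedLieAlgebra 𝔤)

/-! ### Filtrations -/

/-- The elements of `S(𝔤)` whose components of degree at least `k` vanish. -/
def symFil (k : ℕ) : Submodule ℝ L.Sym where
  carrier := {s | ∀ j, k ≤ j → L.symProj j s = 0}
  zero_mem' := by simp
  add_mem' := fun hs ht j hj => by rw [map_add, hs j hj, ht j hj, add_zero]
  smul_mem' := fun r s hs j hj => by rw [map_smul, hs j hj, smul_zero]

theorem symFil_mono {k l : ℕ} (h : k ≤ l) : L.symFil k ≤ L.symFil l :=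
  fun _ hs j hj => hs j (h.trans hj)

theorem symProj_mem {j k : ℕ} (h : j < k) (s : L.Sym) : L.symProj j s ∈ L.symFil k := by
  intro i hi
  rw [symProj_symProj, if_neg (by omega)]

theorem symMul_mem {k : ℕ} {s : L.Sym} (hs : s ∈ L.symFil k) (x : 𝔤) :
    L.symMul s x ∈ L.symFil (k + 1) := by
  intro j hj
  obtain ⟨j, rfl⟩ := Nat.exists_eq_add_of_le' (le_trans (Nat.le_add_left 1 k) hj)
  rw [symProj_succ_symMul, hs j (by omega), map_zero, LinearMap.zero_apply]

theorem one_mem_symFil : (1 : L.Sym) ∈ L.symFil 1 := by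
  intro j hj
  rw [symProj_one, if_neg (by omega)]

theorem eq_sum_symProj {k : ℕ} {s : L.Sym} (hs : s ∈ L.symFil k) :
    s = ∑ j ∈ Finset.range k, L.symProj j s := by
  obtain ⟨K, hK⟩ := L.exists_sum_symProj s
  conv_lhs => rw [← hK (k + K) (by omega)]
  rw [Finset.sum_range_add]
  conv_rhs => rw [← add_zero (∑ j ∈ Finset.range k, L.symProj j s)]
  congr 1
  exact Finset.sum_eq_zero fun j _ => hs _ (by omega)

/-- The strict bound on the degree makes the first step of the filtration trivial, and so gives the
inductions on k a vacuous start. -/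
theorem symFil_zero : L.symFil 0 = ⊥ := by
  rw [eq_bot_iff]
  intro s hs
  rw [L.eq_sum_symProj hs]
  simp

theorem exists_mem_symFil (s : L.Sym) : ∃ k, s ∈ L.symFil k := by
  obtain ⟨K, hK⟩ := L.exists_sum_symProj s
  refine ⟨K, fun j hj => ?_⟩
  have h := hK (j + 1) (by omega)
  rw [Finset.sum_range_succ, hK j hj] at h
  exact add_eq_left.1 h

theorem sub_symProj_mem {k : ℕ} {s : L.Sym} (hs : s ∈ L.symFil (k + 1)) :
    s - L.symProj k s ∈ L.symFil k := by
  intro j hj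
  rw [map_sub, symProj_symProj]
  split_ifs with h
  · rw [h, sub_self]
  · rw [hs j (by omega), sub_zero]

theorem symExtract_mem {k : ℕ} {s : L.Sym} (hs : s ∈ L.symFil (k + 1)) :
    ∃ z, L.symExtract s = (L.symFil k).subtype.rTensor 𝔤 z := by
  suffices h : L.symExtract s ∈ LinearMap.range ((L.symFil k).subtype.rTensor 𝔤) by
    obtain ⟨z, hz⟩ := h
    exact ⟨z, hz.symm⟩
  rw [L.eq_sum_symProj hs, map_sum]
  refine sum_mem fun j hj => ?_
  cases j with
  | zero => rw [symExtract_symProj_zero]; exact zero_mem _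
  | succ j =>
    let f : L.Sym →ₗ[ℝ] L.symFil k := (L.symProj j).codRestrict _ fun t =>
      L.symProj_mem (by simpa using hj) t
    refine ⟨f.rTensor 𝔤 (L.symExtract s), ?_⟩
    rw [symExtract_symProj_succ, ← LinearMap.comp_apply, ← LinearMap.rTensor_comp]
    rfl

/-- The tensors of degree less than `k` in `S(𝔤)` and of degree `n` in `⋀ 𝔤`. -/
def filT (k n : ℕ) : Submodule ℝ (L.Sym ⊗[ℝ] L.Ext) :=
  Submodule.map₂ (TensorProduct.mk ℝ L.Sym L.Ext) (L.symFil k) (L.extDeg n)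

theorem tmul_mem_filT {k n : ℕ} {s : L.Sym} {w : L.Ext} (hs : s ∈ L.symFil k)
    (hw : w ∈ L.extDeg n) : s ⊗ₜ w ∈ L.filT k n :=
  Submodule.apply_mem_map₂ _ hs hw

variable {X : Type*} [AddCommGroup X] [Module ℝ X]

theorem map_filT_mem {k n : ℕ} {f : L.Sym ⊗[ℝ] L.Ext →ₗ[ℝ] X} {Q : Submodule ℝ X}
    (h : ∀ s ∈ L.symFil k, ∀ w ∈ L.extDeg n, f (s ⊗ₜ w) ∈ Q) {z : L.Sym ⊗[ℝ] L.Ext}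
    (hz : z ∈ L.filT k n) : f z ∈ Q :=
  (Submodule.map₂_le.2 h : L.filT k n ≤ Q.comap f) hz

theorem map_filT_eq {k n : ℕ} {f g : L.Sym ⊗[ℝ] L.Ext →ₗ[ℝ] X}
    (h : ∀ s ∈ L.symFil k, ∀ w ∈ L.extDeg n, f (s ⊗ₜ w) = g (s ⊗ₜ w)) {z : L.Sym ⊗[ℝ] L.Ext}
    (hz : z ∈ L.filT k n) : f z = g z :=
  (Submodule.map₂_le.2 h : L.filT k n ≤ LinearMap.eqLocus f g) hz

theorem filT_zero (n : ℕ) : L.filT 0 n = ⊥ := by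
  rw [filT, symFil_zero, Submodule.map₂_bot_left]

theorem filT_mono {k l : ℕ} (h : k ≤ l) (n : ℕ) : L.filT k n ≤ L.filT l n :=
  Submodule.map₂_le_map₂_left (L.symFil_mono h)

theorem hat_mem {k l n : ℕ} {μ : L.Sym →ₗ[ℝ] 𝔤 →ₗ[ℝ] L.Sym}
    (hμ : ∀ s ∈ L.symFil k, ∀ x, μ s x ∈ L.symFil l) {z : L.Sym ⊗[ℝ] L.Ext}
    (hz : z ∈ L.filT k (n + 1)) : L.hat μ z ∈ L.filT l n := by
  refine L.map_filT_mem (fun s hs w hw => ?_) hz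
  obtain ⟨y, hy⟩ := L.extract_mem hw
  rw [hat_tmul, hy]
  clear hy
  induction y using TensorProduct.induction_on with
  | zero => simp
  | add y y' h h' => rw [map_add, map_add]; exact add_mem h h'
  | tmul x v => simpa using L.tmul_mem_filT (hμ s hs x) v.2

theorem hat_eq {k n : ℕ} {μ ν : L.Sym →ₗ[ℝ] 𝔤 →ₗ[ℝ] L.Sym}
    (h : ∀ s ∈ L.symFil k, ∀ x, μ s x = ν s x) {z : L.Sym ⊗[ℝ] L.Ext} (hz : z ∈ L.filT k n) :
    L.hat μ z = L.hat ν z := by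
  refine L.map_filT_eq (fun s hs w _ => ?_) hz
  rw [hat_tmul, hat_tmul, LinearMap.ext (h s hs)]

theorem hat_eq_zero {k : ℕ} (μ : L.Sym →ₗ[ℝ] 𝔤 →ₗ[ℝ] L.Sym) {z : L.Sym ⊗[ℝ] L.Ext}
    (hz : z ∈ L.filT k 0) : L.hat μ z = 0 := by
  refine L.map_filT_eq (g := 0) (fun s hs w hw => ?_) hz
  simp [L.extract_eq_zero hw]

theorem lTensor_extBr_mem {k n : ℕ} {z : L.Sym ⊗[ℝ] L.Ext} (hz : z ∈ L.filT k (n + 1)) :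
    L.extBr.lTensor L.Sym z ∈ L.filT k n :=
  L.map_filT_mem (fun s hs w hw => by simpa using L.tmul_mem_filT hs (L.extBr_mem hw)) hz

theorem lTensor_extBr_eq_zero {k : ℕ} {z : L.Sym ⊗[ℝ] L.Ext} (hz : z ∈ L.filT k 0) :
    L.extBr.lTensor L.Sym z = 0 :=
  L.map_filT_eq (g := 0) (fun s _ w hw => by simp [L.extBr_eq_zero_of_mem_zero hw]) hz

theorem lTensor_extBr_eq_zero_of_mem_one {k : ℕ} {z : L.Sym ⊗[ℝ] L.Ext} (hz : z ∈ L.filT k 1) :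
    L.extBr.lTensor L.Sym z = 0 :=
  L.map_filT_eq (g := 0) (fun s _ w hw => by simp [L.extBr_eq_zero hw]) hz

/-! ### The homotopy -/

/-- The homotopy `S(𝔤) ⊗ ⋀ⁿ 𝔤 → S(𝔤) ⊗ ⋀ⁿ⁺¹ 𝔤`, which moves one factor. -/
def symH : L.Sym ⊗[ℝ] L.Ext →ₗ[ℝ] L.Sym ⊗[ℝ] L.Ext :=
  TensorProduct.lift ((LinearMap.lTensorHom L.Sym ∘ₗ L.extWedge.flip).flip ∘ₗ L.symExtract)

@[simp] theorem symH_tmul (s : L.Sym) (w : L.Ext) :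
    L.symH (s ⊗ₜ w) = (L.extWedge.flip w).lTensor L.Sym (L.symExtract s) := by
  simp [symH]

theorem symH_mem {k n : ℕ} {z : L.Sym ⊗[ℝ] L.Ext} (hz : z ∈ L.filT (k + 1) n) :
    L.symH z ∈ L.filT k (n + 1) := by
  refine L.map_filT_mem (fun s hs w hw => ?_) hz
  obtain ⟨y, hy⟩ := L.symExtract_mem hs
  rw [symH_tmul, hy]
  clear hy
  induction y using TensorProduct.induction_on with
  | zero => simp
  | add y y' h h' => rw [map_add, map_add]; exact add_mem h h'
  | tmul t x => simpa using L.tmul_mem_filT t.2 (L.extWedge_mem x hw)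

/-- The map `(s ⊗ x, y ⊗ w) ↦ (-1)^{|x||y|} s y ⊗ x ∧ w`. -/
def exchange : L.Sym ⊗[ℝ] 𝔤 →ₗ[ℝ] 𝔤 ⊗[ℝ] L.Ext →ₗ[ℝ] L.Sym ⊗[ℝ] L.Ext :=
  TensorProduct.lift <| LinearMap.flip <|
    L.piecewise (X := L.Sym →ₗ[ℝ] 𝔤 ⊗[ℝ] L.Ext →ₗ[ℝ] L.Sym ⊗[ℝ] L.Ext) fun p =>
    LinearMap.mk₂ ℝ (fun x s => TensorProduct.map (L.symMul s ∘ₗ L.sgn p) (L.extWedge x))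
      (fun x y s => by rw [map_add, TensorProduct.map_add_right])
      (fun r x s => by rw [map_smul, TensorProduct.map_smul_right])
      (fun x s t => by rw [map_add, LinearMap.add_comp, TensorProduct.map_add_left])
      (fun r x s => by rw [map_smul, LinearMap.smul_comp, TensorProduct.map_smul_left])

theorem exchange_tmul {p : ℤ} {x : 𝔤} (hx : x ∈ L.piece p) (s : L.Sym) (z : 𝔤 ⊗[ℝ] L.Ext) :
    L.exchange (s ⊗ₜ x) z = TensorProduct.map (L.symMul s ∘ₗ L.sgn p) (L.extWedge x) z := by
  simp [exchange, L.piecewise_apply _ hx]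

theorem exchange_apply_tmul {q : ℤ} {y : 𝔤} (hy : y ∈ L.piece q) (w : L.Ext)
    (z : L.Sym ⊗[ℝ] 𝔤) :
    L.exchange z (y ⊗ₜ w) = (L.extWedge.flip w).lTensor L.Sym (L.symTwist y z) := by
  refine LinearMap.congr_fun (f := L.exchange.flip (y ⊗ₜ w))
    (g := (L.extWedge.flip w).lTensor L.Sym ∘ₗ L.symTwist y)
    (L.sym_tensor_hom_ext fun p x s hx => ?_) z
  simp [L.exchange_tmul hx, L.symTwist_tmul hx hy, L.sgn_apply p hy, TensorProduct.smul_tmul']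

theorem hat_symH_tmul (z : L.Sym ⊗[ℝ] 𝔤) (w : L.Ext) :
    L.hat L.symMul ((L.extWedge.flip w).lTensor L.Sym z)
      = L.symMulT z ⊗ₜ w - L.exchange z (L.extract w) := by
  refine LinearMap.congr_fun (f := L.hat L.symMul ∘ₗ (L.extWedge.flip w).lTensor L.Sym)
    (g := (TensorProduct.mk ℝ L.Sym L.Ext).flip w ∘ₗ L.symMulT - L.exchange.flip (L.extract w))
    (L.sym_tensor_hom_ext fun p x s hx => ?_) z
  simp only [LinearMap.comp_apply, LinearMap.lTensor_tmul, LinearMap.flip_apply, hat_tmul,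
    L.extract_extWedge hx, LinearMap.sub_apply, TensorProduct.mk_apply, symMulT_tmul,
    L.exchange_tmul hx, map_sub, LinearMap.rTensor_tmul]
  congr 1
  induction L.extract w using TensorProduct.induction_on with
  | zero => simp
  | add y y' h h' => simp only [map_add, h, h']
  | tmul y v => simp

theorem symH_hat_tmul (s : L.Sym) (z : 𝔤 ⊗[ℝ] L.Ext) :
    L.symH ((L.symMul s).rTensor L.Ext z)
      = s ⊗ₜ L.wedgeT z + L.exchange (L.symExtract s) z := by
  refine LinearMap.congr_fun (f := L.symH ∘ₗ (L.symMul s).rTensor L.Ext)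
    (g := TensorProduct.mk ℝ L.Sym L.Ext s ∘ₗ L.wedgeT + L.exchange (L.symExtract s))
    (L.tensor_hom_ext fun q y w hy => ?_) z
  simp [symExtract_symMul, L.exchange_apply_tmul hy]

/-- In each composite either the factor just moved is moved back, giving the Euler operator of one
side, or two different factors are exchanged. The exchange terms occur with opposite signs, because
in one of the composites the extracted factor has to cross the new one. -/
theorem hat_symH_add_symH_hat (s : L.Sym) (w : L.Ext) :
    L.hat L.symMul (L.symH (s ⊗ₜ w)) + L.symH (L.hat L.symMul (s ⊗ₜ w))
      = L.symMulT (L.symExtract s) ⊗ₜ w + s ⊗ₜ L.wedgeT (L.extract w) := by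
  rw [symH_tmul, hat_symH_tmul, hat_tmul, symH_hat_tmul]
  abel

theorem hat_symMul_hat_symMul (z : L.Sym ⊗[ℝ] L.Ext) :
    L.hat L.symMul (L.hat L.symMul z) = 0 :=
  LinearMap.congr_fun (f := L.hat L.symMul ∘ₗ L.hat L.symMul) (g := 0)
    (TensorProduct.ext' fun s w =>
      L.hat_hat_tmul (fun _ _ _ _ hx hy => L.symMul_symMul s hx hy) w) z

/-- The tensors of degree `k` in `S(𝔤)` and of degree `n` in `⋀ 𝔤`. -/
def degT (k n : ℕ) : Submodule ℝ (L.Sym ⊗[ℝ] L.Ext) :=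
  Submodule.map₂ (TensorProduct.mk ℝ L.Sym L.Ext) (LinearMap.range (L.symProj k)) (L.extDeg n)

theorem degT_le {k n : ℕ} {Q : Submodule ℝ (L.Sym ⊗[ℝ] L.Ext)}
    (h : ∀ s, ∀ w ∈ L.extDeg n, L.symProj k s ⊗ₜ w ∈ Q) : L.degT k n ≤ Q :=
  Submodule.map₂_le.2 (by rintro _ ⟨s, rfl⟩ w hw; exact h s w hw)

theorem symProj_tmul_mem (k : ℕ) {n : ℕ} (s : L.Sym) {w : L.Ext} (hw : w ∈ L.extDeg n) :
    L.symProj k s ⊗ₜ w ∈ L.degT k n :=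
  Submodule.apply_mem_map₂ _ ⟨s, rfl⟩ hw

theorem degT_le_filT (k n : ℕ) : L.degT k n ≤ L.filT (k + 1) n :=
  L.degT_le fun s _ hw => L.tmul_mem_filT (L.symProj_mem (Nat.lt_succ_self k) s) hw

theorem exists_degT_add {k n : ℕ} {z : L.Sym ⊗[ℝ] L.Ext} (hz : z ∈ L.filT (k + 1) n) :
    ∃ a ∈ L.degT k n, ∃ b ∈ L.filT k n, z = a + b := by
  have : L.filT (k + 1) n ≤ L.degT k n ⊔ L.filT k n := by
    refine Submodule.map₂_le.2 fun s hs w hw => ?_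
    rw [TensorProduct.mk_apply, ← add_sub_cancel (L.symProj k s) s, TensorProduct.add_tmul]
    exact Submodule.add_mem_sup (L.symProj_tmul_mem k s hw)
      (L.tmul_mem_filT (L.sub_symProj_mem hs) hw)
  obtain ⟨a, ha, b, hb, h⟩ := Submodule.mem_sup.1 (this hz)
  exact ⟨a, ha, b, hb, h.symm⟩

theorem homotopy {k n : ℕ} {z : L.Sym ⊗[ℝ] L.Ext} (hz : z ∈ L.degT k n) :
    L.hat L.symMul (L.symH z) + L.symH (L.hat L.symMul z) = ((k : ℝ) + n) • z := by
  refine L.degT_le (Q := LinearMap.eqLocus (L.hat L.symMul ∘ₗ L.symH + L.symH ∘ₗ L.hat L.symMul)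
    (((k : ℝ) + n) • LinearMap.id)) (fun s w hw => ?_) hz
  simp only [LinearMap.mem_eqLocus, LinearMap.add_apply, LinearMap.comp_apply,
    LinearMap.smul_apply, LinearMap.id_apply, hat_symH_add_symH_hat, symMulT_symExtract_symProj,
    L.wedgeT_extract_of_mem hw, TensorProduct.tmul_smul, ← TensorProduct.smul_tmul', add_smul]

theorem hat_symMul_mem_degT {k n : ℕ} {z : L.Sym ⊗[ℝ] L.Ext} (hz : z ∈ L.degT k (n + 1)) :
    L.hat L.symMul z ∈ L.degT (k + 1) n := by
  refine L.degT_le (Q := (L.degT (k + 1) n).comap (L.hat L.symMul)) (fun s w hw => ?_) hz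
  obtain ⟨y, hy⟩ := L.extract_mem hw
  rw [Submodule.mem_comap, hat_tmul, hy]
  clear hy
  induction y using TensorProduct.induction_on with
  | zero => simp
  | add y y' h h' => rw [map_add, map_add]; exact add_mem h h'
  | tmul x v =>
    simpa [symProj_succ_symMul] using L.symProj_tmul_mem (k + 1) (L.symMul s x) v.2

end

end RealGradedLieAlgebra

namespace RealGradedLieAlgebra

noncomputable section

variable {𝔤 : Type*} [AddCommGroup 𝔤] [Module ℝ 𝔤] (L : RealGradedLieAlgebra 𝔤)

/-! ### The component of degree zero -/

/-- The coefficient of the unit in an element of `⋀ 𝔤`. -/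
def vacCoeff : L.Ext →ₗ[ℝ] ℝ :=
  L.extLift fun
    | 0 => (L.wedgeRel 0).liftQ
        (PiTensorProduct.isEmptyEquiv (R := ℝ) (s := fun _ : Fin 0 => 𝔤) (Fin 0)).toLinearMap (by
          rw [wedgeRel, Submodule.span_le]
          rintro _ ⟨_, _, i, _⟩
          exact i.elim0)
    | _ + 1 => 0

theorem vacCoeff_vac : L.vacCoeff L.vac = 1 := by
  simp [vacCoeff, vac, wedge]

theorem eq_vacCoeff_smul_vac {w : L.Ext} (hw : w ∈ L.extDeg 0) : w = L.vacCoeff w • L.vac := by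
  obtain ⟨w, rfl⟩ := hw
  refine L.extPow_le_of_wedge_mem (P := LinearMap.eqLocus (L.extOf 0)
    (LinearMap.toSpanSingleton ℝ L.Ext L.vac ∘ₗ L.vacCoeff ∘ₗ L.extOf 0)) (fun a => ?_) w
  have : L.extOf 0 (L.wedge 0 a) = L.vac := by rw [vac, Subsingleton.elim a Fin.elim0]
  simp [this, vacCoeff_vac]

theorem extDeg_succ_le {n : ℕ} {P : Submodule ℝ L.Ext}
    (h : ∀ x, ∀ w ∈ L.extDeg n, L.extWedge x w ∈ P) : L.extDeg (n + 1) ≤ P := by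
  rintro _ ⟨w, rfl⟩
  refine L.extPow_le_of_wedge_mem (P := P.comap (L.extOf (n + 1))) (fun a => ?_) w
  rw [Submodule.mem_comap, ← Fin.cons_self_tail a, ← L.powWedge_wedge, ← L.extWedge_extOf]
  exact h _ _ ⟨_, rfl⟩

theorem extDeg_one_le {P : Submodule ℝ L.Ext} (h : ∀ x, L.extWedge x L.vac ∈ P) :
    L.extDeg 1 ≤ P :=
  L.extDeg_succ_le fun x w hw => by
    rw [L.eq_vacCoeff_smul_vac hw, map_smul]
    exact P.smul_mem _ (h x)

/-- The map `s ⊗ w ↦ c s`, where `c` is the coefficient of the unit in `w`. -/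
def symCoeff : L.Sym ⊗[ℝ] L.Ext →ₗ[ℝ] L.Sym :=
  (TensorProduct.rid ℝ L.Sym).toLinearMap ∘ₗ L.vacCoeff.lTensor L.Sym

@[simp] theorem symCoeff_tmul (s : L.Sym) (w : L.Ext) :
    L.symCoeff (s ⊗ₜ w) = L.vacCoeff w • s := by
  simp [symCoeff]

theorem symCoeff_mem {k n : ℕ} {z : L.Sym ⊗[ℝ] L.Ext} (hz : z ∈ L.filT k n) :
    L.symCoeff z ∈ L.symFil k :=
  L.map_filT_mem (fun s hs w _ => by
    rw [symCoeff_tmul]; exact Submodule.smul_mem _ _ hs) hz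

theorem symCoeff_tmul_vac {k : ℕ} {z : L.Sym ⊗[ℝ] L.Ext} (hz : z ∈ L.filT k 0) :
    L.symCoeff z ⊗ₜ L.vac = z := by
  refine L.map_filT_eq (f := (TensorProduct.mk ℝ L.Sym L.Ext).flip L.vac ∘ₗ L.symCoeff)
    (g := LinearMap.id) (fun s _ w hw => ?_) hz
  conv_rhs => rw [L.eq_vacCoeff_smul_vac hw]
  simp [TensorProduct.smul_tmul']

theorem extract_extWedge_vac (x : 𝔤) : L.extract (L.extWedge x L.vac) = x ⊗ₜ L.vac := by
  rw [← wedgeT_tmul, extract_wedgeT]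
  simp [extract_vac]

theorem extract_extWedge_extWedge_vac {p q : ℤ} {x y : 𝔤} (hx : x ∈ L.piece p)
    (hy : y ∈ L.piece q) : L.extract (L.extWedge x (L.extWedge y L.vac))
      = x ⊗ₜ L.extWedge y L.vac - chi p q • (y ⊗ₜ L.extWedge x L.vac) := by
  rw [L.extract_extWedge hx, extract_extWedge_vac, TensorProduct.map_tmul, L.sgn_apply p hy,
    TensorProduct.smul_tmul']

theorem extBr_extWedge_extWedge_vac {p q : ℤ} {x y : 𝔤} (hx : x ∈ L.piece p)
    (hy : y ∈ L.piece q) : L.extBr (L.extWedge x (L.extWedge y L.vac))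
      = -L.extWedge (L.bracket x y) L.vac := by
  rw [extBr_apply, extract₂, LinearMap.comp_apply, L.extract_extWedge_extWedge_vac hx hy]
  simp only [map_sub, map_smul, LinearMap.lTensor_tmul, extract_extWedge_vac, br_tmul,
    wedgeT_tmul]
  -- Antisymmetry makes the two orders contribute equally, which absorbs the factor 1/2 in `extBr`.
  have h : chi p q • L.extWedge (L.bracket y x) L.vac = -L.extWedge (L.bracket x y) L.vac := by
    rw [L.bracket_swap hx hy]
    simp
  rw [h]
  module

/-! ### The right action of the Lie algebra on the symmetric algebra -/

/-- The operator `1 / (k + 1)` on the component of degree `k` of `S(𝔤)`. -/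
def symInv : L.Sym →ₗ[ℝ] L.Sym := L.symPiecewise fun k => ((k : ℝ) + 1)⁻¹ • LinearMap.id

theorem symInv_symProj (k : ℕ) (s : L.Sym) :
    L.symInv (L.symProj k s) = ((k : ℝ) + 1)⁻¹ • L.symProj k s := by
  simp [symInv, symPiecewise_symProj]

theorem symInv_mem {k : ℕ} {s : L.Sym} (hs : s ∈ L.symFil k) : L.symInv s ∈ L.symFil k := by
  rw [L.eq_sum_symProj hs, map_sum]
  refine sum_mem fun j hj => ?_
  rw [symInv_symProj]
  exact Submodule.smul_mem _ _ (L.symProj_mem (Finset.mem_range.1 hj) s)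

/-- The part of the differential for the action `symMul + μ` that does not raise the degree. -/
def lowerD (μ : L.Sym →ₗ[ℝ] 𝔤 →ₗ[ℝ] L.Sym) : L.Sym ⊗[ℝ] L.Ext →ₗ[ℝ] L.Sym ⊗[ℝ] L.Ext :=
  L.hat μ + L.extBr.lTensor L.Sym

theorem kD_add (μ : L.Sym →ₗ[ℝ] 𝔤 →ₗ[ℝ] L.Sym) :
    L.kD (L.symMul + μ) = L.hat L.symMul + L.lowerD μ := by
  rw [kD, lowerD, hat_add, add_assoc]

/-- The map whose fixed points correct right multiplication to an action of `𝔤`. -/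
def correct (μ : L.Sym →ₗ[ℝ] 𝔤 →ₗ[ℝ] L.Sym) : L.Sym →ₗ[ℝ] 𝔤 →ₗ[ℝ] L.Sym :=
  ((TensorProduct.mk ℝ L.Sym L.Ext).compr₂
    (-(L.symCoeff ∘ₗ L.hat (L.symMul + μ) ∘ₗ L.lowerD μ ∘ₗ L.symH))).compl₁₂ L.symInv
      (L.extWedge.flip L.vac)

theorem correct_apply (μ : L.Sym →ₗ[ℝ] 𝔤 →ₗ[ℝ] L.Sym) (s : L.Sym) (x : 𝔤) :
    L.correct μ s x = -L.symCoeff (L.hat (L.symMul + μ)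
      (L.lowerD μ (L.symH (L.symInv s ⊗ₜ L.extWedge x L.vac)))) := rfl

/-- A bilinear map that does not raise the degree in `S(𝔤)`. -/
def IsLower (μ : L.Sym →ₗ[ℝ] 𝔤 →ₗ[ℝ] L.Sym) : Prop :=
  ∀ ⦃k : ℕ⦄, ∀ s ∈ L.symFil k, ∀ x, μ s x ∈ L.symFil k

variable {L}

theorem IsLower.lowerD_mem {μ : L.Sym →ₗ[ℝ] 𝔤 →ₗ[ℝ] L.Sym} (hμ : L.IsLower μ) {k n : ℕ}
    {z : L.Sym ⊗[ℝ] L.Ext} (hz : z ∈ L.filT k (n + 1)) : L.lowerD μ z ∈ L.filT k n :=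
  add_mem (L.hat_mem (hμ (k := k)) hz) (L.lTensor_extBr_mem hz)

theorem IsLower.symMul_add_mem {μ : L.Sym →ₗ[ℝ] 𝔤 →ₗ[ℝ] L.Sym} (hμ : L.IsLower μ) {k : ℕ} :
    ∀ s ∈ L.symFil k, ∀ x, (L.symMul + μ) s x ∈ L.symFil (k + 1) :=
  fun s hs x => add_mem (L.symMul_mem hs x) (L.symFil_mono (Nat.le_succ k) (hμ s hs x))

theorem IsLower.kD_mem {μ : L.Sym →ₗ[ℝ] 𝔤 →ₗ[ℝ] L.Sym} (hμ : L.IsLower μ) {k n : ℕ}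
    {z : L.Sym ⊗[ℝ] L.Ext} (hz : z ∈ L.filT k (n + 1)) :
    L.kD (L.symMul + μ) z ∈ L.filT (k + 1) n :=
  add_mem (L.hat_mem hμ.symMul_add_mem hz) (L.filT_mono (Nat.le_succ k) n (L.lTensor_extBr_mem hz))

theorem symH_symInv_mem {k : ℕ} {s : L.Sym} (hs : s ∈ L.symFil (k + 1)) (x : 𝔤) :
    L.symH (L.symInv s ⊗ₜ L.extWedge x L.vac) ∈ L.filT k 2 :=
  L.symH_mem (L.tmul_mem_filT (L.symInv_mem hs) (L.extWedge_mem x L.vac_mem))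

theorem IsLower.correct {μ : L.Sym →ₗ[ℝ] 𝔤 →ₗ[ℝ] L.Sym} (hμ : L.IsLower μ) :
    L.IsLower (L.correct μ) := by
  intro k s hs x
  cases k with
  | zero =>
    rw [symFil_zero, Submodule.mem_bot] at hs
    simp [hs]
  | succ k =>
    rw [correct_apply]
    exact neg_mem (L.symCoeff_mem (L.hat_mem hμ.symMul_add_mem
      (hμ.lowerD_mem (symH_symInv_mem hs x))))

/-- The homotopy lowers the degree in S(𝔤) by one before μ is used, and `lowerD μ` does not raise it
again. Hence the corrected map in degree k involves μ in degrees below k only, and iteration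
stabilises in each degree. -/
theorem correct_eq {μ ν : L.Sym →ₗ[ℝ] 𝔤 →ₗ[ℝ] L.Sym} (hμ : L.IsLower μ)
    {k : ℕ} (h : ∀ s ∈ L.symFil k, ∀ x, μ s x = ν s x) :
    ∀ s ∈ L.symFil (k + 1), ∀ x, L.correct μ s x = L.correct ν s x := by
  intro s hs x
  have hz := symH_symInv_mem hs x
  have h1 : L.lowerD ν (L.symH (L.symInv s ⊗ₜ L.extWedge x L.vac))
      = L.lowerD μ (L.symH (L.symInv s ⊗ₜ L.extWedge x L.vac)) := by
    rw [lowerD, lowerD, LinearMap.add_apply, LinearMap.add_apply, L.hat_eq h hz]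
  have h2 := L.hat_eq (μ := L.symMul + μ) (ν := L.symMul + ν)
    (fun s hs x => congrArg (L.symMul s x + ·) (h s hs x)) (hμ.lowerD_mem hz)
  rw [correct_apply, correct_apply, h1, h2]

variable (L)

/-- The successive approximations of the correction of right multiplication. -/
def lamSeq : ℕ → L.Sym →ₗ[ℝ] 𝔤 →ₗ[ℝ] L.Sym
  | 0 => 0
  | n + 1 => L.correct (lamSeq n)

theorem isLower_lamSeq (n : ℕ) : L.IsLower (L.lamSeq n) := by
  induction n with
  | zero => exact fun k s _ x => zero_mem _
  | succ n ih => exact ih.correct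

theorem lamSeq_eq {k j : ℕ} (h : k ≤ j) :
    ∀ s ∈ L.symFil k, ∀ x, L.lamSeq j s x = L.lamSeq k s x := by
  induction k generalizing j with
  | zero =>
    intro s hs x
    rw [symFil_zero, Submodule.mem_bot] at hs
    simp [hs]
  | succ k ih =>
    obtain ⟨j, rfl⟩ := Nat.exists_eq_add_of_le' (le_trans (Nat.le_add_left 1 k) h)
    exact correct_eq (L.isLower_lamSeq j) (ih (by omega))

/-- The correction of right multiplication. -/
def lam : L.Sym →ₗ[ℝ] 𝔤 →ₗ[ℝ] L.Sym := L.symPiecewise fun k => L.lamSeq (k + 1)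

theorem lam_eq {k : ℕ} : ∀ s ∈ L.symFil k, ∀ x, L.lam s x = L.lamSeq k s x := by
  intro s hs x
  rw [L.eq_sum_symProj hs, map_sum, map_sum, LinearMap.sum_apply, LinearMap.sum_apply]
  refine Finset.sum_congr rfl fun j hj => ?_
  rw [lam, symPiecewise_symProj]
  exact (L.lamSeq_eq (Finset.mem_range.1 hj) _ (L.symProj_mem (Nat.lt_succ_self j) s) x).symm

theorem isLower_lam : L.IsLower L.lam := by
  intro k s hs x
  rw [L.lam_eq s hs]
  exact L.isLower_lamSeq k s hs x

theorem correct_lam (s : L.Sym) (x : 𝔤) : L.correct L.lam s x = L.lam s x := by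
  obtain ⟨k, hk⟩ := L.exists_mem_symFil s
  have hs := L.symFil_mono (Nat.le_succ k) hk
  rw [correct_eq L.isLower_lam (L.lam_eq (k := k)) s hs, L.lam_eq s hs]
  rfl

/-- The right action of `𝔤` on `S(𝔤)` that corresponds to right multiplication in `U(𝔤)`. -/
def symAct : L.Sym →ₗ[ℝ] 𝔤 →ₗ[ℝ] L.Sym := L.symMul + L.lam

/-- The equation that dictates the form of `correct`. If D² = 0, then `hat symAct` kills D(hz) = dhz
+ `lowerD lam` (hz), where dhz = (k + 1)z - hdz. Under the normalization that `hat lam` vanishes on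
hdz, also `hat symAct` (hdz) = dhdz = (k + 1)dz, and this formula for `hat lam` z is what remains.
The operator `symInv` in `correct` divides by k + 1. -/
theorem smul_hat_lam {k : ℕ} {z : L.Sym ⊗[ℝ] L.Ext} (hz : z ∈ L.degT k 1) :
    ((k : ℝ) + 1) • L.hat L.lam z = -L.hat L.symAct (L.lowerD L.lam (L.symH z)) := by
  refine L.degT_le (Q := LinearMap.eqLocus (((k : ℝ) + 1) • L.hat L.lam)
    (-(L.hat L.symAct ∘ₗ L.lowerD L.lam ∘ₗ L.symH))) (fun s w hw => ?_) hz
  refine L.extDeg_one_le (P := (LinearMap.eqLocus (((k : ℝ) + 1) • L.hat L.lam)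
    (-(L.hat L.symAct ∘ₗ L.lowerD L.lam ∘ₗ L.symH))).comap
    (TensorProduct.mk ℝ L.Sym L.Ext (L.symProj k s))) (fun x => ?_) hw
  simp only [Submodule.mem_comap, LinearMap.mem_eqLocus, TensorProduct.mk_apply,
    LinearMap.smul_apply, LinearMap.neg_apply, LinearMap.comp_apply, hat_tmul,
    extract_extWedge_vac, LinearMap.rTensor_tmul]
  have hm : L.hat L.symAct (L.lowerD L.lam (L.symH (L.symProj k s ⊗ₜ L.extWedge x L.vac)))
      ∈ L.filT (k + 1) 0 :=
    L.hat_mem L.isLower_lam.symMul_add_mem (L.isLower_lam.lowerD_mem (L.symH_mem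
      (L.tmul_mem_filT (L.symProj_mem (Nat.lt_succ_self k) s) (L.extWedge_mem x L.vac_mem))))
  rw [← correct_lam, correct_apply, symInv_symProj, ← TensorProduct.smul_tmul', map_smul, map_smul,
    map_smul, map_smul, ← smul_neg, TensorProduct.smul_tmul', smul_smul,
    mul_inv_cancel₀ (by positivity), one_smul, TensorProduct.neg_tmul]
  exact congrArg Neg.neg (L.symCoeff_tmul_vac hm)

/-- Applying `smul_hat_lam` to dt leaves the obstruction `hat symAct` (`lowerD lam` (d(ht))). The
tensor ht lies one filtration step lower, where D² = 0 is known by induction, and this forces the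
obstruction to vanish. -/
theorem hat_symAct_kD {k : ℕ} (ih : ∀ s ∈ L.symFil k, L.IsRepAt L.symAct s)
    {t : L.Sym ⊗[ℝ] L.Ext} (ht : t ∈ L.degT k 2) : L.hat L.symAct (L.kD L.symAct t) = 0 := by
  have hD : ∀ z, L.kD L.symAct z = L.hat L.symMul z + L.lowerD L.lam z := fun z => by
    rw [symAct, kD_add, LinearMap.add_apply]
  have hρ : ∀ z, L.hat L.symAct z = L.hat L.symMul z + L.hat L.lam z := fun z => by
    rw [symAct, hat_add, LinearMap.add_apply]
  have hDD : ∀ n, ∀ z ∈ L.filT k n, L.kD L.symAct (L.kD L.symAct z) = 0 := fun n z hz =>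
    L.map_filT_eq (f := L.kD L.symAct ∘ₗ L.kD L.symAct) (g := 0)
      (fun s hs w _ => L.kD_kD_tmul (ih s hs) w) hz
  have hy : L.symH t ∈ L.filT k 3 := L.symH_mem (L.degT_le_filT k 2 ht)
  have hv := L.isLower_lam.lowerD_mem hy
  have h1 : L.hat L.symAct (L.lowerD L.lam (L.hat L.symMul (L.symH t))) = 0 := by
    -- With y = ht, the relations D²y = 0 and d²y = 0 give `lowerD lam` (dy) = -D(`lowerD lam` y).
    have e1 : L.lowerD L.lam (L.hat L.symMul (L.symH t))
        = -L.kD L.symAct (L.lowerD L.lam (L.symH t)) := by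
      have e2 := hDD 3 _ hy
      rw [hD (L.symH t), map_add, hD (L.hat L.symMul (L.symH t)), hat_symMul_hat_symMul,
        zero_add] at e2
      exact eq_neg_of_add_eq_zero_left e2
    have e3 := hDD 2 _ hv
    -- In exterior degree 1 the bracket part is zero, so D there reduces to `hat symAct` and D² = 0
    -- applies once more.
    have e4 := L.lTensor_extBr_eq_zero_of_mem_one (L.isLower_lam.kD_mem hv)
    rw [kD, LinearMap.add_apply] at e3
    rw [e1, map_neg, neg_eq_zero]
    change L.extBr.lTensor L.Sym (L.kD L.symAct _) = 0 at e4
    change L.hat L.symAct (L.kD L.symAct _) + L.extBr.lTensor L.Sym (L.kD L.symAct _) = 0 at e3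
    rwa [e4, add_zero] at e3
  have h2 := L.smul_hat_lam (L.hat_symMul_mem_degT ht)
  have h3 : L.symH (L.hat L.symMul t) = ((k : ℝ) + 2) • t - L.hat L.symMul (L.symH t) := by
    have := L.homotopy ht
    rw [← eq_sub_iff_add_eq'] at this
    simpa using this
  rw [h3, map_sub, map_sub, h1, sub_zero, map_smul, map_smul] at h2
  have h4 : L.hat L.lam (L.hat L.symMul t) = -L.hat L.symAct (L.lowerD L.lam t) := by
    refine smul_right_injective _ (show ((k : ℝ) + 2) ≠ 0 by positivity) ?_
    refine Eq.trans ?_ (h2.trans (smul_neg _ _).symm)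
    push_cast
    module
  rw [hD, map_add, hρ (L.hat L.symMul t), hat_symMul_hat_symMul, zero_add, h4, neg_add_cancel]

variable {M : Type*} [AddCommGroup M] [Module ℝ M]

theorem IsRepAt.add {ρ : M →ₗ[ℝ] 𝔤 →ₗ[ℝ] M} {s t : M} (hs : L.IsRepAt ρ s)
    (ht : L.IsRepAt ρ t) : L.IsRepAt ρ (s + t) := by
  intro p q x y hx hy
  simp only [map_add, LinearMap.add_apply, ← hs hx hy, ← ht hx hy, smul_add]
  abel

/-- Evaluated on s ⊗ x ∧ y, the vanishing of D² is the action identity at s. The component of top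
degree comes from `hat_symAct_kD`, the rest from the induction hypothesis. -/
theorem isRepAt_symFil (k : ℕ) : ∀ s ∈ L.symFil k, L.IsRepAt L.symAct s := by
  induction k with
  | zero =>
    intro s hs p q x y _ _
    rw [symFil_zero, Submodule.mem_bot] at hs
    simp [hs]
  | succ k ih =>
    intro s hs
    rw [← add_sub_cancel (L.symProj k s) s]
    refine IsRepAt.add L ?_ (ih _ (L.sub_symProj_mem hs))
    intro p q x y hx hy
    have h := L.hat_symAct_kD ih (L.symProj_tmul_mem k s
      (L.extWedge_mem x (L.extWedge_mem y L.vac_mem)))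
    rw [kD_tmul, L.extract_extWedge_extWedge_vac hx hy, L.extBr_extWedge_extWedge_vac hx hy] at h
    simp only [map_sub, map_add, map_smul, LinearMap.rTensor_tmul, hat_tmul,
      TensorProduct.tmul_neg, map_neg, extract_extWedge_vac] at h
    have h' := congrArg L.symCoeff h
    simp only [map_sub, map_add, map_smul, map_neg, symCoeff_tmul, vacCoeff_vac, one_smul,
      map_zero] at h'
    exact add_neg_eq_zero.1 h'

theorem isRepAt_symAct (s : L.Sym) : L.IsRepAt L.symAct s := by
  obtain ⟨k, hk⟩ := L.exists_mem_symFil s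
  exact L.isRepAt_symFil k s hk

end

end RealGradedLieAlgebra

namespace RealGradedLieAlgebra

noncomputable section

variable {𝔤 : Type*} [AddCommGroup 𝔤] [Module ℝ 𝔤] (L : RealGradedLieAlgebra 𝔤)

/-! ### The comparison of the enveloping algebra with the symmetric algebra -/

/-- The map `U(𝔤) → S(𝔤)`, `u ↦ 1 · u`. -/
def symbol : L.Env →ₗ[ℝ] L.Sym := L.orbit L.symAct L.isRepAt_symAct 1

theorem symbol_one : L.symbol 1 = 1 := L.orbit_one _ _ _

theorem symbol_mul (u : L.Env) (x : 𝔤) :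
    L.symbol (u * L.envι x) = L.symAct (L.symbol u) x := L.orbit_mul _ _ _ _ _

theorem symAct_apply (s : L.Sym) (x : 𝔤) : L.symAct s x = L.symMul s x + L.lam s x := rfl

theorem symAct_mem {k : ℕ} {s : L.Sym} (hs : s ∈ L.symFil k) (x : 𝔤) :
    L.symAct s x ∈ L.symFil (k + 1) := L.isLower_lam.symMul_add_mem s hs x

/-- If t is the symbol of u, then t x + `lam` t x is the symbol of u x; the term in `lam` lies in a
lower step and is already reached. -/
theorem symFil_le_range_symbol (k : ℕ) : L.symFil k ≤ LinearMap.range L.symbol := by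
  induction k with
  | zero => rw [symFil_zero]; exact bot_le
  | succ k ih =>
    intro s hs
    rw [← add_sub_cancel (L.symProj k s) s]
    refine add_mem ?_ (ih (L.sub_symProj_mem hs))
    cases k with
    | zero =>
      rw [symProj_zero_apply, ← symbol_one]
      exact Submodule.smul_mem _ _ ⟨1, rfl⟩
    | succ k =>
      -- Only the component of degree k + 1 of s matters from here on, so s may be decomposed
      -- freely.
      clear hs
      induction s using L.sym_induction with
      | one => simp [symProj_one]
      | mul s p x hx _ =>
        have hk := L.symProj_mem (Nat.lt_succ_self k) s
        rw [symProj_succ_symMul, ← add_sub_cancel_right (L.symMul _ x) (L.lam (L.symProj k s) x),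
          ← symAct_apply]
        refine sub_mem ?_ (ih (L.isLower_lam _ hk x))
        obtain ⟨u, hu⟩ := ih hk
        exact ⟨u * L.envι x, by rw [symbol_mul, hu]⟩
      | add s t hs ht => rw [map_add]; exact add_mem hs ht
      | smul r s hs => rw [map_smul]; exact Submodule.smul_mem _ _ hs

theorem symbol_surjective : Function.Surjective L.symbol := by
  intro s
  obtain ⟨k, hk⟩ := L.exists_mem_symFil s
  exact L.symFil_le_range_symbol k hk

/-! ### The filtration of U(𝔤) by the number of factors -/

/-- The span of the products of fewer than `k` elements of `𝔤` in `U(𝔤)`. -/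
def envFil : ℕ → Submodule ℝ L.Env
  | 0 => ⊥
  | k + 1 => Submodule.span ℝ {1} ⊔ Submodule.map₂ L.envMul (envFil k) ⊤

theorem one_mem_envFil (k : ℕ) : 1 ∈ L.envFil (k + 1) :=
  Submodule.mem_sup_left (Submodule.mem_span_singleton_self 1)

theorem mul_mem_envFil {k : ℕ} {u : L.Env} (hu : u ∈ L.envFil k) (x : 𝔤) :
    u * L.envι x ∈ L.envFil (k + 1) :=
  Submodule.mem_sup_right (Submodule.apply_mem_map₂ L.envMul hu (Submodule.mem_top (x := x)))

theorem envFil_succ_le {k : ℕ} {Q : Submodule ℝ L.Env} (h1 : 1 ∈ Q)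
    (hm : ∀ u ∈ L.envFil k, ∀ x, u * L.envι x ∈ Q) : L.envFil (k + 1) ≤ Q :=
  sup_le (by simpa using h1) (Submodule.map₂_le.2 fun u hu x _ => hm u hu x)

theorem envFil_le_succ (k : ℕ) : L.envFil k ≤ L.envFil (k + 1) := by
  induction k with
  | zero => exact bot_le
  | succ k ih =>
    exact L.envFil_succ_le (L.one_mem_envFil _) fun u hu x => L.mul_mem_envFil (ih hu) x

theorem exists_mem_envFil (u : L.Env) : ∃ k, u ∈ L.envFil k := by
  have hm : Monotone L.envFil := monotone_nat_of_le_succ L.envFil_le_succ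
  have h : u ∈ ⨆ k, L.envFil k := by
    refine L.env_mem_of_mul_mem (P := ⨆ k, L.envFil k)
      (Submodule.mem_iSup_of_mem 1 (L.one_mem_envFil 0)) (fun u hu x => ?_) u
    obtain ⟨k, hk⟩ := (Submodule.mem_iSup_of_directed _ hm.directed_le).1 hu
    exact Submodule.mem_iSup_of_mem (k + 1) (L.mul_mem_envFil hk x)
  exact (Submodule.mem_iSup_of_directed _ hm.directed_le).1 h

theorem symbol_mem {k : ℕ} : ∀ u ∈ L.envFil k, L.symbol u ∈ L.symFil k := by
  induction k with
  | zero =>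
    intro u hu
    rw [(Submodule.mem_bot ℝ).1 hu, map_zero]
    exact zero_mem _
  | succ k ih =>
    intro u hu
    refine L.envFil_succ_le (Q := (L.symFil (k + 1)).comap L.symbol) ?_ (fun u hu x => ?_) hu
    · rw [Submodule.mem_comap, symbol_one]
      exact L.symFil_mono (by omega) L.one_mem_symFil
    · rw [Submodule.mem_comap, symbol_mul]
      exact L.symAct_mem (ih u hu) x

/-! ### Symmetrization and injectivity of the symbol -/

/-- Right multiplication `U(𝔤) ⊗ 𝔤 → U(𝔤)`. -/
def envMulT : L.Env ⊗[ℝ] 𝔤 →ₗ[ℝ] L.Env := TensorProduct.lift L.envMul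

@[simp] theorem envMulT_tmul (u : L.Env) (x : 𝔤) : L.envMulT (u ⊗ₜ x) = u * L.envι x := by
  simp [envMulT]

/-- The components of the symmetrization. -/
def symmSeq : ℕ → L.Sym →ₗ[ℝ] L.Env
  | 0 => Algebra.linearMap ℝ L.Env ∘ₗ L.symAug
  | k + 1 => ((k : ℝ) + 1)⁻¹ • (L.envMulT ∘ₗ (symmSeq k).rTensor 𝔤 ∘ₗ L.symExtract)

/-- The symmetrization `S(𝔤) → U(𝔤)`. -/
def symm : L.Sym →ₗ[ℝ] L.Env := L.symPiecewise L.symmSeq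

theorem symm_one : L.symm 1 = 1 := by
  have h : L.symProj 0 1 = 1 := by rw [symProj_one, if_pos rfl]
  rw [← h, symm, symPiecewise_symProj, h]
  simp [symmSeq, symAug_one]

theorem symm_symProj_succ (k : ℕ) (s : L.Sym) : ((k : ℝ) + 1) • L.symm (L.symProj (k + 1) s)
    = L.envMulT (L.symm.rTensor 𝔤 (L.symExtract (L.symProj (k + 1) s))) := by
  have h : L.symmSeq k ∘ₗ L.symProj k = L.symm ∘ₗ L.symProj k :=
    LinearMap.ext fun t => (L.symPiecewise_symProj L.symmSeq k t).symm
  conv_lhs => rw [symm, symPiecewise_symProj, symmSeq, LinearMap.smul_apply, smul_smul,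
    mul_inv_cancel₀ (by positivity), one_smul, LinearMap.comp_apply, LinearMap.comp_apply,
    symExtract_symProj_succ, ← LinearMap.comp_apply, ← LinearMap.comp_apply, LinearMap.comp_assoc,
    ← LinearMap.rTensor_comp, h, LinearMap.rTensor_comp]
  rw [symExtract_symProj_succ]
  rfl

/-- Symmetrization is multiplicative up to shorter products, because reordering two factors in U(𝔤)
costs a bracket. The bound on the length is proved jointly, as it controls the bracket terms. -/
theorem symm_symMul_sub_mem (k : ℕ) : ∀ s, L.symm (L.symProj k s) ∈ L.envFil (k + 1) ∧
    ∀ q y, y ∈ L.piece q → L.symm (L.symMul (L.symProj k s) y)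
      - L.symm (L.symProj k s) * L.envι y ∈ L.envFil (k + 1) := by
  have hsucc : ∀ (k : ℕ) s y, ((k : ℝ) + 1) • L.symm (L.symMul (L.symProj k s) y)
      = L.symm (L.symProj k s) * L.envι y
        + L.envMulT (L.symm.rTensor 𝔤 (L.symTwist y (L.symExtract (L.symProj k s)))) := by
    intro k s y
    rw [← symProj_succ_symMul, symm_symProj_succ, symProj_succ_symMul, symExtract_symMul, map_add,
      map_add, LinearMap.rTensor_tmul, envMulT_tmul]
  induction k with
  | zero =>
    intro s
    refine ⟨?_, fun q y hy => ?_⟩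
    · rw [symProj_zero_apply, map_smul, symm_one]
      exact Submodule.smul_mem _ _ (L.one_mem_envFil 0)
    · have := hsucc 0 s y
      rw [symExtract_symProj_zero] at this
      simp only [Nat.cast_zero, zero_add, one_smul, map_zero, add_zero] at this
      rw [this, sub_self]
      exact zero_mem _
  | succ k ih =>
    intro s
    constructor
    · have h := L.symm_symProj_succ k s
      rw [← inv_smul_smul₀ (show (k : ℝ) + 1 ≠ 0 by positivity) (L.symm _), h,
        symExtract_symProj_succ]
      refine Submodule.smul_mem _ _ ?_
      induction L.symExtract s using TensorProduct.induction_on with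
      | zero => simp
      | add z z' hz hz' => simp only [map_add]; exact add_mem hz hz'
      | tmul t x => simpa using L.mul_mem_envFil (ih t).1 x
    · intro q y hy
      have key : L.envMulT (L.symm.rTensor 𝔤 (L.symTwist y (L.symExtract (L.symProj (k + 1) s))))
          - L.envMulT (L.symm.rTensor 𝔤 (L.symExtract (L.symProj (k + 1) s))) * L.envι y
          ∈ L.envFil (k + 2) := by
        rw [symExtract_symProj_succ]
        refine LinearMap.congr_fun (f := (L.envFil (k + 2)).mkQ ∘ₗ
          ((L.envMulT ∘ₗ L.symm.rTensor 𝔤 ∘ₗ L.symTwist y)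
            - L.envMul.flip y ∘ₗ L.envMulT ∘ₗ L.symm.rTensor 𝔤) ∘ₗ (L.symProj k).rTensor 𝔤)
          (g := 0) (L.sym_tensor_hom_ext fun p x t hx => ?_) (L.symExtract s) |>
            (Submodule.Quotient.mk_eq_zero _).1
        refine (Submodule.Quotient.mk_eq_zero _).2 ?_
        simp only [LinearMap.comp_apply, LinearMap.sub_apply, LinearMap.rTensor_tmul,
          L.symTwist_tmul hx hy, map_smul, envMulT_tmul, LinearMap.flip_apply, envMul_apply]
        -- Moving x to the right of y splits the difference into the induction hypothesis times x
        -- and a bracket term, both short enough.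
        have e : chi p q • (L.symm (L.symMul (L.symProj k t) y) * L.envι x)
            - L.symm (L.symProj k t) * L.envι x * L.envι y
            = chi p q • ((L.symm (L.symMul (L.symProj k t) y)
                - L.symm (L.symProj k t) * L.envι y) * L.envι x)
              - L.symm (L.symProj k t) * L.envι (L.bracket x y) := by
          rw [← L.envι_mul_envι hx hy]
          simp only [sub_mul, mul_sub, smul_sub, mul_smul_comm, mul_assoc]
          abel
        rw [e]
        exact sub_mem (Submodule.smul_mem _ _ (L.mul_mem_envFil ((ih t).2 q y hy) x))
          (L.mul_mem_envFil (ih t).1 _)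
      have h1 := hsucc (k + 1) s y
      rw [← L.symm_symProj_succ k s, smul_mul_assoc] at key
      rw [← inv_smul_smul₀ (show ((k + 1 : ℕ) : ℝ) + 1 ≠ 0 by positivity)
        (L.symm (L.symMul (L.symProj (k + 1) s) y)
          - L.symm (L.symProj (k + 1) s) * L.envι y), smul_sub, h1]
      refine Submodule.smul_mem _ _ ?_
      convert key using 1
      push_cast
      module

theorem envFil_succ_le_sup (k : ℕ) : L.envFil (k + 1)
    ≤ (LinearMap.range (L.symProj k)).map L.symm ⊔ L.envFil k := by
  induction k with
  | zero =>
    refine L.envFil_succ_le (Submodule.mem_sup_left ⟨1, ⟨1, ?_⟩, L.symm_one⟩) fun u hu x => ?_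
    · rw [symProj_one, if_pos rfl]
    · rw [(Submodule.mem_bot ℝ).1 hu, zero_mul]
      exact zero_mem _
  | succ k ih =>
    refine L.envFil_succ_le (Submodule.mem_sup_right (L.one_mem_envFil k)) fun u hu x => ?_
    obtain ⟨_, ⟨_, ⟨s, rfl⟩, rfl⟩, v, hv, rfl⟩ := Submodule.mem_sup.1 (ih hu)
    rw [add_mul]
    refine add_mem ?_ (Submodule.mem_sup_right (L.mul_mem_envFil hv x))
    refine L.hom_induction (P := fun x => L.symm (L.symProj k s) * L.envι x ∈ _) x
      (fun p x hx => ?_) fun x y hx hy => ?_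
    · rw [← sub_sub_cancel (L.symm (L.symMul (L.symProj k s) x)) (L.symm _ * _)]
      refine sub_mem (Submodule.mem_sup_left ⟨_, ⟨L.symMul s x, ?_⟩, rfl⟩)
        (Submodule.mem_sup_right ((L.symm_symMul_sub_mem k s).2 p x hx))
      rw [symProj_succ_symMul]
    · rw [map_add, mul_add]
      exact add_mem hx hy

/-- Both sides obey the same recursion, extracting a factor and multiplying it back, except that on
the symbol the factor acts by `symAct` and not by `symMul`. The discrepancy is `lam`, which does not
raise the degree. -/
theorem symbol_symm_sub_mem (k : ℕ) (s : L.Sym) :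
    L.symbol (L.symm (L.symProj k s)) - L.symProj k s ∈ L.symFil k := by
  induction k generalizing s with
  | zero =>
    rw [symProj_zero_apply, map_smul, symm_one, map_smul, symbol_one, sub_self]
    exact zero_mem _
  | succ k ih =>
    rw [← inv_smul_smul₀ (show (k : ℝ) + 1 ≠ 0 by positivity)
        (L.symbol (L.symm (L.symProj (k + 1) s)) - L.symProj (k + 1) s), smul_sub, ← map_smul,
        symm_symProj_succ]
    refine Submodule.smul_mem _ _ ?_
    have h := L.symMulT_symExtract_symProj (k + 1) s
    push_cast at h
    rw [← h, symExtract_symProj_succ]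
    induction L.symExtract s using TensorProduct.induction_on with
    | zero => simp
    | add z z' hz hz' => simp only [map_add, add_sub_add_comm]; exact add_mem hz hz'
    | tmul t x =>
      simp only [LinearMap.rTensor_tmul, envMulT_tmul, symMulT_tmul, symbol_mul]
      have e : L.symAct (L.symbol (L.symm (L.symProj k t))) x - L.symMul (L.symProj k t) x
          = L.symAct (L.symbol (L.symm (L.symProj k t)) - L.symProj k t) x
            + L.lam (L.symProj k t) x := by
        rw [map_sub, LinearMap.sub_apply, symAct_apply L (L.symProj k t)]
        abel
      rw [e]
      exact add_mem (L.symAct_mem (ih t) x)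
        (L.isLower_lam _ (L.symProj_mem (Nat.lt_succ_self k) t) x)

/-- An element of the kernel is a symmetrized component plus shorter products. Comparing leading
terms puts that component in lower degree, so it is zero, and the length drops. -/
theorem symbol_injective : Function.Injective L.symbol := by
  rw [injective_iff_map_eq_zero]
  intro u hu
  obtain ⟨k, hk⟩ := L.exists_mem_envFil u
  induction k generalizing u with
  | zero => exact (Submodule.mem_bot ℝ).1 hk
  | succ k ih =>
    obtain ⟨_, ⟨_, ⟨s, rfl⟩, rfl⟩, v, hv, rfl⟩ := Submodule.mem_sup.1 (L.envFil_succ_le_sup k hk)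
    have h0 : L.symProj k s ∈ L.symFil k := by
      have e : L.symProj k s
          = -(L.symbol (L.symm (L.symProj k s)) - L.symProj k s) - L.symbol v := by
        rw [map_add] at hu
        rw [eq_neg_of_add_eq_zero_left hu]
        abel
      rw [e]
      exact sub_mem (neg_mem (L.symbol_symm_sub_mem k s)) (L.symbol_mem v hv)
    have h1 : L.symProj k s = 0 := by
      simpa [symProj_symProj] using h0 k le_rfl
    rw [h1, map_zero, zero_add] at hu ⊢
    exact ih v hu hv

end

end RealGradedLieAlgebra

namespace RealGradedLieAlgebra

noncomputable section

variable {𝔤 : Type*} [AddCommGroup 𝔤] [Module ℝ 𝔤] (L : RealGradedLieAlgebra 𝔤)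

/-! ### Exactness with coefficients in the symmetric algebra -/

theorem kD_symAct (z : L.Sym ⊗[ℝ] L.Ext) :
    L.kD L.symAct z = L.hat L.symMul z + L.lowerD L.lam z := by
  rw [symAct, kD_add, LinearMap.add_apply]

theorem symH_lowerD_mem {k n : ℕ} {z : L.Sym ⊗[ℝ] L.Ext} (hz : z ∈ L.filT (k + 1) n) :
    L.symH (L.lowerD L.lam z) ∈ L.filT k n := by
  cases n with
  | zero =>
    rw [lowerD, LinearMap.add_apply, L.hat_eq_zero _ hz, L.lTensor_extBr_eq_zero hz, add_zero,
      map_zero]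
    exact zero_mem _
  | succ n => exact L.symH_mem (L.isLower_lam.lowerD_mem hz)

theorem symH_hat_symMul_mem {k n : ℕ} {z : L.Sym ⊗[ℝ] L.Ext} (hz : z ∈ L.filT k n) :
    L.symH (L.hat L.symMul z) ∈ L.filT k n := by
  cases n with
  | zero =>
    rw [L.hat_eq_zero _ hz, map_zero]
    exact zero_mem _
  | succ n => exact L.symH_mem (L.hat_mem (fun s hs x => L.symMul_mem hs x) hz)

theorem hat_symMul_symH_mem {k n : ℕ} {z : L.Sym ⊗[ℝ] L.Ext} (hz : z ∈ L.filT k n) :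
    L.hat L.symMul (L.symH z) ∈ L.filT k n := by
  cases k with
  | zero =>
    rw [filT_zero, Submodule.mem_bot] at hz
    simp [hz]
  | succ k => exact L.hat_mem (fun s hs x => L.symMul_mem hs x) (L.symH_mem hz)

/-- The part of D beyond d does not raise the degree in S(𝔤) while h lowers it, so its contribution
falls into the previous step; on the top component, `homotopy` gives the scalar exactly. -/
theorem kD_homotopy_mem {k n : ℕ} {z : L.Sym ⊗[ℝ] L.Ext} (hz : z ∈ L.filT (k + 1) n) :
    L.kD L.symAct (L.symH z) + L.symH (L.kD L.symAct z) - ((k : ℝ) + n) • z ∈ L.filT k n := by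
  have hl : L.lowerD L.lam (L.symH z) ∈ L.filT k n := L.isLower_lam.lowerD_mem (L.symH_mem hz)
  have hl' := L.symH_lowerD_mem hz
  obtain ⟨a, ha, b, hb, rfl⟩ := L.exists_degT_add hz
  have h := L.homotopy ha
  have e : L.kD L.symAct (L.symH (a + b)) + L.symH (L.kD L.symAct (a + b))
        - ((k : ℝ) + n) • (a + b)
      = L.lowerD L.lam (L.symH (a + b)) + L.symH (L.lowerD L.lam (a + b))
        + (L.hat L.symMul (L.symH b) + L.symH (L.hat L.symMul b) - ((k : ℝ) + n) • b) := by
    rw [kD_symAct, kD_symAct, smul_add, ← h]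
    simp only [map_add]
    abel
  rw [e]
  exact add_mem (add_mem hl hl') (sub_mem (add_mem (L.hat_symMul_symH_mem hb)
    (L.symH_hat_symMul_mem hb)) (Submodule.smul_mem _ _ hb))

/-- For a cycle z, D(hz) is a nonzero multiple of z up to a cycle in the previous step, which is a
boundary by induction. -/
theorem exists_kD_eq {k n : ℕ} {z : L.Sym ⊗[ℝ] L.Ext} (hz : z ∈ L.filT k (n + 1))
    (h : L.kD L.symAct z = 0) : ∃ y, L.kD L.symAct y = z := by
  induction k generalizing z with
  | zero =>
    rw [filT_zero, Submodule.mem_bot] at hz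
    exact ⟨0, by rw [map_zero, hz]⟩
  | succ k ih =>
    have h1 := L.kD_homotopy_mem hz
    rw [h, map_zero, add_zero] at h1
    have h2 : L.kD L.symAct (L.kD L.symAct (L.symH z) - ((k : ℝ) + (n + 1 : ℕ)) • z) = 0 := by
      rw [map_sub, L.kD_kD L.isRepAt_symAct, map_smul, h, smul_zero, sub_zero]
    obtain ⟨y, hy⟩ := ih h1 h2
    have hc : (k : ℝ) + (n + 1 : ℕ) ≠ 0 := by positivity
    refine ⟨((k : ℝ) + (n + 1 : ℕ))⁻¹ • (L.symH z - y), ?_⟩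
    rw [map_smul, map_sub, hy, sub_sub_cancel, inv_smul_smul₀ hc]

theorem exists_kD_add_eq {k : ℕ} {z : L.Sym ⊗[ℝ] L.Ext} (hz : z ∈ L.filT k 0) :
    ∃ (y : L.Sym ⊗[ℝ] L.Ext) (c : ℝ), L.kD L.symAct y + c • ((1 : L.Sym) ⊗ₜ L.vac) = z := by
  induction k generalizing z with
  | zero =>
    rw [filT_zero, Submodule.mem_bot] at hz
    exact ⟨0, 0, by simp [hz]⟩
  | succ k ih =>
    -- The scalar k + n vanishes exactly for the constants, which therefore form a separate base
    -- case and account for the term in c.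
    cases k with
    | zero =>
      refine ⟨0, L.symAug (L.symCoeff z), ?_⟩
      have h1 := L.eq_sum_symProj (L.symCoeff_mem hz)
      rw [Finset.sum_range_one, symProj_zero_apply] at h1
      rw [map_zero, zero_add, TensorProduct.smul_tmul', ← h1, L.symCoeff_tmul_vac hz]
    | succ k =>
      have h1 := L.kD_homotopy_mem hz
      rw [kD, LinearMap.add_apply _ _ z, L.hat_eq_zero _ hz, L.lTensor_extBr_eq_zero hz, add_zero,
        map_zero, add_zero, ← kD] at h1
      obtain ⟨y, c, hy⟩ := ih h1
      have hc : ((k + 1 : ℕ) : ℝ) + (0 : ℕ) ≠ 0 := by positivity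
      refine ⟨(((k + 1 : ℕ) : ℝ) + (0 : ℕ))⁻¹ • (L.symH z - y),
        -((((k + 1 : ℕ) : ℝ) + (0 : ℕ))⁻¹ * c), ?_⟩
      have e : L.kD L.symAct (L.symH z) - L.kD L.symAct y - c • ((1 : L.Sym) ⊗ₜ L.vac)
          = (((k + 1 : ℕ) : ℝ) + (0 : ℕ)) • z := by
        rw [sub_sub, hy, sub_sub_cancel]
      refine Eq.trans ?_ (inv_smul_smul₀ hc z)
      rw [← e, map_smul, map_sub]
      module

/-! ### The Koszul complex of the enveloping algebra -/

/-- `kD` is natural in the right module, and the symbol intertwines right multiplication with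
`symAct`. -/
theorem rTensor_symbol_kD (z : L.Env ⊗[ℝ] L.Ext) :
    L.symbol.rTensor L.Ext (L.kD L.envMul z) = L.kD L.symAct (L.symbol.rTensor L.Ext z) := by
  refine LinearMap.congr_fun (f := L.symbol.rTensor L.Ext ∘ₗ L.kD L.envMul)
    (g := L.kD L.symAct ∘ₗ L.symbol.rTensor L.Ext) (TensorProduct.ext' fun u w => ?_) z
  have h : L.symbol ∘ₗ L.envMul u = L.symAct (L.symbol u) :=
    LinearMap.ext fun x => L.symbol_mul u x
  simp only [LinearMap.comp_apply, kD_tmul, map_add, LinearMap.rTensor_tmul]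
  rw [← LinearMap.comp_apply, ← LinearMap.rTensor_comp, h]

/-- The isomorphism of vector spaces `U(𝔤) ⊗ ⋀ 𝔤 ≃ S(𝔤) ⊗ ⋀ 𝔤`. -/
def symbolEquiv : L.Env ⊗[ℝ] L.Ext ≃ₗ[ℝ] L.Sym ⊗[ℝ] L.Ext :=
  LinearEquiv.rTensor L.Ext
    (LinearEquiv.ofBijective L.symbol ⟨L.symbol_injective, L.symbol_surjective⟩)

theorem symbolEquiv_apply (z : L.Env ⊗[ℝ] L.Ext) :
    L.symbolEquiv z = L.symbol.rTensor L.Ext z := rfl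

theorem symbolEquiv_kD (z : L.Env ⊗[ℝ] L.Ext) :
    L.symbolEquiv (L.kD L.envMul z) = L.kD L.symAct (L.symbolEquiv z) := L.rTensor_symbol_kD z

theorem exists_symbolEquiv_mem {n : ℕ} (z : L.Chain n) :
    ∃ k, L.symbolEquiv ((L.extOf n).lTensor L.Env z) ∈ L.filT k n := by
  induction z using TensorProduct.induction_on with
  | zero => exact ⟨0, by simp⟩
  | add z z' hz hz' =>
    obtain ⟨k, hk⟩ := hz
    obtain ⟨k', hk'⟩ := hz'
    refine ⟨max k k', ?_⟩
    rw [map_add, map_add]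
    exact add_mem (L.filT_mono (le_max_left _ _) n hk) (L.filT_mono (le_max_right _ _) n hk')
  | tmul u w =>
    obtain ⟨k, hk⟩ := L.exists_mem_symFil (L.symbol u)
    exact ⟨k, by simpa [symbolEquiv_apply] using L.tmul_mem_filT hk ⟨w, rfl⟩⟩

/-- Extracting two factors counts each pair i < j twice with equal contributions, and the factor
-1/2 in `extBr` compensates. -/
theorem extBr_extOf_wedge {m : ℕ} {d : Fin (m + 2) → ℤ} {a : Fin (m + 2) → 𝔤}
    (ha : ∀ k, a k ∈ L.piece (d k)) :
    L.extBr (L.extOf (m + 2) (L.wedge (m + 2) a))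
      = ∑ i : Fin (m + 2), ∑ j' : Fin (m + 1) with i < j'.succ,
        ((-1 : ℝ) ^ ((i : ℕ) + (j'.succ : ℕ)) * sign₂ d i j'.succ) •
          L.extOf (m + 1) (L.wedge (m + 1)
            (Fin.cons (L.bracket (a i) (a j'.succ)) (j'.removeNth (i.removeNth a)))) := by
  have key : L.wedgeT (L.br (L.extract₂ (L.extOf (m + 2) (L.wedge (m + 2) a))))
      = L.extOf (m + 1) (∑ i : Fin (m + 2), ∑ j : Fin (m + 1),
        (((-1 : ℝ) ^ (i : ℕ) * sign₁ d i) * ((-1 : ℝ) ^ (j : ℕ) * sign₁ (i.removeNth d) j)) •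
          L.wedge (m + 1) (Fin.cons (L.bracket (a i) (i.removeNth a j))
            (j.removeNth (i.removeNth a)))) := by
    rw [extract₂, LinearMap.comp_apply, extract_extOf_succ, L.powExtract_wedge ha]
    simp only [map_sum, map_smul, LinearMap.lTensor_tmul, extract_extOf_succ]
    refine Finset.sum_congr rfl fun i _ => ?_
    rw [L.powExtract_wedge (d := i.removeNth d) (a := i.removeNth a) (fun k => ha _)]
    simp only [map_sum, map_smul, LinearMap.lTensor_tmul, TensorProduct.tmul_sum,
      TensorProduct.tmul_smul, br_tmul, wedgeT_tmul, extWedge_extOf, L.powWedge_wedge,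
      Finset.smul_sum, smul_smul]
  rw [sum_halves _ (fun i j hij => L.double_symm d a ha i j hij)] at key
  rw [extBr_apply, key, map_smul, smul_smul, map_sum, Finset.smul_sum]
  refine Finset.sum_congr rfl fun i _ => ?_
  rw [map_sum, Finset.smul_sum]
  refine Finset.sum_congr rfl fun j hj => ?_
  have hij : i < j.succ := by simpa using hj
  have e2 : i.succAbove j = j.succ := Fin.succAbove_of_lt_succ _ _ hij
  have ej : i.removeNth a j = a j.succ := by rw [Fin.removeNth, e2]
  rw [ej, map_smul, smul_smul, sign₁_removeNth, e2]
  congr 1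
  simp only [sign₂, sign₁, pow_add, Fin.val_succ]
  ring

theorem lTensor_extOf_koszulD (n : ℕ) (z : L.Chain (n + 1)) :
    (L.extOf n).lTensor L.Env (L.koszulD n z)
      = L.kD L.envMul ((L.extOf (n + 1)).lTensor L.Env z) := by
  induction z using TensorProduct.induction_on with
  | zero => simp
  | add z z' hz hz' => simp only [map_add, hz, hz']
  | tmul u w =>
    refine L.hom_wedge_mem (P := LinearMap.eqLocus
      ((L.extOf n).lTensor L.Env ∘ₗ (L.koszulD n).restrictScalars ℝ ∘ₗ TensorProduct.mk ℝ L.Env _ u)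
      (L.kD L.envMul ∘ₗ (L.extOf (n + 1)).lTensor L.Env ∘ₗ TensorProduct.mk ℝ L.Env _ u))
      (fun d a ha => ?_) w
    simp only [LinearMap.mem_eqLocus, LinearMap.comp_apply, TensorProduct.mk_apply,
      LinearMap.restrictScalars_apply, LinearMap.lTensor_tmul, kD_tmul,
      L.isKoszulDifferential_koszulD n d u a ha, map_add]
    congr 1
    · simp only [actionSum, map_sum, map_smul, LinearMap.lTensor_tmul, extract_extOf_succ,
        L.powExtract_wedge ha, LinearMap.rTensor_tmul, envMul_apply]
    · cases n with
      | zero => simp [bracketSum, L.extBr_eq_zero ⟨_, rfl⟩]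
      | succ m =>
        rw [L.extBr_extOf_wedge ha, bracketSum]
        simp only [map_sum, map_smul, LinearMap.lTensor_tmul, TensorProduct.tmul_sum,
          TensorProduct.tmul_smul]

/-! ### Passage between `Chain n` and the total space -/

theorem lTensor_extProj_lTensor_extOf (n : ℕ) (z : L.Chain n) :
    (L.extProj n).lTensor L.Env ((L.extOf n).lTensor L.Env z) = z := by
  have h : L.extProj n ∘ₗ L.extOf n = LinearMap.id := LinearMap.ext (L.extProj_extOf n)
  rw [← LinearMap.comp_apply, ← LinearMap.lTensor_comp, h, LinearMap.lTensor_id,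
    LinearMap.id_apply]

theorem lTensor_extProj_lTensor_extOf_of_ne {m n : ℕ} (hmn : m ≠ n) (z : L.Chain m) :
    (L.extProj n).lTensor L.Env ((L.extOf m).lTensor L.Env z) = 0 := by
  have h : L.extProj n ∘ₗ L.extOf m = 0 := LinearMap.ext (L.extProj_extOf_of_ne hmn)
  rw [← LinearMap.comp_apply, ← LinearMap.lTensor_comp, h, LinearMap.lTensor_zero,
    LinearMap.zero_apply]

theorem lTensor_extOf_injective (n : ℕ) : Function.Injective ((L.extOf n).lTensor L.Env) :=
  Function.LeftInverse.injective (L.lTensor_extProj_lTensor_extOf n)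

/-- A preimage found in the total space may have components in every exterior degree. The
differential is homogeneous, so projecting to degree n + 1 keeps the part that matters. -/
theorem lTensor_extProj_kD (n : ℕ) (y : L.Env ⊗[ℝ] L.Ext) :
    (L.extProj n).lTensor L.Env (L.kD L.envMul y)
      = L.koszulD n ((L.extProj (n + 1)).lTensor L.Env y) := by
  induction y using TensorProduct.induction_on with
  | zero => simp
  | add y y' hy hy' => simp only [map_add, hy, hy']
  | tmul u w =>
    refine L.ext_mem (P := LinearMap.eqLocus
      ((L.extProj n).lTensor L.Env ∘ₗ L.kD L.envMul ∘ₗ TensorProduct.mk ℝ L.Env _ u)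
      ((L.koszulD n).restrictScalars ℝ ∘ₗ (L.extProj (n + 1)).lTensor L.Env ∘ₗ
        TensorProduct.mk ℝ L.Env _ u)) (fun m w => ?_) w
    simp only [LinearMap.mem_eqLocus, LinearMap.comp_apply, TensorProduct.mk_apply,
      LinearMap.restrictScalars_apply]
    rw [← LinearMap.lTensor_tmul]
    cases m with
    | zero =>
      rw [L.lTensor_extProj_lTensor_extOf_of_ne (Nat.succ_ne_zero n).symm, map_zero,
        LinearMap.lTensor_tmul, kD_tmul, extract_extOf_zero,
        L.extBr_eq_zero_of_mem_zero ⟨w, rfl⟩]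
      simp
    | succ m =>
      rw [← lTensor_extOf_koszulD]
      by_cases h : m = n
      · subst h
        rw [lTensor_extProj_lTensor_extOf, lTensor_extProj_lTensor_extOf]
      · rw [L.lTensor_extProj_lTensor_extOf_of_ne h,
          L.lTensor_extProj_lTensor_extOf_of_ne (by omega), map_zero]

/-! ### The augmentation and the exactness statements -/

/-- The augmentation on `U(𝔤) ⊗ ⋀ 𝔤`. -/
def totalAug : L.Env ⊗[ℝ] L.Ext →ₗ[ℝ] ℝ :=
  LinearMap.mul' ℝ ℝ ∘ₗ TensorProduct.map L.augmentation.toLinearMap L.vacCoeff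

@[simp] theorem totalAug_tmul (u : L.Env) (w : L.Ext) :
    L.totalAug (u ⊗ₜ w) = L.augmentation u * L.vacCoeff w := by
  simp [totalAug]

theorem koszulAug_eq (z : L.Chain 0) :
    L.koszulAug z = L.totalAug ((L.extOf 0).lTensor L.Env z) := by
  induction z using TensorProduct.induction_on with
  | zero => simp
  | add z z' hz hz' => simp only [map_add, hz, hz']
  | tmul u w => simp [koszulAug, vacCoeff]

theorem vacCoeff_extWedge (x : 𝔤) (w : L.Ext) : L.vacCoeff (L.extWedge x w) = 0 :=
  L.ext_mem (P := LinearMap.ker (L.vacCoeff ∘ₗ L.extWedge x)) (fun n w => by simp [vacCoeff]) w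

theorem vacCoeff_extBr (w : L.Ext) : L.vacCoeff (L.extBr w) = 0 := by
  have h : L.vacCoeff ∘ₗ L.wedgeT = 0 :=
    TensorProduct.ext' fun x w => by simp [vacCoeff_extWedge]
  rw [extBr_apply, map_smul, ← LinearMap.comp_apply, h, LinearMap.zero_apply, smul_zero]

theorem totalAug_kD (z : L.Env ⊗[ℝ] L.Ext) : L.totalAug (L.kD L.envMul z) = 0 := by
  refine LinearMap.congr_fun (f := L.totalAug ∘ₗ L.kD L.envMul) (g := 0)
    (TensorProduct.ext' fun u w => ?_) z
  rw [LinearMap.comp_apply, kD_tmul, map_add, totalAug_tmul, vacCoeff_extBr, mul_zero, add_zero]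
  induction L.extract w using TensorProduct.induction_on with
  | zero => simp
  | add z z' hz hz' => rw [map_add, map_add, hz, hz']; simp
  | tmul x v => simp [augmentation_mul_envι]

theorem koszulAug_surjective : Function.Surjective L.koszulAug := fun c =>
  ⟨(c • (1 : L.Env)) ⊗ₜ L.wedge 0 Fin.elim0, by rw [koszulAug_tmul, map_smul, map_one]; simp⟩

theorem exact_koszulD_koszulAug : Function.Exact (L.koszulD 0) L.koszulAug := by
  intro z
  constructor
  · intro hz
    obtain ⟨k, hk⟩ := L.exists_symbolEquiv_mem z
    obtain ⟨y, c, hy⟩ := L.exists_kD_add_eq hk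
    have h1 : L.symbolEquiv (1 ⊗ₜ L.vac) = (1 : L.Sym) ⊗ₜ L.vac := by
      rw [symbolEquiv_apply, LinearMap.rTensor_tmul, symbol_one]
    obtain ⟨y, rfl⟩ := L.symbolEquiv.surjective y
    rw [← symbolEquiv_kD, ← h1, ← map_smul, ← map_add] at hy
    have hy' := L.symbolEquiv.injective hy
    -- The augmentation kills boundaries and takes the value 1 on the unit, so it reads off c.
    have hc : c = 0 := by
      have := congrArg L.totalAug hy'
      rwa [← koszulAug_eq, hz, map_add, totalAug_kD, map_smul, totalAug_tmul, map_one,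
        vacCoeff_vac, mul_one, zero_add, smul_eq_mul, mul_one] at this
    rw [hc, zero_smul, add_zero] at hy'
    refine ⟨(L.extProj 1).lTensor L.Env y, ?_⟩
    rw [← lTensor_extProj_kD, hy', lTensor_extProj_lTensor_extOf]
  · rintro ⟨y, rfl⟩
    rw [koszulAug_eq, lTensor_extOf_koszulD, totalAug_kD]

theorem exact_koszulD_koszulD (n : ℕ) : Function.Exact (L.koszulD (n + 1)) (L.koszulD n) := by
  intro z
  constructor
  · intro hz
    obtain ⟨k, hk⟩ := L.exists_symbolEquiv_mem z
    obtain ⟨y, hy⟩ := L.exists_kD_eq hk (by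
      rw [← symbolEquiv_kD, ← lTensor_extOf_koszulD, hz, map_zero, map_zero])
    obtain ⟨y, rfl⟩ := L.symbolEquiv.surjective y
    rw [← symbolEquiv_kD] at hy
    refine ⟨(L.extProj (n + 2)).lTensor L.Env y, ?_⟩
    rw [← lTensor_extProj_kD, L.symbolEquiv.injective hy, lTensor_extProj_lTensor_extOf]
  · rintro ⟨y, rfl⟩
    apply L.lTensor_extOf_injective
    rw [lTensor_extOf_koszulD, lTensor_extOf_koszulD, L.kD_kD L.isRepAt_envMul, map_zero]

end

end RealGradedLieAlgebra

theorem mainTheorem4 {𝔤 : Type*} [AddCommGroup 𝔤] [Module ℝ 𝔤] (L : RealGradedLieAlgebra 𝔤) :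
    Function.Surjective L.koszulAug ∧
    Function.Exact (L.koszulD 0) L.koszulAug ∧
    ∀ n : ℕ, Function.Exact (L.koszulD (n + 1)) (L.koszulD n) :=
  ⟨L.koszulAug_surjective, L.exact_koszulD_koszulAug, L.exact_koszulD_koszulD⟩
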